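/- Let $\Delta\subset(\mathbb R^n)^*$ be a reflexive polytope, i.e. an $n$-dimensional lattice polytope such that each facet $F$ of $\Delta$ lies on the hyperplane $\langle m,v_F\rangle=-1$, where $v_F\in\mathbb Z^n$ is the primitive inward conormal vector of $F$. Let $X=\operatorname{Proj}\bigoplus_{k\ge 0}\bigoplus_{m\in k\Delta\cap\mathbb Z^n}\mathbb C\,\chi^m t^k$ be the associated complex projective toric variety, let $D_F\subset X$ be the torus-invariant prime divisor of the facet $F$, and let $K_X=-\sum_F D_F$ be the canonical divisor, which is Cartier. Let $Y\subset X$ be an anticanonical hypersurface, i.e. any member of the linear system $|-K_X|$ (in particular, a generic one), and let $\mathcal L$ be the restriction to $Y$ of the line bundle $\mathcal O_X(-(n-1)K_X)$. Let $D^b(Y)$ be the bounded derived category of coherent sheaves on $Y$, and put $\mathrm{Ext}^r(\mathcal E,\mathcal F)=\mathrm{Hom}_{D^b(Y)}(\mathcal E,\mathcal F[r])$. If $\mathcal F$ is a nonzero object of $D^b(Y)$, then there exist integers $i_0=i_0(\mathcal F)$ and $r=r(\mathcal F)$ such that $\mathrm{Ext}^r(\mathcal L^{\otimes i},\mathcal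 F)\neq 0$ for every integer $i\le i_0$. -/

import Mathlib

open CategoryTheory Limits AlgebraicGeometry TopologicalSpace

noncomputable section

namespace ToricCY

/-! ### Sheaves of modules on a scheme -/

section Generalities

universe u v₁ u₁
variable {C : Type u₁} [Category.{v₁} C] {J : GrothendieckTopology C} {R : Sheaf J RingCat.{u}}
  [∀ X, HasSheafify (J.over X) AddCommGrpCat.{u}]
  [∀ X, (J.over X).WEqualsLocallyBijective AddCommGrpCat.{u}]

lemma isFiniteType_of_iso {M N : SheafOfModules.{u} R} (e : M ≅ N) (h : M.IsFiniteType) :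
    N.IsFiniteType := by
  obtain ⟨σ, hσ⟩ := h
  refine ⟨{ I := σ.I, X := σ.X, coversTop := σ.coversTop
            generators := fun i ↦ (σ.generators i).ofEpi (e.hom.over (σ.X i)) }, ⟨fun i ↦ ?_⟩⟩
  have := hσ.isFiniteType i
  dsimp
  infer_instance

variable [HasSheafify J AddCommGrpCat.{u}] [J.WEqualsLocallyBijective AddCommGrpCat.{u}]
  [HasBinaryProducts C]

lemma isFiniteType_of_isZero {M : SheafOfModules.{u} R} (h : IsZero M) : M.IsFiniteType := by
  let G : SheafOfModules.GeneratingSections M :=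
    { I := PEmpty, s := fun i ↦ i.elim, epi := h.epi _ }
  have hG : G.IsFiniteType := ⟨inferInstanceAs (Finite PEmpty)⟩
  exact ⟨G.localGeneratorsData, ⟨fun _ ↦ ⟨inferInstanceAs (Finite PEmpty)⟩⟩⟩

lemma isQuasicoherent_of_isZero {M : SheafOfModules.{u} R} (h : IsZero M) :
    M.IsQuasicoherent := by
  let G : SheafOfModules.GeneratingSections M :=
    { I := PEmpty, s := fun i ↦ i.elim, epi := h.epi _ }
  have h0 : IsZero (SheafOfModules.free (R := R) PEmpty.{u+1}) := by
    rw [IsZero.iff_id_eq_zero]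
    apply (SheafOfModules.freeHomEquiv _).injective
    funext i; exact i.elim
  let P : M.Presentation :=
    { generators := G
      relations := { I := PEmpty, s := fun i ↦ i.elim
                     epi := ((h0.of_mono (kernel.ι G.π)).epi _) } }
  exact P.isQuasicoherent
end Generalities

section Modules

variable {X : Scheme.{0}}

/-- `𝒪_X` as a module over itself. -/
def structureModule (X : Scheme.{0}) : X.Modules := SheafOfModules.unit X.ringCatSheaf

/-- `M ⊗ N` over `𝒪_X`: the sheaf associated with `U ↦ M(U) ⊗ N(U)`. -/
def tensorModule (M N : X.Modules) : X.Modules :=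
  (PresheafOfModules.sheafification (𝟙 X.ringCatSheaf.obj)).obj
    (PresheafOfModules.Monoidal.tensorObj (R := X.presheaf) M.val N.val)

/-- The ideal sheaf of the closed subscheme `i : Z → X`, as the kernel of `𝒪_X → i_* 𝒪_Z`. -/
def idealModule (I : X.IdealSheafData) : X.Modules :=
  kernel (SheafOfModules.unitToPushforwardObjUnit I.subschemeι.toRingCatSheafHom :
    structureModule X ⟶ (Scheme.Modules.pushforward I.subschemeι).obj (structureModule I.subscheme))

/-- Sections over `U` of the sheaf `ℋom(M, 𝒪_X)`: the families of `𝒪_X(V)`-linear maps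
`M(V) → 𝒪_X(V)`, for `V ⊆ U` open, that commute with restriction (that is, the morphisms
`M|_U → 𝒪_U`). -/
def dualSections (M : X.Modules) (U : X.Opens) :
    AddSubgroup (∀ V : {V : X.Opens // V ≤ U}, Γ(M, V.1) →ₗ[Γ(X, V.1)] Γ(X, V.1)) where
  carrier := {φ | ∀ (V W : {V : X.Opens // V ≤ U}) (h : W.1 ≤ V.1) (x : Γ(M, V.1)),
    X.presheaf.map (homOfLE h).op (φ V x) = φ W (M.presheaf.map (homOfLE h).op x)}
  zero_mem' := by intro V W h x; simp
  add_mem' := by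
    intro a b ha hb V W h x
    simp [ha V W h x, hb V W h x]
  neg_mem' := by
    intro a ha V W h x
    simp [ha V W h x]

/-- `(r φ)_V = r|_V φ_V`. -/
instance (M : X.Modules) (U : X.Opens) : Module Γ(X, U) (dualSections M U) where
  smul r φ := ⟨fun V ↦ X.presheaf.map (homOfLE V.2).op r • φ.1 V, by
    intro V W h x
    simp only [LinearMap.smul_apply, smul_eq_mul, map_mul]
    rw [φ.2 V W h x, ← CommRingCat.comp_apply, ← Functor.map_comp]
    rfl⟩
  one_smul φ := by
    apply Subtype.ext; funext V
    change X.presheaf.map (homOfLE V.2).op 1 • φ.1 V = φ.1 V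
    simp
  mul_smul r s φ := by
    apply Subtype.ext; funext V
    change X.presheaf.map (homOfLE V.2).op (r * s) • φ.1 V =
      X.presheaf.map (homOfLE V.2).op r • X.presheaf.map (homOfLE V.2).op s • φ.1 V
    rw [map_mul, mul_smul]
  smul_zero r := by
    apply Subtype.ext; funext V
    exact smul_zero _
  smul_add r φ ψ := by
    apply Subtype.ext; funext V
    exact smul_add _ _ _
  add_smul r s φ := by
    apply Subtype.ext; funext V
    change X.presheaf.map (homOfLE V.2).op (r + s) • φ.1 V =
      X.presheaf.map (homOfLE V.2).op r • φ.1 V + X.presheaf.map (homOfLE V.2).op s • φ.1 V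
    rw [map_add, add_smul]
  zero_smul φ := by
    apply Subtype.ext; funext V
    change X.presheaf.map (homOfLE V.2).op 0 • φ.1 V = 0
    rw [map_zero, zero_smul]

def dualRestrict (M : X.Modules) {U V : X.Opens} (h : V ≤ U) :
    dualSections M U →+ dualSections M V where
  toFun φ := ⟨fun W ↦ φ.1 ⟨W.1, W.2.trans h⟩, fun W W' h' x ↦
    φ.2 ⟨W.1, W.2.trans h⟩ ⟨W'.1, W'.2.trans h⟩ h' x⟩
  map_zero' := rfl
  map_add' _ _ := rfl

def dualPresheaf (M : X.Modules) : TopCat.Presheaf Ab X where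
  obj U := AddCommGrpCat.of (dualSections M U.unop)
  map f := AddCommGrpCat.ofHom (dualRestrict M f.unop.le)
  map_id _ := by ext φ; rfl
  map_comp _ _ := by ext φ; rfl

instance (M : X.Modules) (U : (Opens X)ᵒᵖ) :
    Module (X.ringCatSheaf.obj.obj U) ((dualPresheaf M).obj U) :=
  inferInstanceAs (Module Γ(X, U.unop) (dualSections M U.unop))

lemma dualPresheaf_map_smul (M : X.Modules) {U V : (Opens X)ᵒᵖ} (f : U ⟶ V)
    (r : X.ringCatSheaf.obj.obj U) (φ : (dualPresheaf M).obj U) :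
    (dualPresheaf M).map f (r • φ) = X.ringCatSheaf.obj.map f r • (dualPresheaf M).map f φ := by
  refine Subtype.ext (a1 := (_ : dualSections M V.unop)) (a2 := (_ : dualSections M V.unop)) ?_
  funext W
  exact congrArg (· • φ.1 ⟨W.1, W.2.trans f.unop.le⟩)
    (ConcreteCategory.congr_hom (X.presheaf.map_comp f (homOfLE W.2).op) r)

lemma res_res (X : Scheme.{0}) {U V W : X.Opens} (h : V ≤ U) (h' : W ≤ V) (a : Γ(X, U)) :
    X.presheaf.map (homOfLE h').op (X.presheaf.map (homOfLE h).op a) =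
      X.presheaf.map (homOfLE (h'.trans h)).op a :=
  (ConcreteCategory.congr_hom (X.presheaf.map_comp (homOfLE h).op (homOfLE h').op) a).symm

lemma res_res_module (M : X.Modules) {U V W : X.Opens} (h : V ≤ U) (h' : W ≤ V) (a : Γ(M, U)) :
    M.presheaf.map (homOfLE h').op (M.presheaf.map (homOfLE h).op a) =
      M.presheaf.map (homOfLE (h'.trans h)).op a :=
  (ConcreteCategory.congr_hom (M.presheaf.map_comp (homOfLE h).op (homOfLE h').op) a).symm

lemma dualSections_glue (M : X.Modules) {ι : Type} (U : ι → X.Opens)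
    (sf : ∀ i, dualSections M (U i))
    (hsf : ∀ i j (W : X.Opens) (hi : W ≤ U i) (hj : W ≤ U j), (sf i).1 ⟨W, hi⟩ = (sf j).1 ⟨W, hj⟩) :
    ∃! φ : dualSections M (iSup U), ∀ i (W : X.Opens) (hi : W ≤ U i),
      φ.1 ⟨W, hi.trans (le_iSup U i)⟩ = (sf i).1 ⟨W, hi⟩ := by
  have cov (V : X.Opens) (hV : V ≤ iSup U) : V ≤ ⨆ i, V ⊓ U i := by
    rw [← inf_iSup_eq]; exact le_inf le_rfl hV
  have key (V : {V : X.Opens // V ≤ iSup U}) (x : Γ(M, V.1)) :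
      ∃! s : Γ(X, V.1), ∀ i, X.presheaf.map (homOfLE (inf_le_left : V.1 ⊓ U i ≤ V.1)).op s =
        (sf i).1 ⟨V.1 ⊓ U i, inf_le_right⟩
          (M.presheaf.map (homOfLE (inf_le_left : V.1 ⊓ U i ≤ V.1)).op x) := by
    refine X.sheaf.existsUnique_gluing' (fun i ↦ V.1 ⊓ U i) V.1 (fun i ↦ homOfLE inf_le_left)
      (cov V.1 V.2) (fun i ↦ (sf i).1 ⟨V.1 ⊓ U i, inf_le_right⟩
        (M.presheaf.map (homOfLE (inf_le_left : V.1 ⊓ U i ≤ V.1)).op x)) ?_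
    intro i j
    have hi := (sf i).2 ⟨V.1 ⊓ U i, inf_le_right⟩ ⟨(V.1 ⊓ U i) ⊓ (V.1 ⊓ U j),
      inf_le_left.trans inf_le_right⟩ inf_le_left
      (M.presheaf.map (homOfLE (inf_le_left : V.1 ⊓ U i ≤ V.1)).op x)
    have hj := (sf j).2 ⟨V.1 ⊓ U j, inf_le_right⟩ ⟨(V.1 ⊓ U i) ⊓ (V.1 ⊓ U j),
      inf_le_right.trans inf_le_right⟩ inf_le_right
      (M.presheaf.map (homOfLE (inf_le_left : V.1 ⊓ U j ≤ V.1)).op x)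
    refine hi.trans (Eq.trans ?_ hj.symm)
    rw [hsf i j _ _ (inf_le_right.trans inf_le_right), res_res_module, res_res_module]
  choose g hg hu using key
  have ext (V : {V : X.Opens // V ≤ iSup U}) (a b : Γ(X, V.1))
      (h : ∀ i, X.presheaf.map (homOfLE (inf_le_left : V.1 ⊓ U i ≤ V.1)).op a =
        X.presheaf.map (homOfLE (inf_le_left : V.1 ⊓ U i ≤ V.1)).op b) : a = b :=
    X.sheaf.eq_of_locally_eq' (fun i ↦ V.1 ⊓ U i) V.1 (fun i ↦ homOfLE inf_le_left)
      (cov V.1 V.2) a b h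
  let φ : dualSections M (iSup U) := ⟨fun V ↦
    { toFun := g V
      map_add' := fun x y ↦ ext V _ _ fun i ↦ by
        rw [map_add, hg, hg, hg, map_add, map_add]
      map_smul' := fun r x ↦ ext V _ _ fun i ↦ by
        rw [RingHom.id_apply, smul_eq_mul, map_mul, hg, hg, Scheme.Modules.map_smul, map_smul,
          smul_eq_mul] }, by
    intro V W h x
    refine ext W _ _ fun i ↦ ?_
    change X.presheaf.map _ (X.presheaf.map _ (g V x)) = X.presheaf.map _ (g W _)
    rw [hg, res_res, res_res_module,
      ← res_res X (inf_le_left : V.1 ⊓ U i ≤ V.1) (inf_le_inf_right (U i) h), hg,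
      (sf i).2 ⟨V.1 ⊓ U i, inf_le_right⟩ ⟨W.1 ⊓ U i, inf_le_right⟩ (inf_le_inf_right (U i) h),
      res_res_module]⟩
  refine ⟨φ, ?_, ?_⟩
  · intro i W hi
    ext x
    refine (hu ⟨W, hi.trans (le_iSup U i)⟩ x _ fun j ↦ ?_).symm
    rw [(sf i).2 ⟨W, hi⟩ ⟨W ⊓ U j, inf_le_left.trans hi⟩ inf_le_left, hsf i j _ _ inf_le_right]
  · intro ψ hψ
    refine Subtype.ext (funext fun V ↦ LinearMap.ext fun x ↦ hu V x _ fun i ↦ ?_)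
    rw [ψ.2 V ⟨V.1 ⊓ U i, inf_le_left.trans V.2⟩ inf_le_left, ← hψ i]

lemma dualPresheaf_isSheaf (M : X.Modules) : (dualPresheaf M).IsSheaf := by
  rw [TopCat.Presheaf.isSheaf_iff_isSheafUniqueGluing]
  intro ι U sf hsf
  have h := dualSections_glue M U sf (fun i j W hi hj ↦
    congrFun (congrArg Subtype.val (hsf i j :
      dualRestrict M inf_le_left (sf i) = dualRestrict M inf_le_right (sf j))) ⟨W, le_inf hi hj⟩)
  obtain ⟨φ, hφ, hu⟩ := h
  refine ⟨φ, fun i ↦ ?_, fun ψ hψ ↦ hu ψ fun i W hi ↦ ?_⟩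
  · exact Subtype.ext (a1 := (_ : dualSections M (U i))) (a2 := (_ : dualSections M (U i)))
      (funext fun W ↦ hφ i W.1 W.2)
  · exact congrFun (congrArg Subtype.val (hψ i :
      dualRestrict M (le_iSup U i) ψ = sf i)) ⟨W, hi⟩

/-- The dual sheaf `ℋom(M, 𝒪_X)`. -/
def dualModule (M : X.Modules) : X.Modules :=
  { val := PresheafOfModules.ofPresheaf (dualPresheaf M)
      (fun _ _ f r φ ↦ dualPresheaf_map_smul M f r φ)
    isSheaf := dualPresheaf_isSheaf M }

/-- `M^{⊗ k}` for a natural number `k`. -/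
def tensorNPow (M : X.Modules) : ℕ → X.Modules
  | 0 => structureModule X
  | k + 1 => tensorModule (tensorNPow M k) M

/-- `M^{⊗ k}` for an integer `k` and an invertible sheaf `M`: for `k < 0` it is the `|k|`-th power
of the dual of `M`. -/
def tensorPow (M : X.Modules) : ℤ → X.Modules
  | Int.ofNat k => tensorNPow M k
  | Int.negSucc k => tensorNPow (dualModule M) (k + 1)

/-- Coherent sheaves on a (locally Noetherian) scheme: quasi-coherent and of finite type. -/
def IsCoherent (M : X.Modules) : Prop :=
  SheafOfModules.IsQuasicoherent M ∧ SheafOfModules.IsFiniteType M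

lemma isCoherent_of_iso {M N : X.Modules} (e : M ≅ N) (h : IsCoherent M) : IsCoherent N :=
  ⟨(SheafOfModules.isQuasicoherent X.ringCatSheaf).prop_of_iso (X := M) (Y := N)
      ⟨e.hom, e.inv, e.hom_inv_id, e.inv_hom_id⟩ h.1,
    isFiniteType_of_iso (M := M) (N := N) ⟨e.hom, e.inv, e.hom_inv_id, e.inv_hom_id⟩ h.2⟩

lemma isCoherent_zero {M : X.Modules} (h : IsZero M) : IsCoherent M :=
  ⟨isQuasicoherent_of_isZero (M := M) ⟨h.1, h.2⟩, isFiniteType_of_isZero (M := M) ⟨h.1, h.2⟩⟩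

/-! ### The bounded derived category of coherent sheaves -/

/-- Bounded cochain complexes whose terms are coherent sheaves. -/
def isBoundedCoherent (Y : Scheme.{0}) : ObjectProperty (CochainComplex Y.Modules ℤ) := fun K ↦
  (∀ i, IsCoherent (K.X i)) ∧ ∃ a b : ℤ, ∀ i, i < a ∨ b < i → IsZero (K.X i)

instance (Y : Scheme.{0}) : (isBoundedCoherent Y).IsStableUnderShift ℤ where
  isStableUnderShiftBy n := ⟨by
    rintro K ⟨h, a, b, hab⟩
    refine ⟨fun i ↦ h (i + n), a - n, b - n, fun i hi ↦ hab (i + n) (by omega)⟩⟩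

/-- The category of bounded complexes of coherent sheaves on `Y`. -/
abbrev BoundedComplexes (Y : Scheme.{0}) := (isBoundedCoherent Y).FullSubcategory

/-- The quasi-isomorphisms between bounded complexes of coherent sheaves. -/
def quasiIsos (Y : Scheme.{0}) : MorphismProperty (BoundedComplexes Y) :=
  (HomologicalComplex.quasiIso Y.Modules (ComplexShape.up ℤ)).inverseImage (isBoundedCoherent Y).ι

instance (Y : Scheme.{0}) : (quasiIsos Y).IsCompatibleWithShift ℤ where
  condition n := by
    ext K L f
    change HomologicalComplex.quasiIso _ _ _ ↔ HomologicalComplex.quasiIso _ _ f.hom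
    rw [← MorphismProperty.IsCompatibleWithShift.iff
      (HomologicalComplex.quasiIso Y.Modules (ComplexShape.up ℤ)) f.hom n]
    exact (HomologicalComplex.quasiIso Y.Modules (ComplexShape.up ℤ)).arrow_mk_iso_iff
      (Arrow.isoOfNatIso ((isBoundedCoherent Y).ι.commShiftIso n) (Arrow.mk f))

/-- The bounded derived category of coherent sheaves on `Y`: the category of bounded complexes
of coherent sheaves, localized at the quasi-isomorphisms, with its induced shift. -/
abbrev DbCoh (Y : Scheme.{0}) := (quasiIsos Y).Localization

/-- A coherent sheaf as a complex concentrated in degree `0`. -/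
def sheafComplex {Y : Scheme.{0}} (A : Y.Modules) (hA : IsCoherent A) : BoundedComplexes Y :=
  ⟨(CochainComplex.singleFunctor Y.Modules 0).obj A, by
    refine ⟨fun i ↦ ?_, 0, 0, fun i hi ↦
      HomologicalComplex.isZero_single_obj_X _ _ _ _ (by omega)⟩
    by_cases hi : i = 0
    · subst hi
      exact isCoherent_of_iso (HomologicalComplex.singleObjXSelf (ComplexShape.up ℤ) 0 A).symm hA
    · exact isCoherent_zero (HomologicalComplex.isZero_single_obj_X _ _ _ _ hi)⟩

/-- A coherent sheaf as an object of the bounded derived category. -/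
def sheafObj {Y : Scheme.{0}} (A : Y.Modules) (hA : IsCoherent A) : DbCoh Y :=
  (quasiIsos Y).Q.obj (sheafComplex A hA)

/-- `Ext^r(E, F) = Hom(E, F[r])` in the bounded derived category. As this is a group, it is
nonzero if and only if it has more than one element. -/
abbrev DbExt {Y : Scheme.{0}} (r : ℤ) (E F : DbCoh Y) := E ⟶ F⟦r⟧

end Modules

/-! ### Reflexive polytopes and their toric varieties -/

section Toric

/-- The pairing of `m ∈ (ℝⁿ)^*` with `u ∈ ℤⁿ`. -/
def pairing {n : ℕ} (m : Fin n → ℝ) (u : Fin n → ℤ) : ℝ := ∑ i, m i * (u i : ℝ)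

/-- A lattice point as a point of `(ℝⁿ)^*`. -/
def latticePt {n : ℕ} (m : Fin n → ℤ) : Fin n → ℝ := fun i ↦ (m i : ℝ)

/-- `u` is the primitive inward conormal vector of a facet `F` of `Δ`, and `F` lies on the
hyperplane `⟨m, u⟩ = -c`; here `F = {m ∈ Δ | ⟨m, u⟩ = -c}` is a face of dimension `n - 1`. -/
structure IsFacetNormal {n : ℕ} (Δ : Set (Fin n → ℝ)) (u : Fin n → ℤ) (c : ℝ) : Prop where
  primitive : ∀ d : ℤ, (∀ i, d ∣ u i) → IsUnit d
  inward : ∀ m ∈ Δ, -c ≤ pairing m u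
  nonempty : {m ∈ Δ | pairing m u = -c}.Nonempty
  dim : Module.finrank ℝ (vectorSpan ℝ {m ∈ Δ | pairing m u = -c}) + 1 = n

/-- A reflexive polytope: an `n`-dimensional lattice polytope in `(ℝⁿ)^*` each of whose facets
lies on the hyperplane `⟨m, u⟩ = -1`, where `u` is the primitive inward conormal of the facet. -/
structure ReflexivePolytope (n : ℕ) where
  carrier : Set (Fin n → ℝ)
  lattice : ∃ S : Finset (Fin n → ℤ), carrier = convexHull ℝ (latticePt '' (S : Set (Fin n → ℤ)))
  fullDim : affineSpan ℝ carrier = ⊤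
  reflexive : ∀ (u : Fin n → ℤ) (c : ℝ), IsFacetNormal carrier u c → c = 1

namespace ReflexivePolytope

open scoped Pointwise

variable {n : ℕ} (Δ : ReflexivePolytope n)

lemma convex : Convex ℝ Δ.carrier := by
  obtain ⟨S, hS⟩ := Δ.lattice
  rw [hS]
  exact convex_convexHull ℝ _

lemma nonempty : Δ.carrier.Nonempty := by
  rw [← affineSpan_nonempty ℝ, Δ.fullDim]
  exact ⟨0, trivial⟩

/-- The lattice points of the cone over `Δ × {1}`: the pairs `(m, k)` with `m ∈ kΔ`. -/
def cone : AddSubmonoid ((Fin n → ℤ) × ℕ) where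
  carrier := {p | latticePt p.1 ∈ (p.2 : ℝ) • Δ.carrier}
  zero_mem' := by
    obtain ⟨x, hx⟩ := Δ.nonempty
    refine ⟨x, hx, ?_⟩
    ext i
    simp [latticePt]
  add_mem' := by
    intro p q hp hq
    have h : latticePt (p + q).1 = latticePt p.1 + latticePt q.1 := by
      ext i
      simp [latticePt]
    change latticePt (p + q).1 ∈ ((p.2 + q.2 : ℕ) : ℝ) • Δ.carrier
    rw [h, Nat.cast_add, Δ.convex.add_smul (Nat.cast_nonneg _) (Nat.cast_nonneg _)]
    exact Set.add_mem_add hp hq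

/-- The homogeneous coordinate ring `S_Δ`, with basis the monomials `χ^m t^k` for `m ∈ kΔ`. -/
abbrev coordRing : Type := AddMonoidAlgebra ℂ Δ.cone

/-- The degree `(m, k) ↦ k`. -/
def degree : Δ.cone →+ ℕ := (AddMonoidHom.snd (Fin n → ℤ) ℕ).comp Δ.cone.subtype

/-- The grading of `S_Δ` by the degree in `t`. -/
abbrev grading : ℕ → Submodule ℂ Δ.coordRing := AddMonoidAlgebra.gradeBy ℂ Δ.degree

/-- The toric variety `X = Proj S_Δ` of `Δ`. -/
def toricVariety : Scheme.{0} := Proj Δ.grading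

/-- The facets of `Δ`, each given by its primitive inward conormal. -/
abbrev Facet : Type := {u : Fin n → ℤ // IsFacetNormal Δ.carrier u 1}

/-- The torus-invariant prime divisor `D_F` of the facet `F`: the common zeros of the monomials
`χ^m t^k` with `m ∉ kF`. -/
def facetDivisor (F : Δ.Facet) : Closeds Δ.toricVariety :=
  ⟨ProjectiveSpectrum.zeroLocus Δ.grading
    {f | ∃ p : Δ.cone, pairing (latticePt p.1.1) F.1 ≠ -(p.1.2 : ℝ) ∧
      f = AddMonoidAlgebra.single p 1},
    ProjectiveSpectrum.isClosed_zeroLocus Δ.grading _⟩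

/-- The canonical sheaf `𝒪_X(K_X)`, for the canonical divisor `K_X = -∑_F D_F`. Since `∑_F D_F` is
reduced and `X` is normal, this is the ideal sheaf of the (reduced) union of the `D_F`. -/
def canonicalSheaf : Δ.toricVariety.Modules :=
  idealModule (Scheme.IdealSheafData.vanishingIdeal (⨆ F, Δ.facetDivisor F))

/-- The closed subscheme `Y` with ideal sheaf `I` is an anticanonical hypersurface, that is a member
of the complete linear system `|-K_X|`: it is an effective Cartier divisor with
`𝒪_X(-Y) ≅ 𝒪_X(K_X)`. -/
def IsAnticanonical (I : Δ.toricVariety.IdealSheafData) : Prop :=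
  Nonempty (idealModule I ≅ Δ.canonicalSheaf)

/-- The sheaf `𝒪_X(-(n-1)K_X)`. -/
def polarization : Δ.toricVariety.Modules :=
  tensorPow Δ.canonicalSheaf (-((n : ℤ) - 1))

/-- The restriction `ℒ` of `𝒪_X(-(n-1)K_X)` to the closed subscheme `Y` with ideal sheaf `I`. -/
def lineBundle (I : Δ.toricVariety.IdealSheafData) : I.subscheme.Modules :=
  (Scheme.Modules.pullback I.subschemeι).obj Δ.polarization

end ReflexivePolytope

end Toric

end ToricCY

end

/-! The statement is a form of Serre's theorem that an ample sheaf generates after twisting.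
Represent `F` by a bounded complex `K` of coherent sheaves. Since `F` is nonzero, some cohomology
sheaf of `K` in degree `r` is nonzero, so after a shift the projection `q : Z → H` from the cocycles
to the cohomology in degree `0` is nonzero. If some `φ : ℒ^{-k} → Z` has `φ ≫ q ≠ 0`, then `φ`
defines a map of complexes that is nonzero on cohomology, hence nonzero in the derived category, and
the Ext group in degree `r` is nontrivial (`exists_nontrivial_dbExt`). No vanishing theorem or
duality is needed.

Such `φ` exist for all large `k` when `ℒ` is a positive power of the `𝒪(1)` of a finite affine cover
(`Charts.exists_comp_ne_zero`): a section of `Z` over one chart, multiplied by a high power of a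
coordinate, extends to a global section of `Z(k)`. All line bundles are handled through explicit
frames on the charts with transition functions `(x_v / x_w)^d`, recorded by `Charts.HasWeight`; this
passes to tensor products, duals and pullbacks.

It remains to see that the canonical sheaf is `𝒪(-1)` on the charts `D₊(χ^v t)`, with local
generators `t / (χ^v t)` (`ReflexivePolytope.ideal_boundary`). This is where reflexivity acts: `Δ`
is cut out by the inequalities `⟨m, u_F⟩ ≥ -1`, so a lattice point of `(k+1)Δ` on no facet lies in
`kΔ`, and a function vanishing on every `D_F` is divisible by `t`. The facet description is derived
from the definition by taking extreme points of a polar body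
(`ReflexivePolytope.exists_facet_of_notMem`).

Thus `ℒ` has weight `n - 1`, which is positive for `n ≥ 2`. For `n = 0` there is a single chart, and
weights carry no information. For `n = 1` the bundle is trivial, but `Y` is a proper closed
subscheme of a conic and is affine (`ReflexivePolytope.isAffine_subscheme`), so again one chart
suffices. -/

noncomputable section

namespace ToricCY

/-! ### Frames of modules: local generators and gluing -/

section Frames

variable {X : Scheme.{0}}

/-- Restriction of functions. -/
def resO {U W : X.Opens} (h : W ≤ U) : Γ(X, U) →+* Γ(X, W) := (X.presheaf.map (homOfLE h).op).hom

/-- Restriction of sections of a module. -/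
def resM (M : X.Modules) {U W : X.Opens} (h : W ≤ U) : Γ(M, U) →+ Γ(M, W) :=
  (M.presheaf.map (homOfLE h).op).hom

lemma resO_resO {U V W : X.Opens} (h : V ≤ U) (h' : W ≤ V) (a : Γ(X, U)) :
    resO h' (resO h a) = resO (h'.trans h) a := res_res X h h' a

lemma resM_resM (M : X.Modules) {U V W : X.Opens} (h : V ≤ U) (h' : W ≤ V) (a : Γ(M, U)) :
    resM M h' (resM M h a) = resM M (h'.trans h) a := res_res_module M h h' a

lemma resO_rfl {U : X.Opens} (h : U ≤ U) (a : Γ(X, U)) : resO h a = a :=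
  ConcreteCategory.congr_hom (X.presheaf.map_id (.op U)) a

lemma resM_rfl (M : X.Modules) {U : X.Opens} (h : U ≤ U) (a : Γ(M, U)) : resM M h a = a :=
  ConcreteCategory.congr_hom (M.presheaf.map_id (.op U)) a

lemma resM_smul (M : X.Modules) {U W : X.Opens} (h : W ≤ U) (r : Γ(X, U)) (a : Γ(M, U)) :
    resM M h (r • a) = resO h r • resM M h a := Scheme.Modules.map_smul M (homOfLE h) r a

lemma app_resM {M N : X.Modules} (φ : M ⟶ N) {U W : X.Opens} (h : W ≤ U) (a : Γ(M, U)) :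
    φ.app W (resM M h a) = resM N h (φ.app U a) :=
  (ConcreteCategory.congr_hom (φ.mapPresheaf.naturality (homOfLE h).op) a)

lemma section_ext (M : X.Modules) {ι : Type} (U : ι → X.Opens) {W : X.Opens}
    (hU : ∀ i, U i ≤ W) (hW : W ≤ iSup U) {a b : Γ(M, W)}
    (h : ∀ i, resM M (hU i) a = resM M (hU i) b) : a = b :=
  TopCat.Sheaf.eq_of_locally_eq' ⟨M.presheaf, M.isSheaf⟩ U W (fun i ↦ homOfLE (hU i)) hW a b h

lemma function_ext {ι : Type} (U : ι → X.Opens) {W : X.Opens}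
    (hU : ∀ i, U i ≤ W) (hW : W ≤ iSup U) {a b : Γ(X, W)}
    (h : ∀ i, resO (hU i) a = resO (hU i) b) : a = b :=
  X.sheaf.eq_of_locally_eq' U W (fun i ↦ homOfLE (hU i)) hW a b h

lemma section_glue (M : X.Modules) {ι : Type} (U : ι → X.Opens) {W : X.Opens}
    (hU : ∀ i, U i ≤ W) (hW : W ≤ iSup U) (s : ∀ i, Γ(M, U i))
    (h : ∀ i j, resM M (inf_le_left : U i ⊓ U j ≤ U i) (s i) =
      resM M (inf_le_right : U i ⊓ U j ≤ U j) (s j)) :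
    ∃ a : Γ(M, W), ∀ i, resM M (hU i) a = s i := by
  obtain ⟨a, ha, -⟩ := TopCat.Sheaf.existsUnique_gluing' ⟨M.presheaf, M.isSheaf⟩ U W
    (fun i ↦ homOfLE (hU i)) hW s h
  exact ⟨a, ha⟩

lemma function_glue {ι : Type} (U : ι → X.Opens) {W : X.Opens}
    (hU : ∀ i, U i ≤ W) (hW : W ≤ iSup U) (s : ∀ i, Γ(X, U i))
    (h : ∀ i j, resO (inf_le_left : U i ⊓ U j ≤ U i) (s i) =
      resO (inf_le_right : U i ⊓ U j ≤ U j) (s j)) :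
    ∃ a : Γ(X, W), ∀ i, resO (hU i) a = s i := by
  obtain ⟨a, ha, -⟩ := X.sheaf.existsUnique_gluing' U W
    (fun i ↦ homOfLE (hU i)) hW s h
  exact ⟨a, ha⟩

/-- A section `e` of `M` over `U` is a frame if it freely generates `M` over `U`. -/
def IsFrame (M : X.Modules) {U : X.Opens} (e : Γ(M, U)) : Prop :=
  ∀ (W : X.Opens) (h : W ≤ U), Function.Bijective fun r : Γ(X, W) ↦ r • resM M h e

variable {M N : X.Modules} {U : X.Opens}

namespace IsFrame

variable {e : Γ(M, U)}

/-- The coordinate of a section with respect to a frame. -/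
def coord (he : IsFrame M e) {W : X.Opens} (h : W ≤ U) : Γ(M, W) →ₗ[Γ(X, W)] Γ(X, W) :=
  (LinearEquiv.ofBijective ((LinearMap.id (R := Γ(X, W))).smulRight (resM M h e)) (he W h)).symm

lemma coord_smul_frame (he : IsFrame M e) {W : X.Opens} (h : W ≤ U) (m : Γ(M, W)) :
    he.coord h m • resM M h e = m :=
  (LinearEquiv.ofBijective ((LinearMap.id (R := Γ(X, W))).smulRight (resM M h e))
    (he W h)).apply_symm_apply m

lemma coord_eq (he : IsFrame M e) {W : X.Opens} (h : W ≤ U) {m : Γ(M, W)} {r : Γ(X, W)}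
    (hr : r • resM M h e = m) : he.coord h m = r :=
  (he W h).1 ((he.coord_smul_frame h m).trans hr.symm)

lemma coord_frame (he : IsFrame M e) {W : X.Opens} (h : W ≤ U) :
    he.coord h (resM M h e) = 1 := he.coord_eq h (one_smul _ _)

lemma resO_coord (he : IsFrame M e) {V W : X.Opens} (h : V ≤ U) (h' : W ≤ V) (m : Γ(M, V)) :
    resO h' (he.coord h m) = he.coord (h'.trans h) (resM M h' m) := by
  refine (he.coord_eq _ ?_).symm
  rw [← resM_resM M h h', ← resM_smul, coord_smul_frame]

end IsFrame

/-- It suffices to test a frame on a basis of opens. -/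
lemma isFrame_of_basis {e : Γ(M, U)} (B : Set X.Opens)
    (hB : ∀ W ≤ U, ∀ x ∈ W, ∃ V ∈ B, x ∈ V ∧ V ≤ W)
    (he : ∀ V ∈ B, ∀ h : V ≤ U, Function.Bijective fun r : Γ(X, V) ↦ r • resM M h e) :
    IsFrame M e := by
  intro W h
  have hinj : ∀ (W : X.Opens) (h : W ≤ U), Function.Injective fun r : Γ(X, W) ↦ r • resM M h e := by
    intro W h r s hrs
    choose V hV hxV hVW using fun x : W ↦ hB W h x.1 x.2
    refine function_ext V hVW (fun x hx ↦ Opens.mem_iSup.2 ⟨⟨x, hx⟩, hxV ⟨x, hx⟩⟩) fun i ↦ ?_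
    refine (he (V i) (hV i) ((hVW i).trans h)).1 ?_
    have := congrArg (resM M (hVW i)) hrs
    simpa only [resM_smul, resM_resM] using this
  refine ⟨hinj W h, fun m ↦ ?_⟩
  choose V hV hxV hVW using fun x : W ↦ hB W h x.1 x.2
  have hcov : W ≤ iSup V := fun x hx ↦ Opens.mem_iSup.2 ⟨⟨x, hx⟩, hxV ⟨x, hx⟩⟩
  choose r hr using fun i ↦ (he (V i) (hV i) ((hVW i).trans h)).2 (resM M (hVW i) m)
  dsimp only at hr
  -- The overlaps `V i ⊓ V j` need not belong to the basis, which is why injectivity was first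
  -- proved for all opens.
  obtain ⟨a, ha⟩ := function_glue V hVW hcov r (fun i j ↦ by
    refine hinj _ ((inf_le_left.trans (hVW i)).trans h) ?_
    dsimp only
    have h1 := congrArg (resM M (inf_le_left : V i ⊓ V j ≤ V i)) (hr i)
    have h2 := congrArg (resM M (inf_le_right : V i ⊓ V j ≤ V j)) (hr j)
    rw [resM_smul, resM_resM, resM_resM] at h1 h2
    rw [h1, h2])
  refine ⟨a, section_ext M V hVW hcov fun i ↦ ?_⟩
  rw [resM_smul, ha, resM_resM, hr]

/-- Morphisms of modules can be glued from local linear maps. -/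
lemma exists_glue_hom {ι : Type} (U : ι → X.Opens) (hU : iSup U = ⊤)
    (Φ : ∀ (i : ι) (W : X.Opens), W ≤ U i → (Γ(M, W) →ₗ[Γ(X, W)] Γ(N, W)))
    (hres : ∀ i (W V : X.Opens) (hW : W ≤ U i) (h : V ≤ W) (m : Γ(M, W)),
      resM N h (Φ i W hW m) = Φ i V (h.trans hW) (resM M h m))
    (hagree : ∀ i j (W : X.Opens) (hi : W ≤ U i) (hj : W ≤ U j) (m : Γ(M, W)),
      Φ i W hi m = Φ j W hj m) :
    ∃ φ : M ⟶ N, ∀ i (W : X.Opens) (h : W ≤ U i) (m : Γ(M, W)), φ.app W m = Φ i W h m := by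
  have cov (V : X.Opens) : V ≤ ⨆ i, V ⊓ U i := by
    rw [← inf_iSup_eq, hU, inf_top_eq]
  have key (V : X.Opens) (m : Γ(M, V)) : ∃ s : Γ(N, V), ∀ i,
      resM N (inf_le_left : V ⊓ U i ≤ V) s =
        Φ i (V ⊓ U i) inf_le_right (resM M inf_le_left m) := by
    refine section_glue N (fun i ↦ V ⊓ U i) (fun i ↦ inf_le_left) (cov V) _ fun i j ↦ ?_
    rw [hres, hres, resM_resM, resM_resM]
    exact hagree _ _ _ _ _ _
  choose g hg using key
  have gext (V : X.Opens) {a b : Γ(N, V)} (h : ∀ i, resM N (inf_le_left : V ⊓ U i ≤ V) a =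
      resM N (inf_le_left : V ⊓ U i ≤ V) b) : a = b :=
    section_ext N (fun i ↦ V ⊓ U i) (fun i ↦ inf_le_left) (cov V) h
  let f (V : X.Opens) : Γ(M, V) →ₗ[Γ(X, V)] Γ(N, V) :=
    { toFun := g V
      map_add' := fun a b ↦ gext V fun i ↦ by simp only [hg, map_add]
      map_smul' := fun r a ↦ gext V fun i ↦ by
        simp only [hg, resM_smul, map_smul, RingHom.id_apply] }
  have hf (V W : X.Opens) (h : W ≤ V) (m : Γ(M, V)) : resM N h (f V m) = f W (resM M h m) := by
    refine gext W fun i ↦ ?_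
    change resM N _ (resM N h (g V m)) = resM N _ (g W _)
    rw [hg, resM_resM, ← resM_resM N (inf_le_left : V ⊓ U i ≤ V) (inf_le_inf_right (U i) h), hg,
      hres, resM_resM, resM_resM]
  let φ : M ⟶ N := ⟨{ app V := ModuleCat.ofHom (f V.unop)
                      naturality {V W} i := by
                        ext m
                        exact (hf V.unop W.unop i.unop.le m).symm }⟩
  refine ⟨φ, fun i W h m ↦ ?_⟩
  change g W m = _
  refine gext W fun j ↦ ?_
  rw [hg, hres]
  exact hagree _ _ _ _ _ _

end Frames


/-! ### Frames of duals and tensor products -/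

section FrameOperations

variable {X : Scheme.{0}} {M N : X.Modules} {U : X.Opens}

/-- The section `1` of the structure sheaf. -/
def oneSec (U : X.Opens) : Γ(structureModule X, U) := (1 : Γ(X, U))

lemma resM_oneSec {U V : X.Opens} (h : V ≤ U) : resM (structureModule X) h (oneSec U) = oneSec V :=
  map_one (resO h)

lemma isFrame_one (U : X.Opens) : IsFrame (structureModule X) (oneSec U) := by
  intro W h
  rw [resM_oneSec]
  have : (fun r : Γ(X, W) ↦ r • oneSec W) = id := funext fun r ↦ mul_one (M := Γ(X, W)) r
  exact this ▸ Function.bijective_id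

/-- The coordinate function of a frame, as a section of the dual. -/
def IsFrame.dual {e : Γ(M, U)} (he : IsFrame M e) : Γ(dualModule M, U) :=
  (⟨fun V ↦ he.coord V.2, fun V _ h x ↦ he.resO_coord V.2 h x⟩ : dualSections M U)

/-- Evaluation of a section of the dual. -/
def dualEval {U : X.Opens} (φ : Γ(dualModule M, U)) {V : X.Opens} (h : V ≤ U) :
    Γ(M, V) →ₗ[Γ(X, V)] Γ(X, V) := (show dualSections M U from φ).1 ⟨V, h⟩

lemma dual_ext {U : X.Opens} {φ ψ : Γ(dualModule M, U)}
    (h : ∀ (V : X.Opens) (hV : V ≤ U) (m : Γ(M, V)), dualEval φ hV m = dualEval ψ hV m) : φ = ψ :=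
  Subtype.ext (a1 := (φ : dualSections M U)) (a2 := (ψ : dualSections M U))
    (funext fun V ↦ LinearMap.ext fun m ↦ h V.1 V.2 m)

lemma dualEval_smul {U V : X.Opens} (h : V ≤ U) (r : Γ(X, U)) (φ : Γ(dualModule M, U))
    (m : Γ(M, V)) : dualEval (r • φ) h m = resO h r * dualEval φ h m := rfl

lemma dualEval_resM {U V W : X.Opens} (h : V ≤ U) (h' : W ≤ V) (φ : Γ(dualModule M, U))
    (m : Γ(M, W)) : dualEval (resM _ h φ) h' m = dualEval φ (h'.trans h) m := rfl

lemma resO_dualEval {U V W : X.Opens} (h : V ≤ U) (h' : W ≤ V) (φ : Γ(dualModule M, U))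
    (m : Γ(M, V)) : resO h' (dualEval φ h m) = dualEval φ (h'.trans h) (resM M h' m) :=
  (show dualSections M U from φ).2 ⟨V, h⟩ ⟨W, h'.trans h⟩ h' m

lemma IsFrame.dualEval_dual {e : Γ(M, U)} (he : IsFrame M e) {V : X.Opens} (h : V ≤ U)
    (m : Γ(M, V)) : dualEval he.dual h m = he.coord h m := rfl

/-- A functional on a free module of rank one is determined by its value at the generator, and that
value is its coordinate with respect to the dual frame. -/
lemma IsFrame.isFrame_dual {e : Γ(M, U)} (he : IsFrame M e) :
    IsFrame (dualModule M) he.dual := by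
  intro W h
  constructor
  · intro r s hrs
    have := congrArg (fun φ ↦ dualEval φ le_rfl (resM M h e)) hrs
    simpa only [dualEval_smul, dualEval_resM, he.dualEval_dual, he.coord_frame, mul_one,
      resO_rfl] using this
  · intro φ
    refine ⟨dualEval φ le_rfl (resM M h e), dual_ext fun V hV m ↦ ?_⟩
    rw [dualEval_smul, dualEval_resM, he.dualEval_dual, resO_dualEval, resM_resM, mul_comm,
      ← smul_eq_mul, ← map_smul, he.coord_smul_frame]

/-! ### Tensor products -/

open TensorProduct

/-- The canonical map from the presheaf tensor product. -/
def tensorToSheaf (M N : X.Modules) (U : X.Opens) :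
    (Γ(M, U) ⊗[Γ(X, U)] Γ(N, U)) →ₗ[Γ(X, U)] Γ(tensorModule M N, U) :=
  (((PresheafOfModules.sheafificationAdjunction (𝟙 X.ringCatSheaf.obj)).unit.app
    (PresheafOfModules.Monoidal.tensorObj (R := X.presheaf) M.val N.val)).app (.op U)).hom

/-- Restriction on the presheaf tensor product. -/
def tensorRes (M N : X.Modules) {U V : X.Opens} (h : V ≤ U) :
    (Γ(M, U) ⊗[Γ(X, U)] Γ(N, U)) →+ (Γ(M, V) ⊗[Γ(X, V)] Γ(N, V)) :=
  ((PresheafOfModules.Monoidal.tensorObj (R := X.presheaf) M.val N.val).presheaf.map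
    (homOfLE h).op).hom

lemma tensorRes_tmul {U V : X.Opens} (h : V ≤ U) (m : Γ(M, U)) (n : Γ(N, U)) :
    tensorRes M N h (m ⊗ₜ n) = resM M h m ⊗ₜ resM N h n := rfl

lemma resM_tensorToSheaf {U V : X.Opens} (h : V ≤ U) (z : Γ(M, U) ⊗[Γ(X, U)] Γ(N, U)) :
    resM _ h (tensorToSheaf M N U z) = tensorToSheaf M N V (tensorRes M N h z) :=
  (ConcreteCategory.congr_hom ((CategoryTheory.toSheafify (Opens.grothendieckTopology X)
    (PresheafOfModules.Monoidal.tensorObj (R := X.presheaf) M.val N.val).presheaf).naturality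
      (homOfLE h).op) z).symm

/-- Together with local surjectivity, this is all that is used about sheafification: the tensor
sheaf is never computed on a given open directly. -/
lemma tensorToSheaf_locally_injective {U : X.Opens} (z : Γ(M, U) ⊗[Γ(X, U)] Γ(N, U))
    (hz : tensorToSheaf M N U z = 0) (x : X) (hx : x ∈ U) :
    ∃ (V : X.Opens) (h : V ≤ U), x ∈ V ∧ tensorRes M N h z = 0 := by
  have := Presheaf.equalizerSieve_mem (Opens.grothendieckTopology X)
    (CategoryTheory.toSheafify (Opens.grothendieckTopology X)
    (PresheafOfModules.Monoidal.tensorObj (R := X.presheaf) M.val N.val).presheaf)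
    (X := .op U) z 0 (by rw [map_zero]; exact hz)
  obtain ⟨V, f, hf, hxV⟩ := this x hx
  refine ⟨V, f.le, hxV, ?_⟩
  exact (hf : _ = _).trans (map_zero (tensorRes M N f.le))

lemma tensorToSheaf_locally_surjective {U : X.Opens} (s : Γ(tensorModule M N, U))
    (x : X) (hx : x ∈ U) :
    ∃ (V : X.Opens) (h : V ≤ U) (z : Γ(M, V) ⊗[Γ(X, V)] Γ(N, V)), x ∈ V ∧
      tensorToSheaf M N V z = resM _ h s := by
  have := Presheaf.imageSieve_mem (Opens.grothendieckTopology X)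
    (CategoryTheory.toSheafify (Opens.grothendieckTopology X)
    (PresheafOfModules.Monoidal.tensorObj (R := X.presheaf) M.val N.val).presheaf) (U := .op U) s
  obtain ⟨V, f, ⟨z, hz⟩, hxV⟩ := this x hx
  exact ⟨V, f.le, z, hxV, hz⟩

/-- The tensor product of two sections. -/
def tmulSec {U : X.Opens} (m : Γ(M, U)) (n : Γ(N, U)) : Γ(tensorModule M N, U) :=
  tensorToSheaf M N U (m ⊗ₜ n)

lemma resM_tmulSec {U V : X.Opens} (h : V ≤ U) (m : Γ(M, U)) (n : Γ(N, U)) :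
    resM _ h (tmulSec m n) = tmulSec (resM M h m) (resM N h n) :=
  resM_tensorToSheaf h _

lemma smul_tmulSec_smul {U : X.Opens} (a b : Γ(X, U)) (m : Γ(M, U)) (n : Γ(N, U)) :
    tmulSec (a • m) (b • n) = (a * b) • tmulSec m n := by
  rw [tmulSec, tmulSec, TensorProduct.smul_tmul_smul, map_smul]

lemma IsFrame.exists_eq_smul_tmul {e : Γ(M, U)} {f : Γ(N, U)} (he : IsFrame M e)
    (hf : IsFrame N f) {W : X.Opens} (h : W ≤ U) (z : Γ(M, W) ⊗[Γ(X, W)] Γ(N, W)) :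
    ∃ r : Γ(X, W), z = r • (resM M h e ⊗ₜ resM N h f) := by
  induction z with
  | zero => exact ⟨0, by simp⟩
  | tmul m n =>
    obtain ⟨a, rfl⟩ := (he W h).2 m
    obtain ⟨b, rfl⟩ := (hf W h).2 n
    exact ⟨a * b, by rw [TensorProduct.smul_tmul_smul]⟩
  | add y z hy hz =>
    obtain ⟨a, ha⟩ := hy
    obtain ⟨b, hb⟩ := hz
    exact ⟨a + b, by rw [add_smul, ← ha, ← hb]⟩

lemma IsFrame.eq_zero_of_smul_tmul {e : Γ(M, U)} {f : Γ(N, U)} (he : IsFrame M e)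
    (hf : IsFrame N f) {W : X.Opens} (h : W ≤ U) {r : Γ(X, W)}
    (hr : r • (resM M h e ⊗ₜ[Γ(X, W)] resM N h f) = 0) : r = 0 := by
  have := congrArg (TensorProduct.lift ((LinearMap.mul Γ(X, W) Γ(X, W)).compl₁₂
    (he.coord h) (hf.coord h))) hr
  simpa [he.coord_frame, hf.coord_frame] using this

/-- Before sheafifying, `e ⊗ f` freely generates by pure algebra; local injectivity and local
surjectivity of the unit carry this to the sheaf, and the local coordinates glue by uniqueness. -/
lemma IsFrame.tmulSec {e : Γ(M, U)} {f : Γ(N, U)} (he : IsFrame M e) (hf : IsFrame N f) :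
    IsFrame (tensorModule M N) (tmulSec e f) := by
  have hinj (W : X.Opens) (h : W ≤ U) (r : Γ(X, W))
      (hr : r • resM _ h (ToricCY.tmulSec e f) = 0) : r = 0 := by
    rw [resM_tmulSec, ToricCY.tmulSec, ← map_smul] at hr
    choose V hVW hxV hz using fun x : W ↦ tensorToSheaf_locally_injective _ hr x.1 x.2
    refine function_ext V hVW (fun x hx ↦ Opens.mem_iSup.2 ⟨⟨x, hx⟩, hxV ⟨x, hx⟩⟩) fun i ↦ ?_
    rw [map_zero]
    refine he.eq_zero_of_smul_tmul hf ((hVW i).trans h) ?_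
    have := hz i
    rw [TensorProduct.smul_tmul', tensorRes_tmul, resM_smul, resM_resM, resM_resM] at this
    rw [TensorProduct.smul_tmul', this]
  intro W h
  have hinj' (V : X.Opens) (hV : V ≤ U) :
      Function.Injective fun r : Γ(X, V) ↦ r • resM _ hV (ToricCY.tmulSec e f) := by
    intro r s hrs
    refine sub_eq_zero.1 (hinj V hV _ ?_)
    rw [sub_smul]
    exact sub_eq_zero.2 hrs
  refine ⟨hinj' W h, fun s ↦ ?_⟩
  choose V hVW z hxV hz using fun x : W ↦ tensorToSheaf_locally_surjective s x.1 x.2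
  have hcov : W ≤ iSup V := fun x hx ↦ Opens.mem_iSup.2 ⟨⟨x, hx⟩, hxV ⟨x, hx⟩⟩
  choose r hr using fun i ↦ he.exists_eq_smul_tmul hf ((hVW i).trans h) (z i)
  have hr' (i : W) : r i • resM _ ((hVW i).trans h) (ToricCY.tmulSec e f) = resM _ (hVW i) s := by
    rw [← hz, hr i, map_smul, resM_tmulSec]
    rfl
  obtain ⟨a, ha⟩ := function_glue V hVW hcov r (fun i j ↦ by
    refine hinj' _ ((inf_le_left.trans (hVW i)).trans h) ?_
    dsimp only
    have h1 := congrArg (resM _ (inf_le_left : V i ⊓ V j ≤ V i)) (hr' i)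
    have h2 := congrArg (resM _ (inf_le_right : V i ⊓ V j ≤ V j)) (hr' j)
    rw [resM_smul, resM_resM, resM_resM] at h1 h2
    rw [h1, h2])
  refine ⟨a, section_ext _ V hVW hcov fun i ↦ ?_⟩
  rw [resM_smul, ha, resM_resM, hr']

end FrameOperations


/-! ### Frames of pullbacks -/

section Pullback

/-- Restriction serves as the transport between opens that are equal only propositionally. -/
lemma bijective_resM_of_eq {X : Scheme.{0}} (M : X.Modules) {U V : X.Opens} (h : V ≤ U)
    (h' : U = V) : Function.Bijective (resM M h) := by
  subst h'
  have : (resM M h : Γ(M, U) → Γ(M, U)) = id := funext fun a ↦ resM_rfl M h a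
  rw [this]
  exact Function.bijective_id

/-- The linear map `𝒪(V) → N(V)` given by a global section. -/
def unitHomApp {X : Scheme.{0}} {N : X.Modules} (a : Γ(N, ⊤)) (V : X.Opens) :
    Γ(structureModule X, V) →ₗ[Γ(X, V)] Γ(N, V) where
  toFun r := (show Γ(X, V) from r) • resM N le_top a
  map_add' r s := add_smul (R := Γ(X, V)) r s _
  map_smul' r s := mul_smul (α := Γ(X, V)) r s _

lemma unitHomApp_resM {X : Scheme.{0}} {N : X.Modules} (a : Γ(N, ⊤)) {V W : X.Opens} (h : W ≤ V)
    (r : Γ(structureModule X, V)) :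
    unitHomApp a W (resM _ h r) = resM N h (unitHomApp a V r) := by
  change _ = resM N h ((show Γ(X, V) from r) • resM N le_top a)
  rw [resM_smul, resM_resM]
  rfl

/-- The morphism `𝒪 ⟶ N` given by a global section. -/
def unitHom {X : Scheme.{0}} {N : X.Modules} (a : Γ(N, ⊤)) : structureModule X ⟶ N :=
  ⟨{ app V := ModuleCat.ofHom (unitHomApp a V.unop)
     naturality {_ _} i := ModuleCat.hom_ext (LinearMap.ext fun r ↦
       unitHomApp_resM a i.unop.le r) }⟩

lemma unitHom_app {X : Scheme.{0}} {N : X.Modules} (a : Γ(N, ⊤)) (W : X.Opens) (r : Γ(X, W)) :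
    (unitHom a).app W r = r • resM N le_top a := rfl

lemma unitHom_app_one {X : Scheme.{0}} {N : X.Modules} (a : Γ(N, ⊤)) (W : X.Opens) :
    (unitHom a).app W (oneSec W) = resM N le_top a := one_smul Γ(X, W) _

lemma bijective_unitHom_eval {X : Scheme.{0}} (N : X.Modules) :
    Function.Bijective fun φ : structureModule X ⟶ N ↦ φ.app ⊤ (oneSec ⊤) := by
  constructor
  · intro φ ψ h
    dsimp only at h
    refine Scheme.Modules.hom_ext _ _ fun W ↦ ?_
    ext r
    rw [← (isFrame_one ⊤).coord_smul_frame le_top r, Scheme.Modules.Hom.app_smul,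
      Scheme.Modules.Hom.app_smul, app_resM, app_resM, h]
  · intro a
    refine ⟨unitHom a, ?_⟩
    dsimp only
    rw [unitHom_app_one, resM_rfl]

/-- The condition on `P` says that it behaves like a pushforward from `U`. Maps into `P` are
therefore determined over `U`, where `M` is free on `e`. -/
lemma IsFrame.bijective_eval {X : Scheme.{0}} {M : X.Modules} {U : X.Opens} {e : Γ(M, U)}
    (he : IsFrame M e) (P : X.Modules)
    (hP : ∀ A : X.Opens, Function.Bijective (resM P (inf_le_left : A ⊓ U ≤ A))) :
    Function.Bijective fun ψ : M ⟶ P ↦ ψ.app U e := by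
  constructor
  · intro φ ψ h
    dsimp only at h
    refine Scheme.Modules.hom_ext _ _ fun A ↦ ?_
    ext m
    refine (hP A).1 ?_
    change resM P _ (φ.app A m) = resM P _ (ψ.app A m)
    rw [← app_resM, ← app_resM, ← he.coord_smul_frame inf_le_right (resM M inf_le_left m),
      Scheme.Modules.Hom.app_smul, Scheme.Modules.Hom.app_smul, app_resM, app_resM, h]
  · intro p
    choose g hg using fun (A : X.Opens) (m : Γ(M, A)) ↦ (hP A).2
      (he.coord inf_le_right (resM M (inf_le_left : A ⊓ U ≤ A) m) • resM P inf_le_right p)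
    let f (V : X.Opens) : Γ(M, V) →ₗ[Γ(X, V)] Γ(P, V) :=
      { toFun := g V
        map_add' := fun a b ↦ (hP V).1 (by simp only [hg, map_add, add_smul])
        map_smul' := fun r a ↦ (hP V).1 (by
          simp only [hg, resM_smul, map_smul, RingHom.id_apply, smul_eq_mul, mul_smul]) }
    have hf (V W : X.Opens) (h : W ≤ V) (m : Γ(M, V)) : resM P h (f V m) = f W (resM M h m) := by
      refine (hP W).1 ?_
      change resM P _ (resM P h (g V m)) = resM P _ (g W _)
      rw [hg, resM_resM, ← resM_resM P (inf_le_left : V ⊓ U ≤ V) (inf_le_inf_right U h), hg,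
        resM_smul, he.resO_coord, resM_resM, resM_resM, resM_resM]
    refine ⟨⟨{ app V := ModuleCat.ofHom (f V.unop)
               naturality {V W} i := by
                 ext m
                 exact (hf V.unop W.unop i.unop.le m).symm }⟩, ?_⟩
    change g U e = p
    refine (hP U).1 ?_
    rw [hg, he.coord_frame, one_smul]

/-- The pullback of a section. -/
def pullbackSec {X Y : Scheme.{0}} (f : Y ⟶ X) {M : X.Modules} {U : X.Opens} (e : Γ(M, U)) :
    Γ((Scheme.Modules.pullback f).obj M, f ⁻¹ᵁ U) :=
  ((Scheme.Modules.pullbackPushforwardAdjunction f).unit.app M).app U e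

lemma resM_pullbackSec {X Y : Scheme.{0}} (f : Y ⟶ X) {M : X.Modules} {U V : X.Opens}
    (h : V ≤ U) (e : Γ(M, U)) :
    resM ((Scheme.Modules.pullback f).obj M) (f.preimage_mono h) (pullbackSec f e) =
      pullbackSec f (resM M h e) :=
  (app_resM ((Scheme.Modules.pullbackPushforwardAdjunction f).unit.app M) h e).symm

lemma pullbackSec_smul {X Y : Scheme.{0}} (f : Y ⟶ X) {M : X.Modules} {U : X.Opens}
    (r : Γ(X, U)) (e : Γ(M, U)) :
    pullbackSec f (r • e) = (f.app U).hom r • pullbackSec f e :=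
  Scheme.Modules.Hom.app_smul ((Scheme.Modules.pullbackPushforwardAdjunction f).unit.app M) r e

/-- The pullback is accessible only through its adjunction, so the proof is by Yoneda. With `j` the
inclusion of `f⁻¹U`, maps from `(f^*M)|_{f⁻¹U}` to `T` are maps `M → f_* j_* T`. These are sections
of `T`, by evaluation at the frame, hence maps `𝒪 → T`. -/
lemma IsFrame.pullbackSec {X Y : Scheme.{0}} (f : Y ⟶ X) {M : X.Modules} {U : X.Opens}
    {e : Γ(M, U)} (he : IsFrame M e) :
    IsFrame ((Scheme.Modules.pullback f).obj M) (pullbackSec f e) := by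
  let A := (Scheme.Modules.pullback f).obj M
  let j := (f ⁻¹ᵁ U).ι
  have hj : j ''ᵁ ⊤ ≤ f ⁻¹ᵁ U := (f ⁻¹ᵁ U).ι_image_top.le
  let e'' : Γ(A.restrict j, ⊤) := resM A hj (ToricCY.pullbackSec f e)
  have hiso : IsIso (unitHom e'') := by
    rw [isIso_iff_coyoneda_map_bijective]
    intro T
    rw [← (bijective_unitHom_eval T).of_comp_iff']
    have hP : ∀ B : X.Opens, Function.Bijective (resM ((Scheme.Modules.pushforward f).obj
        ((Scheme.Modules.pushforward j).obj T)) (inf_le_left : B ⊓ U ≤ B)) := by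
      intro B
      refine bijective_resM_of_eq T (U := j ⁻¹ᵁ f ⁻¹ᵁ B) (V := j ⁻¹ᵁ f ⁻¹ᵁ (B ⊓ U))
        (j.preimage_mono (f.preimage_mono inf_le_left)) ?_
      ext x
      exact ⟨fun h ↦ ⟨h, x.2⟩, fun h ↦ h.1⟩
    have h3 := (((Scheme.Modules.restrictAdjunction j).homEquiv A T).trans
      ((Scheme.Modules.pullbackPushforwardAdjunction f).homEquiv M _)).bijective
    have h4 := (he.bijective_eval _ hP).comp h3
    have htop : j ⁻¹ᵁ (f ⁻¹ᵁ U) = ⊤ := (f ⁻¹ᵁ U).ι_preimage_self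
    have h5 := (bijective_resM_of_eq T (le_of_eq htop.symm) htop).comp h4
    convert h5 using 1
    funext φ
    have hform : (((Scheme.Modules.restrictAdjunction j).homEquiv A T).trans
        ((Scheme.Modules.pullbackPushforwardAdjunction f).homEquiv M _)) φ =
        (Scheme.Modules.pullbackPushforwardAdjunction f).unit.app M ≫
          (Scheme.Modules.pushforward f).map ((Scheme.Modules.restrictAdjunction j).unit.app A ≫
            (Scheme.Modules.pushforward j).map φ) := by
      rw [Equiv.trans_apply, Adjunction.homEquiv_unit, Adjunction.homEquiv_unit]
    refine Eq.trans ?_ (congrArg (fun z ↦ resM T (le_of_eq htop.symm)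
      (Scheme.Modules.Hom.app z U e)) hform).symm
    change φ.app ⊤ ((unitHom e'').app ⊤ (oneSec ⊤)) = resM T _ (φ.app (j ⁻¹ᵁ (f ⁻¹ᵁ U))
      (resM A (j.image_preimage_le _) (ToricCY.pullbackSec f e)))
    rw [unitHom_app_one, resM_rfl]
    refine Eq.trans ?_ (app_resM φ (le_of_eq htop.symm) _)
    congr 1
    exact (resM_resM A (j.image_preimage_le _) (j.image_mono htop.ge) _).symm
  -- The isomorphism lives on the open subscheme `f⁻¹U`; what remains is to translate it into a
  -- statement about sections over opens `W ≤ f⁻¹U` of `Y`, including the change of scalars.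
  intro W hW
  obtain ⟨W', rfl⟩ : ∃ W' : (f ⁻¹ᵁ U).toScheme.Opens, j ''ᵁ W' = W :=
    ⟨j ⁻¹ᵁ W, by
         rw [Scheme.Hom.image_preimage_eq_opensRange_inf, Scheme.Opens.opensRange_ι]
         exact inf_eq_right.2 hW⟩
  have hb : Function.Bijective ((unitHom e'').app W') :=
    (ConcreteCategory.isIso_iff_bijective _).1 inferInstance
  have hb' := hb.comp ((ConcreteCategory.isIso_iff_bijective (j.appIso W').hom).1 inferInstance)
  have key (r : Γ(Y, j ''ᵁ W')) : r • resM A hW (ToricCY.pullbackSec f e) =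
      (unitHom e'').app W' ((j.appIso W').hom r) := by
    rw [unitHom_app]
    have h1 := Scheme.Modules.smul_restrictAppIso_hom_apply j A W'
      ((j.appIso W').hom r) (resM (A.restrict j) le_top e'')
    refine Eq.trans ?_ h1.symm
    change _ = ((j.appIso W').hom ≫ (j.appIso W').inv) r •
      resM A (j.image_mono le_top) (resM A hj _)
    rw [Iso.hom_inv_id, resM_resM]
    rfl
  refine ⟨fun r s h ↦ hb'.1 ?_, fun m ↦ ?_⟩
  · exact (key r).symm.trans (h.trans (key s))
  · obtain ⟨r, hr⟩ := hb'.2 m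
    exact ⟨r, (key r).trans hr⟩

end Pullback


/-! ### Modules with local frames are coherent -/

section Coherent

variable {X : Scheme.{0}} {M : X.Modules}

/-- A frame as a linear equivalence on sections. -/
def IsFrame.sectionEquiv {U : X.Opens} {e : Γ(M, U)} (he : IsFrame M e) {W : X.Opens}
    (h : W ≤ U) : Γ(structureModule X, W) ≃ₗ[Γ(X, W)] Γ(M, W) :=
  LinearEquiv.ofBijective
    { toFun := fun r ↦ (show Γ(X, W) from r) • resM M h e
      map_add' := fun r s ↦ add_smul (R := Γ(X, W)) r s _
      map_smul' := fun r s ↦ mul_smul (α := Γ(X, W)) r s _ } (he W h)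

lemma IsFrame.resM_sectionEquiv {U : X.Opens} {e : Γ(M, U)} (he : IsFrame M e) {V W : X.Opens}
    (h : V ≤ U) (h' : W ≤ V) (r : Γ(structureModule X, V)) :
    he.sectionEquiv (h'.trans h) (resM _ h' r) = resM M h' (he.sectionEquiv h r) := by
  change _ = resM M h' ((show Γ(X, V) from r) • resM M h e)
  rw [resM_smul, resM_resM]
  rfl

/-- A frame over `U` as an isomorphism `𝒪_U ≅ M|_U`. -/
def IsFrame.overIso {U : X.Opens} {e : Γ(M, U)} (he : IsFrame M e) :
    SheafOfModules.unit (X.ringCatSheaf.over U) ≅ SheafOfModules.over (R := X.ringCatSheaf) M U :=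
  (SheafOfModules.fullyFaithfulForget _).preimageIso (PresheafOfModules.isoMk
    (fun Y ↦ (he.sectionEquiv Y.unop.hom.le).toModuleIso)
    (fun Y _ f ↦ ModuleCat.hom_ext (LinearMap.ext fun r ↦
      he.resM_sectionEquiv Y.unop.hom.le f.unop.left.le r)))

lemma isCoherent_of_frames {ι : Type} (U : ι → X.Opens) (hU : iSup U = ⊤)
    (e : ∀ i, Γ(M, U i)) (he : ∀ i, IsFrame M (e i)) : IsCoherent M := by
  let φ (i : ι) : SheafOfModules.free PUnit ≅ SheafOfModules.over (R := X.ringCatSheaf) M (U i) :=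
    (coproductUniqueIso fun _ : PUnit ↦ SheafOfModules.unit (X.ringCatSheaf.over (U i))) ≪≫
      (he i).overIso
  let q : SheafOfModules.LocalGeneratorsData (R := X.ringCatSheaf) M :=
    { I := ι
      X := U
      coversTop := by
        intro W x hx
        obtain ⟨i, hi⟩ := Opens.mem_iSup.1 (hU.ge (Opens.mem_top x))
        exact ⟨W ⊓ U i, homOfLE inf_le_left, ⟨i, ⟨homOfLE inf_le_right⟩⟩, hx, hi⟩
      generators := fun i ↦ (SheafOfModules.free.generatingSections PUnit).ofEpi (φ i).hom }
  have hq : q.IsLocallyFreeData := ⟨fun i ↦ by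
    have h := SheafOfModules.GeneratingSections.ofEpi_π
      (SheafOfModules.free.generatingSections PUnit) (φ i).hom
    rw [SheafOfModules.free.generatingSections_π] at h
    exact (congrArg IsIso (h.trans (Category.id_comp _))).mpr (Iso.isIso_hom (φ i))⟩
  have hq' : q.shrink.IsFiniteType := ⟨fun i ↦ ⟨inferInstanceAs (Finite PUnit)⟩⟩
  exact ⟨q.quasiCoherentData.isQuasicoherent, ⟨q.shrink, hq'⟩⟩

end Coherent

/-! ### Line bundles described by weights on charts -/

section Charts

/-- An open cover together with functions `g v w` on the `w`-th chart, to be thought of as the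
ratios `x_v / x_w` of homogeneous coordinates. -/
structure Charts (X : Scheme.{0}) (ι : Type) where
  U : ι → X.Opens
  cover : iSup U = ⊤
  g : ∀ _ w : ι, Γ(X, U w)
  g_self : ∀ v, g v v = 1
  cocycle : ∀ u v w, resO (inf_le_right : U v ⊓ U w ≤ U w) (g u w) =
    resO inf_le_left (g u v) * resO inf_le_right (g v w)
  basicOpen_g : ∀ v w, X.basicOpen (g v w) = U v ⊓ U w

variable {X : Scheme.{0}} {ι : Type} (C : Charts X ι)

namespace Charts

lemma g_mul_g (v w : ι) : resO (inf_le_right : C.U v ⊓ C.U w ≤ C.U w) (C.g v w) *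
    resO inf_le_left (C.g w v) = 1 := by
  rw [mul_comm, ← C.cocycle w v w, C.g_self, map_one]

/-- The transition functions on overlaps. -/
def trans (v w : ι) : Γ(X, C.U v ⊓ C.U w)ˣ where
  val := resO inf_le_right (C.g v w)
  inv := resO inf_le_left (C.g w v)
  val_inv := C.g_mul_g v w
  inv_val := by rw [mul_comm, g_mul_g]

/-- `M` is, with respect to the charts, isomorphic to `𝒪(d)`. -/
def HasWeight (M : X.Modules) (d : ℤ) : Prop :=
  ∃ e : ∀ w, Γ(M, C.U w), (∀ w, IsFrame M (e w)) ∧ ∀ v w,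
    resM M (inf_le_left : C.U v ⊓ C.U w ≤ C.U v) (e v) =
      ((C.trans v w ^ d : Γ(X, C.U v ⊓ C.U w)ˣ) : Γ(X, C.U v ⊓ C.U w)) • resM M inf_le_right (e w)

variable {C}

lemma HasWeight.isCoherent {M : X.Modules} {d : ℤ} (h : C.HasWeight M d) : IsCoherent M := by
  obtain ⟨e, he, -⟩ := h
  exact isCoherent_of_frames C.U C.cover e he

variable (C) in
lemma hasWeight_structureModule : C.HasWeight (structureModule X) 0 :=
  ⟨fun w ↦ oneSec _, fun w ↦ isFrame_one _, fun v w ↦ by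
    rw [resM_oneSec, resM_oneSec, zpow_zero, Units.val_one, one_smul]⟩

lemma HasWeight.tensorModule {M N : X.Modules} {c d : ℤ} (hM : C.HasWeight M c)
    (hN : C.HasWeight N d) : C.HasWeight (tensorModule M N) (c + d) := by
  obtain ⟨e, he, he'⟩ := hM
  obtain ⟨f, hf, hf'⟩ := hN
  refine ⟨fun w ↦ tmulSec (e w) (f w), fun w ↦ (he w).tmulSec (hf w), fun v w ↦ ?_⟩
  rw [resM_tmulSec, resM_tmulSec, he', hf', smul_tmulSec_smul, zpow_add, Units.val_mul]

lemma HasWeight.dualModule {M : X.Modules} {d : ℤ} (hM : C.HasWeight M d) :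
    C.HasWeight (dualModule M) (-d) := by
  obtain ⟨e, he, he'⟩ := hM
  refine ⟨fun w ↦ (he w).dual, fun w ↦ (he w).isFrame_dual, fun v w ↦ ?_⟩
  refine dual_ext fun V hV m ↦ ?_
  rw [dualEval_smul, dualEval_resM, dualEval_resM, (he v).dualEval_dual, (he w).dualEval_dual]
  refine (he v).coord_eq _ ?_
  rw [← resM_resM M inf_le_left hV, he' v w, resM_smul, smul_smul, resM_resM, mul_right_comm,
    ← map_mul, ← Units.val_mul, ← zpow_add, neg_add_cancel, zpow_zero, Units.val_one, map_one,
    one_mul, (he w).coord_smul_frame]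

lemma HasWeight.tensorNPow {M : X.Modules} {d : ℤ} (hM : C.HasWeight M d) (k : ℕ) :
    C.HasWeight (tensorNPow M k) (k * d) := by
  induction k with
  | zero => simpa using! C.hasWeight_structureModule
  | succ k ih =>
    have := ih.tensorModule hM
    rw [Nat.cast_succ, add_mul, one_mul]
    exact this

lemma HasWeight.tensorPow {M : X.Modules} {d : ℤ} (hM : C.HasWeight M d) (i : ℤ) :
    C.HasWeight (tensorPow M i) (i * d) := by
  match i with
  | Int.ofNat k => exact hM.tensorNPow k
  | Int.negSucc k =>
    have := hM.dualModule.tensorNPow (k + 1)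
    have h : ((k + 1 : ℕ) : ℤ) * -d = Int.negSucc k * d := by
      rw [Int.negSucc_eq]; push_cast; ring
    rw [h] at this
    exact this

lemma resO_app {Y : Scheme.{0}} (f : Y ⟶ X) {U V : X.Opens} (h : V ≤ U) (a : Γ(X, U)) :
    resO (f.preimage_mono h) ((f.app U).hom a) = (f.app V).hom (resO h a) :=
  (ConcreteCategory.congr_hom (f.naturality (homOfLE h).op) a).symm

variable (C) in
/-- The inverse image of charts. -/
def pullback {Y : Scheme.{0}} (f : Y ⟶ X) : Charts Y ι where
  U w := f ⁻¹ᵁ C.U w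
  cover := by
    rw [← Scheme.Hom.preimage_iSup, C.cover]
    rfl
  g v w := (f.app (C.U w)).hom (C.g v w)
  g_self v := by rw [C.g_self, map_one]
  cocycle u v w := by
    have := congrArg (f.app (C.U v ⊓ C.U w)).hom (C.cocycle u v w)
    rw [map_mul, ← resO_app, ← resO_app, ← resO_app] at this
    exact this
  basicOpen_g v w := by
    rw [← Scheme.preimage_basicOpen, C.basicOpen_g]
    rfl

/-- Pulled-back frames have pulled-back transition functions, and a ring homomorphism commutes with
integer powers of units. -/
lemma HasWeight.pullback {Y : Scheme.{0}} (f : Y ⟶ X) {M : X.Modules} {d : ℤ}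
    (hM : C.HasWeight M d) : (C.pullback f).HasWeight ((Scheme.Modules.pullback f).obj M) d := by
  obtain ⟨e, he, he'⟩ := hM
  refine ⟨fun w ↦ pullbackSec f (e w), fun w ↦ (he w).pullbackSec f, fun v w ↦ ?_⟩
  have := congrArg (pullbackSec f) (he' v w)
  rw [pullbackSec_smul, ← resM_pullbackSec, ← resM_pullbackSec] at this
  refine this.trans ?_
  congr 1
  let G : Γ(X, C.U v ⊓ C.U w) →+* Γ(Y, (C.pullback f).U v ⊓ (C.pullback f).U w) :=
    (f.app (C.U v ⊓ C.U w)).hom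
  have h : (C.pullback f).trans v w = Units.map (G : _ →* _) (C.trans v w) :=
    Units.ext (resO_app f (inf_le_right : C.U v ⊓ C.U w ≤ C.U w) (C.g v w))
  rw [h, ← map_zpow]
  rfl

end Charts

end Charts


/-! ### Extending sections after a twist -/

section Extension

variable {Y : Scheme.{0}}

/-- Sections of `Z` over basic opens of affine opens are obtained by localization. -/
structure LocalizesSections (Z : Y.Modules) : Prop where
  exists_extend : ∀ (U : Y.Opens), IsAffineOpen U → ∀ (g : Γ(Y, U)) (D : Y.Opens) (hD : D ≤ U),
    D = Y.basicOpen g → ∀ s : Γ(Z, D), ∃ (m : ℕ) (t : Γ(Z, U)), resM Z hD t = resO hD g ^ m • s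
  exists_kill : ∀ (U : Y.Opens), IsAffineOpen U → ∀ (g : Γ(Y, U)) (D : Y.Opens) (hD : D ≤ U),
    D = Y.basicOpen g → ∀ t : Γ(Z, U), resM Z hD t = 0 → ∃ m : ℕ, g ^ m • t = 0

/-- Extend in `A`, then kill the image in `B` by a further power of `g`. This gives the localization
property for kernels without proving that they are quasi-coherent. -/
lemma LocalizesSections.of_kernel {Z A B : Y.Modules} (i : Z ⟶ A) (d : A ⟶ B)
    (hA : LocalizesSections A) (hB : LocalizesSections B)
    (hi : ∀ U, Function.Injective (i.app U)) (hid : i ≫ d = 0)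
    (hker : ∀ (U : Y.Opens) (a : Γ(A, U)), d.app U a = 0 → ∃ z, i.app U z = a) :
    LocalizesSections Z where
  exists_extend U hU g D hD hDg s := by
    obtain ⟨m, t, ht⟩ := hA.exists_extend U hU g D hD hDg (i.app D s)
    have h0 : d.app D (i.app D s) = 0 := by
      have := congrArg (fun φ ↦ Scheme.Modules.Hom.app φ D s) hid
      exact this
    obtain ⟨m', hm'⟩ := hB.exists_kill U hU g D hD hDg (d.app U t) (by
      rw [← app_resM, ht, Scheme.Modules.Hom.app_smul, h0, smul_zero])
    rw [← Scheme.Modules.Hom.app_smul] at hm'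
    obtain ⟨z, hz⟩ := hker U _ hm'
    refine ⟨m' + m, z, hi D ?_⟩
    rw [app_resM, hz, resM_smul, ht, map_pow, Scheme.Modules.Hom.app_smul, smul_smul, pow_add]
  exists_kill U hU g D hD hDg t ht := by
    obtain ⟨m, hm⟩ := hA.exists_kill U hU g D hD hDg (i.app U t) (by
      rw [← app_resM, ht, map_zero])
    refine ⟨m, hi U ?_⟩
    rw [Scheme.Modules.Hom.app_smul, hm, map_zero]

variable {ι : Type} (C : Charts Y ι)

/-- A family of sections `t w` of `Z` that defines a section of `Z(k)`. -/
def Charts.IsTwisted {Z : Y.Modules} (k : ℕ) (t : ∀ w, Γ(Z, C.U w)) : Prop :=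
  ∀ u w, resM Z (inf_le_right : C.U u ⊓ C.U w ≤ C.U w) (t w) =
    resO (inf_le_right : C.U u ⊓ C.U w ≤ C.U w) (C.g u w) ^ k •
      resM Z (inf_le_left : C.U u ⊓ C.U w ≤ C.U u) (t u)

/-- Serre's extension argument. On each chart, `(x_v / x_w)^m s` extends from `U v ⊓ U w` to `U w`
for some `m`. The extensions may disagree on overlaps, but the disagreement vanishes on `U v`, so
another power of `x_v / x_w` removes it. Finiteness of the cover makes both exponents uniform. -/
lemma Charts.exists_extend [Finite ι] (hC : ∀ w, IsAffineOpen (C.U w)) {Z : Y.Modules}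
    (hZ : LocalizesSections Z) (v : ι) (s : Γ(Z, C.U v)) :
    ∃ k₀ : ℕ, ∀ k ≥ k₀, ∃ t : ∀ w, Γ(Z, C.U w), t v = s ∧ C.IsTwisted k t := by
  cases nonempty_fintype ι
  choose m t' ht' using fun w ↦ hZ.exists_extend (C.U w) (hC w) (C.g v w) (C.U v ⊓ C.U w)
    inf_le_right (C.basicOpen_g v w).symm (resM Z inf_le_left s)
  let m₀ := Finset.univ.sup m
  have hm (w : ι) : m w ≤ m₀ := Finset.le_sup (Finset.mem_univ w)
  let T (w : ι) : Γ(Z, C.U w) := C.g v w ^ (m₀ - m w) • t' w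
  have hT (w : ι) : resM Z (inf_le_right : C.U v ⊓ C.U w ≤ C.U w) (T w) =
      resO (inf_le_right : C.U v ⊓ C.U w ≤ C.U w) (C.g v w) ^ m₀ •
        resM Z (inf_le_left : C.U v ⊓ C.U w ≤ C.U v) s := by
    rw [resM_smul, ht', smul_smul, map_pow, ← pow_add, Nat.sub_add_cancel (hm w)]
  clear_value T
  -- The failure of the family `T` to be twisted of degree `m₀`; it vanishes on `U v` by the cocycle
  -- identity.
  let δ (u w : ι) : Γ(Z, C.U u ⊓ C.U w) := resM Z inf_le_right (T w) -
    resO (inf_le_right : C.U u ⊓ C.U w ≤ C.U w) (C.g u w) ^ m₀ •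
      resM Z (inf_le_left : C.U u ⊓ C.U w ≤ C.U u) (T u)
  have hδ (u w : ι) : resM Z (inf_le_right : C.U v ⊓ (C.U u ⊓ C.U w) ≤ _) (δ u w) = 0 := by
    have h1 := congrArg (resM Z (le_inf inf_le_left (inf_le_right.trans inf_le_right) :
      C.U v ⊓ (C.U u ⊓ C.U w) ≤ C.U v ⊓ C.U w)) (hT w)
    have h2 := congrArg (resM Z (le_inf inf_le_left (inf_le_right.trans inf_le_left) :
      C.U v ⊓ (C.U u ⊓ C.U w) ≤ C.U v ⊓ C.U u)) (hT u)
    have h3 := congrArg (resO (inf_le_right : C.U v ⊓ (C.U u ⊓ C.U w) ≤ _)) (C.cocycle v u w)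
    simp only [resM_smul, resM_resM, map_pow, resO_resO, map_mul] at h1 h2 h3
    simp only [δ, map_sub, resM_smul, resM_resM, map_pow, resO_resO]
    rw [h1, h2, h3, smul_smul, ← mul_pow, mul_comm, sub_self]
  have haff (u w : ι) : IsAffineOpen (C.U u ⊓ C.U w) := by
    rw [← C.basicOpen_g u w]
    exact (hC w).basicOpen _
  choose m₁ hm₁ using fun u w ↦ hZ.exists_kill _ (haff u w) (resO inf_le_right (C.g v w))
    (C.U v ⊓ (C.U u ⊓ C.U w)) inf_le_right (by
      rw [resO]
      refine Eq.trans ?_ (Y.basicOpen_res _ _).symm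
      rw [C.basicOpen_g]
      exact le_antisymm (le_inf inf_le_right (inf_le_inf_left _ inf_le_right))
        (le_inf (inf_le_right.trans inf_le_left) inf_le_left)) _ (hδ u w)
  let k₁ := Finset.univ.sup fun u ↦ Finset.univ.sup fun w ↦ m₁ u w
  have hk (u w : ι) : m₁ u w ≤ k₁ :=
    (Finset.le_sup (f := fun w ↦ m₁ u w) (Finset.mem_univ w)).trans
      (Finset.le_sup (f := fun u ↦ Finset.univ.sup fun w ↦ m₁ u w) (Finset.mem_univ u))
  refine ⟨m₀ + k₁, fun k hk' ↦ ⟨fun w ↦ C.g v w ^ (k - m₀) • T w, ?_, fun u w ↦ ?_⟩⟩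
  · dsimp only
    rw [C.g_self, one_pow, one_smul]
    -- Since `g v v = 1`, no power of a coordinate alters the section on the chart `v` itself.
    have h : C.U v ≤ C.U v ⊓ C.U v := le_inf le_rfl le_rfl
    have := congrArg (resM Z h) (hT v)
    simpa only [C.g_self, map_one, one_pow, one_smul, resM_resM, resM_rfl] using this
  · have h1 : resO (inf_le_right : C.U u ⊓ C.U w ≤ _) (C.g v w) ^ (k - m₀) • δ u w = 0 := by
      have : k - m₀ = (k - m₀ - m₁ u w) + m₁ u w := by have := hk u w; omega
      rw [this, pow_add, mul_smul, hm₁, smul_zero]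
    dsimp only
    rw [resM_smul, resM_smul, map_pow, map_pow]
    simp only [δ, smul_sub, sub_eq_zero] at h1
    rw [h1, smul_smul, smul_smul, C.cocycle v u w, mul_pow, mul_assoc, ← pow_add,
      Nat.sub_add_cancel (by omega), mul_comm]

/-- Send the frame of `M` on each chart to `t w`: the transition functions of weight `-k` are
inverse to those in the twisting condition, so these maps agree on overlaps. -/
lemma Charts.HasWeight.exists_hom {C : Charts Y ι} {M Z : Y.Modules} {k : ℕ}
    (hM : C.HasWeight M (-k)) (t : ∀ w, Γ(Z, C.U w)) (ht : C.IsTwisted k t) :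
    ∃ φ : M ⟶ Z, ∀ w, ∃ e, φ.app (C.U w) e = t w := by
  obtain ⟨e, he, hee⟩ := hM
  obtain ⟨φ, hφ⟩ := exists_glue_hom (M := M) (N := Z) C.U C.cover
    (fun w W hW ↦ ((he w).coord hW).smulRight (resM Z hW (t w))) (by
      intro w W V hW h m
      rw [LinearMap.smulRight_apply, LinearMap.smulRight_apply, resM_smul, resM_resM,
        (he w).resO_coord]) (by
      intro u w W hu hw m
      rw [LinearMap.smulRight_apply, LinearMap.smulRight_apply]
      have hW : W ≤ C.U u ⊓ C.U w := le_inf hu hw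
      have h1 := congrArg (resM Z hW) (ht u w)
      rw [resM_smul, resM_resM, resM_resM] at h1
      have h2 := congrArg (resM M hW) (hee u w)
      rw [resM_smul, resM_resM, resM_resM] at h2
      have h3 : (he w).coord hw m = (he u).coord hu m *
          resO hW ((C.trans u w ^ (-(k : ℤ)) : Γ(Y, C.U u ⊓ C.U w)ˣ) : Γ(Y, C.U u ⊓ C.U w)) := by
        refine (he w).coord_eq hw ?_
        rw [mul_smul, ← h2, (he u).coord_smul_frame]
      have h4 : resO hW ((C.trans u w ^ (-(k : ℤ)) : Γ(Y, C.U u ⊓ C.U w)ˣ) :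
          Γ(Y, C.U u ⊓ C.U w)) * resO hW (resO inf_le_right (C.g u w) ^ k) = 1 := by
        rw [← map_mul]
        change resO hW (_ * ((C.trans u w : Γ(Y, C.U u ⊓ C.U w)ˣ) : Γ(Y, C.U u ⊓ C.U w)) ^ k) = 1
        rw [← Units.val_pow_eq_pow_val, ← Units.val_mul, ← zpow_natCast, ← zpow_add,
          neg_add_cancel, zpow_zero, Units.val_one, map_one]
      rw [h1, h3, smul_smul, mul_assoc, h4, mul_one])
  refine ⟨φ, fun w ↦ ⟨e w, ?_⟩⟩
  rw [hφ w _ le_rfl, LinearMap.smulRight_apply, resM_rfl]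
  have := (he w).coord_frame le_rfl
  rw [resM_rfl] at this
  rw [this, one_smul]

/-- If `q : Z ⟶ H` is nonzero then so is its composition with some `M ⟶ Z` for every `M` of
sufficiently negative weight. -/
lemma Charts.exists_comp_ne_zero [Finite ι] (hC : ∀ w, IsAffineOpen (C.U w)) {Z H : Y.Modules}
    (hZ : LocalizesSections Z) (q : Z ⟶ H) (hq : q ≠ 0) :
    ∃ k₀ : ℕ, ∀ k ≥ k₀, ∀ M : Y.Modules, C.HasWeight M (-k) → ∃ φ : M ⟶ Z, φ ≫ q ≠ 0 := by
  obtain ⟨W, s, hs⟩ : ∃ (W : Y.Opens) (s : Γ(Z, W)), q.app W s ≠ 0 := by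
    by_contra! h
    exact hq (Scheme.Modules.hom_ext _ _ fun W ↦ by ext s; exact h W s)
  -- A section with nonzero image must be found over a whole chart. Shrink to a basic open of a
  -- chart where the image is still nonzero, then clear the denominator; `g` is a unit on the basic
  -- open, so the image stays nonzero.
  have hB (x : W) : ∃ (v : ι) (g : Γ(Y, C.U v)), Y.basicOpen g ≤ W ∧ x.1 ∈ Y.basicOpen g := by
    obtain ⟨v, hv⟩ := Opens.mem_iSup.1 (C.cover.ge (Opens.mem_top x.1))
    obtain ⟨g, hg, hxg⟩ := (hC v).exists_basicOpen_le x hv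
    exact ⟨v, g, hg, hxg⟩
  choose v g hgW hxg using hB
  obtain ⟨x, hx⟩ : ∃ x, resM H (hgW x) (q.app W s) ≠ 0 := by
    by_contra! h
    refine hs (section_ext H (fun x ↦ Y.basicOpen (g x)) hgW
      (fun x hx ↦ Opens.mem_iSup.2 ⟨⟨x, hx⟩, hxg ⟨x, hx⟩⟩) fun x ↦ ?_)
    rw [h x, map_zero]
  obtain ⟨m, s', hs'⟩ := hZ.exists_extend (C.U (v x)) (hC _) (g x) _ (Y.basicOpen_le _) rfl
    (resM Z (hgW x) s)
  have hne : q.app _ s' ≠ 0 := by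
    intro h0
    have h1 := congrArg (resM H (Y.basicOpen_le (g x))) h0
    rw [← app_resM, hs', Scheme.Modules.Hom.app_smul, map_zero, app_resM] at h1
    have hu : IsUnit (resO (Y.basicOpen_le (g x)) (g x) ^ m) :=
      (RingedSpace.isUnit_res_basicOpen Y.toRingedSpace (g x)).pow m
    exact hx (hu.smul_eq_zero.1 h1)
  obtain ⟨k₀, hk₀⟩ := C.exists_extend hC hZ (v x) s'
  refine ⟨k₀, fun k hk M hM ↦ ?_⟩
  obtain ⟨t, htv, ht⟩ := hk₀ k hk
  obtain ⟨φ, hφ⟩ := hM.exists_hom t ht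
  refine ⟨φ, fun h0 ↦ hne ?_⟩
  obtain ⟨e, he⟩ := hφ (v x)
  rw [htv] at he
  rw [← he]
  exact congrArg (fun ψ ↦ Scheme.Modules.Hom.app ψ _ e) h0

end Extension


/-! ### Quasi-coherent sheaves and cocycles localize -/

section Quasicoherent

variable {Y : Scheme.{0}}

/-- The localization theorem is stated on `Spec Γ(Y, U)`; this identifies its scalar action with
restriction of functions on `Y`. -/
lemma fromSpec_appIso_inv {U : Y.Opens} (hU : IsAffineOpen U) (V : (Spec Γ(Y, U)).Opens)
    (hV : hU.fromSpec ''ᵁ V ≤ U) (r : Γ(Y, U)) :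
    (hU.fromSpec.appIso V).inv ((Spec Γ(Y, U)).presheaf.map (homOfLE le_top : V ⟶ ⊤).op
      ((Scheme.ΓSpecIso Γ(Y, U)).inv r)) = resO hV r := by
  have h1 : (Scheme.ΓSpecIso Γ(Y, U)).inv ≫
      (Spec Γ(Y, U)).presheaf.map (homOfLE le_top : V ⟶ ⊤).op =
      Y.presheaf.map (homOfLE hV).op ≫ (hU.fromSpec.appIso V).hom := by
    rw [Scheme.Hom.appIso_hom', Scheme.Hom.map_appLE, Scheme.Hom.appLE, hU.fromSpec_app_self,
      Category.assoc, ← Functor.map_comp]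
    rfl
  exact ((ConcreteCategory.congr_hom (((Iso.comp_inv_eq _).2 h1)) r))

lemma restrict_fromSpec_smul (M : Y.Modules) {U : Y.Opens} (hU : IsAffineOpen U)
    (V : (Spec Γ(Y, U)).Opens) (hV : hU.fromSpec ''ᵁ V ≤ U) (r : Γ(Y, U))
    (x : Γ(M.restrict hU.fromSpec, V)) :
    (M.restrictAppIso hU.fromSpec V).hom (r • x) =
      resO hV r • (M.restrictAppIso hU.fromSpec V).hom x := by
  refine (Scheme.Modules.smul_restrictAppIso_hom_apply hU.fromSpec M V
    ((Spec Γ(Y, U)).presheaf.map (homOfLE le_top : V ⟶ ⊤).op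
      ((Scheme.ΓSpecIso Γ(Y, U)).inv r)) x).trans ?_
  rw [← fromSpec_appIso_inv hU V hV r]

/-- On an affine scheme a quasi-coherent module is the sheaf associated with its global sections. -/
lemma isLocalizedModule_restrict_fromSpec (M : Y.Modules)
    (hM : SheafOfModules.IsQuasicoherent M) {U : Y.Opens} (hU : IsAffineOpen U) (g : Γ(Y, U)) :
    IsLocalizedModule (.powers g) ((modulesSpecToSheaf.obj (M.restrict hU.fromSpec)).obj.map
      (PrimeSpectrum.basicOpen g).leTop.op).hom :=
  have : SheafOfModules.IsQuasicoherent (M.restrict hU.fromSpec) :=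
    Scheme.Modules.isQuasicoherent_restrictFunctor hU.fromSpec M
  (isIso_fromTildeΓ_iff_isLocalizing (M.restrict hU.fromSpec)).1
    (Scheme.Modules.isIso_fromTildeΓ_of_isQuasicoherent _) g

lemma exists_resM_eq_of_isQuasicoherent (M : Y.Modules)
    (hM : SheafOfModules.IsQuasicoherent M) {U : Y.Opens} (hU : IsAffineOpen U) (g : Γ(Y, U))
    (V : (Spec Γ(Y, U)).Opens) (hV : V = PrimeSpectrum.basicOpen g)
    (hVU : hU.fromSpec ''ᵁ V ≤ U)
    (s : Γ(M, hU.fromSpec ''ᵁ V)) : ∃ (m : ℕ) (t : Γ(M, hU.fromSpec ''ᵁ ⊤)),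
      resM M (hU.fromSpec.image_mono le_top) t = resO hVU (g ^ m) • s := by
  subst hV
  obtain ⟨⟨t, c⟩, ht⟩ := (isLocalizedModule_restrict_fromSpec M hM hU g).surj s
  obtain ⟨_, m, rfl⟩ := c
  refine ⟨m, t, ?_⟩
  exact ht.symm.trans (restrict_fromSpec_smul M hU _ hVU (g ^ m) s)

lemma exists_smul_eq_zero_of_isQuasicoherent (M : Y.Modules)
    (hM : SheafOfModules.IsQuasicoherent M) {U : Y.Opens} (hU : IsAffineOpen U) (g : Γ(Y, U))
    (V : (Spec Γ(Y, U)).Opens) (hV : V = PrimeSpectrum.basicOpen g)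
    (htop : hU.fromSpec ''ᵁ ⊤ ≤ U)
    (t : Γ(M, hU.fromSpec ''ᵁ ⊤)) (ht : resM M (hU.fromSpec.image_mono (le_top : V ≤ ⊤)) t = 0) :
    ∃ m : ℕ, resO htop (g ^ m) • t = 0 := by
  subst hV
  obtain ⟨c, hc⟩ := (isLocalizedModule_restrict_fromSpec M hM hU g).exists_of_eq
    (x₁ := t) (x₂ := 0) (by rw [map_zero]; exact ht)
  obtain ⟨_, m, rfl⟩ := c
  exact ⟨m, (restrict_fromSpec_smul M hU ⊤ htop (g ^ m) t).symm.trans (hc.trans (smul_zero _))⟩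

lemma localizesSections_of_isQuasicoherent (M : Y.Modules)
    (hM : SheafOfModules.IsQuasicoherent M) : LocalizesSections M := by
  have htop {U : Y.Opens} (hU : IsAffineOpen U) : U = hU.fromSpec ''ᵁ ⊤ := by
    rw [Scheme.Hom.image_top_eq_opensRange, hU.opensRange_fromSpec]
  constructor
  · intro U hU g D hD hDg s
    obtain ⟨V, hV⟩ : ∃ V : (Spec Γ(Y, U)).Opens, V = PrimeSpectrum.basicOpen g := ⟨_, rfl⟩
    have hbas : D = hU.fromSpec ''ᵁ V := by
      rw [hV, hDg, hU.fromSpec_image_basicOpen g]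
    obtain ⟨m, t, ht⟩ := exists_resM_eq_of_isQuasicoherent M hM hU g V hV
      (hbas.ge.trans hD) (resM M hbas.ge s)
    refine ⟨m, resM M (htop hU).le t, (bijective_resM_of_eq M hbas.ge hbas).1 ?_⟩
    rw [resM_smul, resM_resM, resM_resM, ht, map_pow, map_pow, resO_resO]
  · intro U hU g D hD hDg t ht
    obtain ⟨V, hV⟩ : ∃ V : (Spec Γ(Y, U)).Opens, V = PrimeSpectrum.basicOpen g := ⟨_, rfl⟩
    have hbas : D = hU.fromSpec ''ᵁ V := by
      rw [hV, hDg, hU.fromSpec_image_basicOpen g]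
    obtain ⟨m, hm⟩ := exists_smul_eq_zero_of_isQuasicoherent M hM hU g V hV (htop hU).ge
      (resM M (htop hU).ge t) (by
        rw [resM_resM, ← resM_resM M hD hbas.ge, ht, map_zero])
    refine ⟨m, (bijective_resM_of_eq M (htop hU).ge (htop hU)).1 ?_⟩
    rw [map_zero, resM_smul, hm]

/-- The functor of sections over `U`. -/
def sectionsFunctor (U : Y.Opens) : Y.Modules ⥤ Ab :=
  Scheme.Modules.toPresheaf Y ⋙ (evaluation _ _).obj (.op U)

instance (U : Y.Opens) : PreservesLimits (sectionsFunctor U) :=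
  have : PreservesLimits ((evaluation (Opens Y)ᵒᵖ Ab.{0}).obj (.op U)) :=
    evaluationPreservesLimits _
  comp_preservesLimits _ _

instance (U : Y.Opens) : (sectionsFunctor U).PreservesZeroMorphisms where
  map_zero _ _ := rfl

lemma injective_app_of_mono {Z A : Y.Modules} (i : Z ⟶ A) [Mono i] (U : Y.Opens) :
    Function.Injective (i.app U) :=
  (AddCommGrpCat.mono_iff_injective _).1 (inferInstanceAs (Mono ((sectionsFunctor U).map i)))

lemma exists_app_eq_of_isKernel {Z A B : Y.Modules} {i : Z ⟶ A} {d : A ⟶ B} (w : i ≫ d = 0)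
    (h : IsLimit (KernelFork.ofι i w)) {U : Y.Opens} {a : Γ(A, U)} (ha : d.app U a = 0) :
    ∃ z, i.app U z = a := by
  have hS := ShortComplex.exact_of_f_is_kernel (ShortComplex.mk i d w) h
  have : Mono i := mono_of_isLimit_fork h
  have := hS.map_of_mono_of_preservesKernel (sectionsFunctor U) this inferInstance
  exact ((ShortComplex.ab_exact_iff _).1 this) a ha

lemma localizesSections_cycles (K : CochainComplex Y.Modules ℤ)
    (hK : ∀ i, SheafOfModules.IsQuasicoherent (K.X i)) (i : ℤ) :
    LocalizesSections (K.cycles i) :=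
  .of_kernel (K.iCycles i) (K.d i (i + 1)) (localizesSections_of_isQuasicoherent _ (hK _))
    (localizesSections_of_isQuasicoherent _ (hK _)) (injective_app_of_mono _) (K.iCycles_d _ _)
    fun _ _ ha ↦ exists_app_eq_of_isKernel (K.iCycles_d _ _)
      (K.cyclesIsKernel i (i + 1) (by simp)) ha

end Quasicoherent

/-! ### Nonzero morphisms in the bounded derived category -/

section Derived

/-- No additive structure on the localization is used. The maps to and from `z` descend to natural
transformations between the identity of `D` and the constant functor at `L.obj z`; naturality, with
components equal to the identity at `L.obj z`, forces uniqueness of maps. -/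
lemma isZero_localization_obj {C D : Type*} [Category* C] [Category* D] (L : C ⥤ D)
    (W : MorphismProperty C) [L.IsLocalization W] {z : C} (hz : IsZero z) : IsZero (L.obj z) := by
  let lift : Localization.Lifting L W ((Functor.const C).obj (L.obj z))
    ((Functor.const D).obj (L.obj z)) := ⟨Iso.refl _⟩
  let η : 𝟭 D ⟶ (Functor.const D).obj (L.obj z) := Localization.liftNatTrans L W L
    ((Functor.const C).obj (L.obj z)) _ _
    { app := fun X ↦ L.map (hz.from_ X)
      naturality := fun X Y f ↦ by
        dsimp
        rw [← L.map_comp, Category.comp_id, hz.eq_of_tgt (f ≫ hz.from_ Y) (hz.from_ X)] }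
  let θ : (Functor.const D).obj (L.obj z) ⟶ 𝟭 D := Localization.liftNatTrans L W
    ((Functor.const C).obj (L.obj z)) L _ _
    { app := fun X ↦ L.map (hz.to_ X)
      naturality := fun X Y f ↦ by
        dsimp
        rw [← L.map_comp, Category.id_comp, hz.eq_of_src (hz.to_ X ≫ f) (hz.to_ Y)] }
  have hη : η.app (L.obj z) = 𝟙 _ := by
    simp [η, lift, hz.eq_of_src (hz.from_ z) (𝟙 z), Localization.Lifting.iso]
  have hθ : θ.app (L.obj z) = 𝟙 _ := by
    simp [θ, lift, hz.eq_of_src (hz.to_ z) (𝟙 z), Localization.Lifting.iso]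
  refine ⟨fun X ↦ ⟨⟨⟨θ.app X⟩, fun g ↦ ?_⟩⟩, fun X ↦ ⟨⟨⟨η.app X⟩, fun g ↦ ?_⟩⟩⟩
  · have := θ.naturality g
    rw [hθ] at this
    simpa using! this.symm
  · have := η.naturality g
    rw [hη] at this
    simpa using! this

variable {Y : Scheme.{0}}

/-- The map from an acyclic complex to the zero complex is a quasi-isomorphism. -/
lemma isZero_Q_obj (K : BoundedComplexes Y) (hK : ∀ i, IsZero (K.obj.homology i)) :
    IsZero ((quasiIsos Y).Q.obj K) := by
  obtain ⟨T, hT⟩ : ∃ T : CochainComplex Y.Modules ℤ, IsZero T := HasZeroObject.zero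
  let Z : BoundedComplexes Y := ⟨T, fun i ↦ isCoherent_zero
    ((HomologicalComplex.eval Y.Modules (ComplexShape.up ℤ) i).map_isZero hT), 0, 0, fun i _ ↦
      (HomologicalComplex.eval Y.Modules (ComplexShape.up ℤ) i).map_isZero hT⟩
  have hZ : IsZero Z := IsZero.of_full_of_faithful_of_isZero (isBoundedCoherent Y).ι Z hT
  let f : K ⟶ Z := hZ.from_ K
  have hf : quasiIsos Y f := by
    change QuasiIso f.hom
    refine ⟨fun i ↦ ?_⟩
    rw [quasiIsoAt_iff_isIso_homologyMap]
    refine ⟨0, (hK i).eq_of_src _ _, ?_⟩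
    exact IsZero.eq_of_src ((HomologicalComplex.homologyFunctor Y.Modules
      (ComplexShape.up ℤ) i).map_isZero hT) _ _
  have := Localization.inverts (quasiIsos Y).Q (quasiIsos Y) f hf
  exact (isZero_localization_obj (quasiIsos Y).Q (quasiIsos Y) hZ).of_iso
    (asIso ((quasiIsos Y).Q.map f))

/-- Cohomology inverts quasi-isomorphisms, hence factors through the localization and detects that
two morphisms there differ. -/
lemma Q_map_ne {E K : BoundedComplexes Y} (α β : E ⟶ K)
    (h : HomologicalComplex.homologyMap α.hom 0 ≠ HomologicalComplex.homologyMap β.hom 0) :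
    (quasiIsos Y).Q.map α ≠ (quasiIsos Y).Q.map β := by
  let F : BoundedComplexes Y ⥤ Y.Modules :=
    (isBoundedCoherent Y).ι ⋙ HomologicalComplex.homologyFunctor _ _ 0
  have hF : (quasiIsos Y).IsInvertedBy F := by
    intro A B f hf
    have : QuasiIso f.hom := hf
    change IsIso (HomologicalComplex.homologyMap f.hom 0)
    infer_instance
  intro h0
  apply h
  let e := Localization.fac F hF (quasiIsos Y).Q
  have h1 := e.hom.naturality α
  have h2 := e.hom.naturality β
  have h3 : ((quasiIsos Y).Q ⋙ Localization.lift F hF (quasiIsos Y).Q).map α =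
      ((quasiIsos Y).Q ⋙ Localization.lift F hF (quasiIsos Y).Q).map β := by
    rw [Functor.comp_map, h0, Functor.comp_map]
  rw [h3, h2] at h1
  exact ((cancel_epi _).1 h1).symm

lemma comp_homologyπ_eq_zero {A : Y.Modules} {L : CochainComplex Y.Modules ℤ}
    (φ : A ⟶ L.cycles 0)
    (α : (HomologicalComplex.single Y.Modules (ComplexShape.up ℤ) 0).obj A ⟶ L)
    (hα : α.f 0 = (HomologicalComplex.singleObjXSelf (ComplexShape.up ℤ) 0 A).hom ≫ φ ≫ L.iCycles 0)
    (h0 : HomologicalComplex.homologyMap α 0 = 0) : φ ≫ L.homologyπ 0 = 0 := by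
  have h1 : HomologicalComplex.cyclesMap α 0 =
      (HomologicalComplex.singleObjCyclesSelfIso (ComplexShape.up ℤ) 0 A).hom ≫ φ := by
    rw [← cancel_mono (L.iCycles 0), HomologicalComplex.cyclesMap_i, Category.assoc,
      HomologicalComplex.singleObjCyclesSelfIso_hom, Category.assoc, hα]
  have h2 := HomologicalComplex.homologyπ_naturality α 0
  rw [h0, comp_zero, h1, Category.assoc] at h2
  exact (cancel_epi (HomologicalComplex.singleObjCyclesSelfIso
    (ComplexShape.up ℤ) 0 A).hom).1 (h2.symm.trans comp_zero.symm)

lemma exists_nontrivial_dbExt {M : ℕ → Y.Modules} (hM : ∀ k, IsCoherent (M k))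
    (h : ∀ (Z H : Y.Modules) (q : Z ⟶ H), LocalizesSections Z → q ≠ 0 →
      ∃ k₀ : ℕ, ∀ k ≥ k₀, ∃ φ : M k ⟶ Z, φ ≫ q ≠ 0) (F : DbCoh Y) (hF : ¬ IsZero F) :
    ∃ (k₀ : ℕ) (r : ℤ), ∀ k ≥ k₀, Nontrivial (DbExt r (sheafObj (M k) (hM k)) F) := by
  obtain ⟨K, ⟨e⟩⟩ := (Localization.essSurj (quasiIsos Y).Q (quasiIsos Y)).mem_essImage F
  obtain ⟨r, hr⟩ : ∃ r, ¬ IsZero (K.obj.homology r) := by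
    by_contra! h
    exact hF ((isZero_Q_obj K h).of_iso e.symm)
  let L : BoundedComplexes Y := K⟦r⟧
  have hL : ¬ IsZero (L.obj.homology 0) := fun h0 ↦ hr (h0.of_iso
    (((CochainComplex.ShiftSequence.shiftIso Y.Modules r 0 r (by simp)).app K.obj).symm ≪≫
      HomologicalComplex.homologyMapIso (((isBoundedCoherent Y).ι.commShiftIso r).app K).symm 0))
  obtain ⟨k₀, hk₀⟩ := h (L.obj.cycles 0) (L.obj.homology 0) (L.obj.homologyπ 0)
    (localizesSections_cycles L.obj (fun i ↦ (L.property.1 i).1) 0)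
    (fun h0 ↦ hL ((IsZero.iff_id_eq_zero _).2 (by
      rw [← cancel_epi (L.obj.homologyπ 0), h0, zero_comp, zero_comp])))
  refine ⟨k₀, r, fun k hk ↦ ?_⟩
  obtain ⟨φ, hφ⟩ := hk₀ k hk
  let α' : (HomologicalComplex.single Y.Modules (ComplexShape.up ℤ) 0).obj (M k) ⟶ L.obj :=
    HomologicalComplex.mkHomFromSingle (φ ≫ L.obj.iCycles 0) (fun j _ ↦ by simp)
  let α : sheafComplex (M k) (hM k) ⟶ L := ObjectProperty.homMk α'
  -- Nontriviality of the Hom set is witnessed by `α` and the image of the zero map of complexes.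
  let β : sheafComplex (M k) (hM k) ⟶ L := ObjectProperty.homMk 0
  have hne : (quasiIsos Y).Q.map α ≠ (quasiIsos Y).Q.map β := fun h0 ↦ by
    refine Q_map_ne α β (fun h0 ↦ hφ (comp_homologyπ_eq_zero φ α'
      (HomologicalComplex.mkHomFromSingle_f _ _) ?_)) h0
    exact h0.trans (HomologicalComplex.homologyMap_zero _ _ _)
  let i : (quasiIsos Y).Q.obj L ≅ F⟦r⟧ :=
    ((quasiIsos Y).Q.commShiftIso r).app K ≪≫ (shiftFunctor _ r).mapIso e
  refine ⟨⟨(quasiIsos Y).Q.map α ≫ i.hom, (quasiIsos Y).Q.map β ≫ i.hom, fun h0 ↦ hne ?_⟩⟩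
  exact (cancel_mono i.hom).1 h0

end Derived


/-! ### Polar bodies, extreme points and integral normals -/

section ConvexGeometry

open scoped Pointwise

/-- A nonnegative multiple `a • conv(S)` consists of the combinations of total weight `a`. -/
lemma mem_smul_convexHull_image {ι E : Type*} [AddCommGroup E] [Module ℝ E] (S : Finset ι)
    (f : ι → E) (hne : (convexHull ℝ (f '' (S : Set ι))).Nonempty) {a : ℝ} (ha : 0 ≤ a) (x : E) :
    x ∈ a • convexHull ℝ (f '' (S : Set ι)) ↔
      ∃ c : ι → ℝ, (∀ i ∈ S, 0 ≤ c i) ∧ ∑ i ∈ S, c i = a ∧ x = ∑ i ∈ S, c i • f i := by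
  classical
  have hull (y : E) : y ∈ convexHull ℝ (f '' (S : Set ι)) ↔
      ∃ c : ι → ℝ, (∀ i ∈ S, 0 ≤ c i) ∧ ∑ i ∈ S, c i = 1 ∧ y = ∑ i ∈ S, c i • f i := by
    constructor
    · intro hy
      rw [← Finset.coe_image, Finset.mem_convexHull'] at hy
      obtain ⟨w, hw0, hw1, rfl⟩ := hy
      -- As `f` need not be injective, the weight of a point is divided equally among the indices
      -- that map to it.
      let N (y : E) : ℝ := ({i ∈ S | f i = y}.card : ℝ)
      have hN (y) (hy : y ∈ S.image f) : N y ≠ 0 := by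
        obtain ⟨i, hi, rfl⟩ := Finset.mem_image.1 hy
        exact Nat.cast_ne_zero.2 (Finset.card_ne_zero.2 ⟨i, by simp [hi]⟩)
      have hfib (y) : ∀ i ∈ {i ∈ S | f i = y}, f i = y := fun i hi ↦ (Finset.mem_filter.1 hi).2
      refine ⟨fun i ↦ w (f i) / N (f i),
        fun i hi ↦ div_nonneg (hw0 _ (Finset.mem_image_of_mem f hi))
        (Nat.cast_nonneg _), ?_, ?_⟩
      · rw [← hw1, ← Finset.sum_fiberwise_of_maps_to (fun i hi ↦ Finset.mem_image_of_mem f hi)]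
        refine Finset.sum_congr rfl fun y hy ↦ ?_
        rw [Finset.sum_congr rfl (g := fun _ ↦ w y / N y) (fun i hi ↦ by rw [hfib y i hi]),
          Finset.sum_const, nsmul_eq_mul, mul_div_cancel₀]
        exact hN y hy
      · rw [← Finset.sum_fiberwise_of_maps_to (fun i hi ↦ Finset.mem_image_of_mem f hi)]
        refine Finset.sum_congr rfl fun y hy ↦ ?_
        rw [Finset.sum_congr rfl (g := fun _ ↦ (w y / N y) • y)
            (fun i hi ↦ by simp only [hfib y i hi]),
          Finset.sum_const, ← Nat.cast_smul_eq_nsmul ℝ, smul_smul, mul_div_cancel₀]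
        exact hN y hy
    · rintro ⟨c, h0, h1, rfl⟩
      exact (convex_convexHull ℝ _).sum_mem h0 h1 fun i hi ↦
        subset_convexHull ℝ _ ⟨i, hi, rfl⟩
  constructor
  · rintro ⟨y, hy, rfl⟩
    obtain ⟨c, h0, h1, rfl⟩ := (hull y).1 hy
    refine ⟨fun i ↦ a * c i, fun i hi ↦ mul_nonneg ha (h0 i hi), ?_, ?_⟩
    · rw [← Finset.mul_sum, h1, mul_one]
    · simp [Finset.smul_sum, smul_smul]
  · rintro ⟨c, h0, h1, rfl⟩
    rcases ha.eq_or_lt with rfl | ha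
    · obtain ⟨y, hy⟩ := hne
      refine ⟨y, hy, ?_⟩
      rw [Finset.sum_eq_zero_iff_of_nonneg h0] at h1
      rw [Finset.sum_eq_zero fun i hi ↦ by rw [h1 i hi, zero_smul]]
      simp
    · refine ⟨∑ i ∈ S, (a⁻¹ * c i) • f i, (hull _).2 ⟨fun i ↦ a⁻¹ * c i, fun i hi ↦
        mul_nonneg (inv_nonneg.2 ha.le) (h0 i hi), ?_, rfl⟩, ?_⟩
      · rw [← Finset.mul_sum, h1, inv_mul_cancel₀ ha.ne']
      · simp only [Finset.smul_sum, smul_smul]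
        refine Finset.sum_congr rfl fun i _ ↦ ?_
        rw [← mul_assoc, mul_inv_cancel₀ ha.ne', one_mul]

variable {n : ℕ}

lemma exists_dotProduct_eq (f : (Fin n → ℝ) →ₗ[ℝ] ℝ) :
    ∃ w : Fin n → ℝ, ∀ x, f x = x ⬝ᵥ w := by
  refine ⟨fun i ↦ f (Pi.single i 1), fun x ↦ ?_⟩
  conv_lhs => rw [pi_eq_sum_univ' x]
  simp [dotProduct]

/-- A proper subspace of `ℝⁿ` is annihilated by a nonzero vector. -/
lemma exists_dotProduct_eq_zero {W : Submodule ℝ (Fin n → ℝ)} (hW : W ≠ ⊤) :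
    ∃ z : Fin n → ℝ, z ≠ 0 ∧ ∀ x ∈ W, x ⬝ᵥ z = 0 := by
  obtain ⟨f, hf0, hf⟩ := W.exists_le_ker_of_lt_top hW.lt_top
  obtain ⟨z, hz⟩ := exists_dotProduct_eq f
  refine ⟨z, ?_, fun x hx ↦ (hz x).symm.trans (hf hx)⟩
  rintro rfl
  exact hf0 (LinearMap.ext fun x ↦ by simp [hz])

/-- The polar body of `T - p`. -/
def polarBody (T : Set (Fin n → ℝ)) (p : Fin n → ℝ) : Set (Fin n → ℝ) :=
  {w | ∀ s ∈ T, -1 ≤ (s - p) ⬝ᵥ w}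

lemma polarBody_convexHull {T : Set (Fin n → ℝ)} {p w : Fin n → ℝ} (hw : w ∈ polarBody T p) :
    w ∈ polarBody (convexHull ℝ T) p := by
  intro s hs
  have hc : Convex ℝ {s : Fin n → ℝ | -1 + p ⬝ᵥ w ≤ s ⬝ᵥ w} :=
    convex_halfSpace_ge ⟨fun x y ↦ add_dotProduct x y w, fun c x ↦ smul_dotProduct c x w⟩ _
  have : -1 + p ⬝ᵥ w ≤ s ⬝ᵥ w := convexHull_min (fun s hs ↦ by
    have := hw s hs
    rw [sub_dotProduct] at this
    change -1 + p ⬝ᵥ w ≤ s ⬝ᵥ w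
    linarith) hc hs
  rw [sub_dotProduct]
  linarith

lemma isClosed_polarBody (T : Set (Fin n → ℝ)) (p : Fin n → ℝ) : IsClosed (polarBody T p) := by
  have : polarBody T p = ⋂ s ∈ T, {w | -1 ≤ (s - p) ⬝ᵥ w} := by
    ext w; simp [polarBody]
  rw [this]
  refine isClosed_biInter fun s _ ↦ isClosed_le continuous_const ?_
  unfold dotProduct
  fun_prop

/-- A ball of radius `ε` around `p` lies in the hull; testing `w` against `p ± (ε/2)e_i` bounds each
coordinate by `2/ε`. -/
lemma isCompact_polarBody {T : Set (Fin n → ℝ)} {p : Fin n → ℝ}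
    (hp : p ∈ interior (convexHull ℝ T)) : IsCompact (polarBody T p) := by
  obtain ⟨ε, hε, hball⟩ := Metric.isOpen_iff.1 isOpen_interior p hp
  refine (isCompact_Icc (a := fun _ : Fin n ↦ -(2 / ε)) (b := fun _ ↦ 2 / ε)).of_isClosed_subset
    (isClosed_polarBody T p) fun w hw ↦ ?_
  have key (i : Fin n) (δ : ℝ) (hδ : |δ| < ε) : -1 ≤ δ * w i := by
    have := polarBody_convexHull hw (p + Pi.single i δ) (interior_subset (hball (by
      rw [Metric.mem_ball, dist_eq_norm, add_sub_cancel_left, Pi.norm_single]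
      exact hδ)))
    simpa using this
  have h2 : 0 < 2 / ε := by positivity
  have hε2 : |ε / 2| < ε := by rw [abs_of_pos (by positivity)]; linarith
  have hε3 : |-(ε / 2)| < ε := by rwa [abs_neg]
  refine ⟨fun i ↦ ?_, fun i ↦ ?_⟩
  · have h3 := mul_le_mul_of_nonneg_left (key i _ hε2) h2.le
    rw [← mul_assoc, div_mul_div_cancel₀ hε.ne', div_self two_ne_zero] at h3
    change -(2 / ε) ≤ w i
    linarith
  · have h3 := mul_le_mul_of_nonneg_left (key i _ hε3) h2.le
    rw [neg_mul, mul_neg (2 / ε) (ε / 2 * w i), ← mul_assoc,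
      div_mul_div_cancel₀ hε.ne', div_self two_ne_zero] at h3
    change w i ≤ 2 / ε
    linarith

/-- The points of `T` that are active at an extreme point of the polar body span. -/
lemma span_active_eq_top {T : Set (Fin n → ℝ)} (hT : T.Finite) {p w : Fin n → ℝ}
    (hw : w ∈ (polarBody T p).extremePoints ℝ) :
    Submodule.span ℝ {y | ∃ s ∈ T, (s - p) ⬝ᵥ w = -1 ∧ y = s - p} = ⊤ := by
  by_contra hne
  obtain ⟨z, hz0, hz⟩ := exists_dotProduct_eq_zero hne
  -- With `z` orthogonal to every active point, moving along `z` preserves the active equalities,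
  -- and small moves preserve the finitely many strict inequalities. So `w` would be the midpoint of
  -- a segment in the polar body.
  have hev : ∀ᶠ ε : ℝ in nhds 0, ∀ s ∈ T, -1 ≤ (s - p) ⬝ᵥ (w + ε • z) := by
    rw [hT.eventually_all]
    intro s hs
    rcases (hw.1 s hs).eq_or_lt with h | h
    · refine Filter.Eventually.of_forall fun ε ↦ ?_
      rw [dotProduct_add, dotProduct_smul,
        hz _ (Submodule.subset_span ⟨s, hs, h.symm, rfl⟩), smul_zero, add_zero]
      exact h.le
    · have hc : Continuous fun ε : ℝ ↦ (s - p) ⬝ᵥ (w + ε • z) := by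
        unfold dotProduct
        fun_prop
      exact (hc.continuousAt.eventually (lt_mem_nhds (by simpa using h))).mono fun _ h ↦ h.le
  obtain ⟨ε, hε, hball⟩ := Metric.eventually_nhds_iff.1 hev
  have hmem (δ : ℝ) (hδ : |δ| < ε) : w + δ • z ∈ polarBody T p := hball (by simpa using hδ)
  have h1 := hmem (ε / 2) (by rw [abs_of_pos (by positivity)]; linarith)
  have h2 := hmem (-(ε / 2)) (by rw [abs_neg, abs_of_pos (by positivity)]; linarith)
  have h3 := hw.2 h1 h2 ⟨1 / 2, 1 / 2, by norm_num, by norm_num, by norm_num, by module⟩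
  have h4 : (ε / 2) • z = 0 := by simpa using h3
  rcases smul_eq_zero.1 h4 with h | h
  · linarith
  · exact hz0 h

lemma finrank_ker_dotProduct {w : Fin n → ℝ} (hw : w ≠ 0) {W : Submodule ℝ (Fin n → ℝ)}
    (hW : ∀ x ∈ W, x ⬝ᵥ w = 0) : Module.finrank ℝ W + 1 ≤ n := by
  have hlt : W < ⊤ := lt_top_iff_ne_top.2 fun h ↦ hw (by
    have := hW w (h ▸ trivial)
    exact dotProduct_self_eq_zero.1 this)
  have := Submodule.finrank_lt_finrank_of_lt hlt
  simpa using this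

/-- An extreme point of the polar body cuts out a face of codimension one. -/
lemma finrank_vectorSpan_active {A : Set (Fin n → ℝ)} {p w : Fin n → ℝ} (hn : 0 < n)
    (hA : ∀ s ∈ A, (s - p) ⬝ᵥ w = -1)
    (hspan : Submodule.span ℝ {y | ∃ s ∈ A, y = s - p} = ⊤) :
    w ≠ 0 ∧ A.Nonempty ∧ Module.finrank ℝ (vectorSpan ℝ A) + 1 = n := by
  obtain ⟨s₀, hs₀⟩ : A.Nonempty := by
    by_contra! hA
    subst hA
    simp only [Set.mem_empty_iff_false, false_and, exists_false, Set.ofPred_false,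
      Submodule.span_empty] at hspan
    have := congrArg (fun W : Submodule ℝ (Fin n → ℝ) ↦ Module.finrank ℝ W) hspan
    simp at this
    omega
  have hw : w ≠ 0 := by
    rintro rfl
    simpa using hA s₀ hs₀
  refine ⟨hw, ⟨s₀, hs₀⟩, le_antisymm (finrank_ker_dotProduct hw fun x hx ↦ ?_) ?_⟩
  · induction hx using Submodule.span_induction with
    | mem x hx =>
      obtain ⟨a, ha, b, hb, rfl⟩ := hx
      have h1 := hA a ha
      have h2 := hA b hb
      rw [sub_dotProduct] at h1 h2
      change (a - b) ⬝ᵥ w = 0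
      rw [sub_dotProduct]
      linarith
    | zero => simp
    | add x y _ _ hx hy => rw [add_dotProduct, hx, hy, add_zero]
    | smul c x _ hx => rw [smul_dotProduct, hx, smul_zero]
  · have hle : (⊤ : Submodule ℝ (Fin n → ℝ)) ≤
        vectorSpan ℝ A ⊔ Submodule.span ℝ {s₀ - p} := by
      rw [← hspan, Submodule.span_le]
      rintro _ ⟨s, hs, rfl⟩
      have : s - p = (s -ᵥ s₀) + (s₀ - p) := by rw [vsub_eq_sub]; abel
      rw [this]
      exact add_mem (Submodule.mem_sup_left (vsub_mem_vectorSpan ℝ hs hs₀))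
        (Submodule.mem_sup_right (Submodule.mem_span_singleton_self _))
    have h1 := Submodule.finrank_mono hle
    have h2 := Submodule.finrank_add_le_finrank_add_finrank (vectorSpan ℝ A)
      (Submodule.span ℝ {s₀ - p})
    have h3 := finrank_span_le_card (R := ℝ) {s₀ - p}
    simp only [finrank_top, Module.finrank_fin_fun, Set.toFinset_singleton,
      Finset.card_singleton] at h1 h3
    omega

lemma eq_zero_of_forall_dotProduct {W : Submodule ℝ (Fin n → ℝ)} {w z : Fin n → ℝ} (hw : w ≠ 0)
    (hW : ∀ x ∈ W, x ⬝ᵥ w = 0) (hdim : Module.finrank ℝ W + 1 = n)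
    (hz : ∀ x ∈ W, x ⬝ᵥ z = 0) (hwz : w ⬝ᵥ z = 0) : z = 0 := by
  have hlt : W < W ⊔ Submodule.span ℝ {w} := by
    refine lt_of_le_of_ne le_sup_left fun h ↦ hw ?_
    have : w ∈ W := h ▸ Submodule.mem_sup_right (Submodule.mem_span_singleton_self w)
    exact dotProduct_self_eq_zero.1 (hW w this)
  have htop : W ⊔ Submodule.span ℝ {w} = ⊤ := by
    refine Submodule.eq_top_of_finrank_eq (le_antisymm (Submodule.finrank_le _) ?_)
    have := Submodule.finrank_lt_finrank_of_lt hlt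
    rw [Module.finrank_fin_fun]
    omega
  obtain ⟨a, ha, b, hb, hab⟩ := Submodule.mem_sup.1 (htop ▸ Submodule.mem_top : z ∈ _)
  obtain ⟨c, rfl⟩ := Submodule.mem_span_singleton.1 hb
  rw [← dotProduct_self_eq_zero]
  nth_rewrite 1 [← hab]
  rw [add_dotProduct, smul_dotProduct, hz a ha, hwz, smul_zero, add_zero]

/-- If the rational span were everything, so would be the real span. Hence a nonzero rational
functional kills `B`, and clearing denominators makes it integral. -/
lemma exists_integral_annihilator (B : Set (Fin n → ℤ))
    (hB : Submodule.span ℝ (latticePt '' B) ≠ ⊤) :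
    ∃ u : Fin n → ℤ, u ≠ 0 ∧ ∀ b ∈ B, latticePt b ⬝ᵥ latticePt u = 0 := by
  let r (b : Fin n → ℤ) : Fin n → ℚ := fun i ↦ b i
  let L : (Fin n → ℚ) →ₗ[ℚ] (Fin n → ℝ) :=
    LinearMap.pi fun i ↦ (Algebra.linearMap ℚ ℝ) ∘ₗ LinearMap.proj i
  have hL (x : Fin n → ℚ) (i) : L x i = (x i : ℝ) := rfl
  have hspan (x : Fin n → ℚ) (hx : x ∈ Submodule.span ℚ (r '' B)) :
      L x ∈ Submodule.span ℝ (latticePt '' B) := by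
    induction hx using Submodule.span_induction with
    | mem x hx =>
      obtain ⟨b, hb, rfl⟩ := hx
      refine Submodule.subset_span ⟨b, hb, ?_⟩
      ext i
      simp [hL, r, latticePt]
    | zero => simp
    | add x y _ _ hx hy => rw [map_add]; exact add_mem hx hy
    | smul c x _ hx =>
      have : L (c • x) = (c : ℝ) • L x := by
        ext i
        simp [hL]
      rw [this]
      exact Submodule.smul_mem _ _ hx
  have hlt : Submodule.span ℚ (r '' B) < ⊤ := by
    refine lt_top_iff_ne_top.2 fun h ↦ hB ?_
    rw [eq_top_iff, ← (Pi.basisFun ℝ (Fin n)).span_eq, Submodule.span_le]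
    rintro _ ⟨i, rfl⟩
    have := hspan (Pi.single i 1) (h ▸ Submodule.mem_top)
    have he : L (Pi.single i 1) = Pi.basisFun ℝ (Fin n) i := by
      ext j
      by_cases hj : j = i
      · subst hj; simp [hL]
      · simp [hL, hj]
    rwa [he] at this
  obtain ⟨f, hf0, hf⟩ := Submodule.exists_le_ker_of_lt_top _ hlt
  let q (i : Fin n) : ℚ := f (Pi.single i 1)
  have hq (x : Fin n → ℚ) : f x = ∑ i, x i * q i := by
    conv_lhs => rw [pi_eq_sum_univ' x]
    simp [q]
  obtain ⟨D, hD⟩ := IsLocalization.exist_integer_multiples_of_finite (nonZeroDivisors ℤ) q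
  choose u hu using hD
  have hu' (i) : (u i : ℚ) = (D : ℤ) * q i := by
    have := hu i
    simpa [Algebra.smul_def] using this
  have hD0 : ((D : ℤ) : ℚ) ≠ 0 := by exact_mod_cast nonZeroDivisors.coe_ne_zero D
  refine ⟨u, ?_, fun b hb ↦ ?_⟩
  · rintro rfl
    refine hf0 (LinearMap.ext fun x ↦ ?_)
    rw [hq, LinearMap.zero_apply]
    refine Finset.sum_eq_zero fun i _ ↦ ?_
    have := hu' i
    simp only [Pi.zero_apply, Int.cast_zero, zero_eq_mul, hD0, false_or] at this
    rw [this, mul_zero]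
  · have h1 : f (r b) = 0 := hf (Submodule.subset_span ⟨b, hb, rfl⟩)
    rw [hq] at h1
    have h2 : ∑ i, (b i : ℚ) * (u i : ℚ) = 0 := by
      rw [← mul_zero ((D : ℤ) : ℚ), ← h1, Finset.mul_sum]
      refine Finset.sum_congr rfl fun i _ ↦ ?_
      rw [hu']
      ring
    unfold dotProduct latticePt
    exact_mod_cast h2

/-- A hyperplane spanned by integral vectors has a primitive integral normal vector. -/
lemma exists_primitive_normal {w : Fin n → ℝ} (hw : w ≠ 0) (B : Set (Fin n → ℤ))
    (hB : ∀ b ∈ B, latticePt b ⬝ᵥ w = 0)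
    (hdim : Module.finrank ℝ (Submodule.span ℝ (latticePt '' B)) + 1 = n) :
    ∃ (u : Fin n → ℤ) (c : ℝ), 0 < c ∧ latticePt u = c • w ∧
      ∀ d : ℤ, (∀ i, d ∣ u i) → IsUnit d := by
  have hne : Submodule.span ℝ (latticePt '' B) ≠ ⊤ := fun h ↦ by
    rw [h, finrank_top, Module.finrank_fin_fun] at hdim
    omega
  have hspan (z : Fin n → ℝ) (hz : ∀ b ∈ B, latticePt b ⬝ᵥ z = 0) :
      ∀ x ∈ Submodule.span ℝ (latticePt '' B), x ⬝ᵥ z = 0 := fun x hx ↦ by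
    induction hx using Submodule.span_induction with
    | mem x hx =>
      obtain ⟨b, hb, rfl⟩ := hx
      exact hz b hb
    | zero => simp
    | add x y _ _ hx hy => rw [add_dotProduct, hx, hy, add_zero]
    | smul c x _ hx => rw [smul_dotProduct, hx, smul_zero]
  obtain ⟨u₀, hu₀, hu₀B⟩ := exists_integral_annihilator B hne
  have : Nonempty (Fin n) := ⟨(Function.ne_iff.1 hu₀).choose⟩
  obtain ⟨u₁, hu₁, hg⟩ := Finset.extract_gcd u₀ (Finset.univ_nonempty (α := Fin n))
  have hg0 : (Finset.univ.gcd u₀) ≠ 0 := fun h ↦ hu₀ (funext fun i ↦ by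
    rw [hu₁ i (Finset.mem_univ i), h, zero_mul]; rfl)
  have hprim : ∀ d : ℤ, (∀ i, d ∣ u₁ i) → IsUnit d := fun d hd ↦
    isUnit_of_dvd_one (hg ▸ Finset.dvd_gcd fun i _ ↦ hd i)
  have hscale : latticePt u₀ = ((Finset.univ.gcd u₀ : ℤ) : ℝ) • latticePt u₁ := by
    ext i
    simp only [latticePt, Pi.smul_apply, smul_eq_mul]
    exact_mod_cast hu₁ i (Finset.mem_univ i)
  have hu₁B : ∀ b ∈ B, latticePt b ⬝ᵥ latticePt u₁ = 0 := fun b hb ↦ by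
    have := hu₀B b hb
    rw [hscale, dotProduct_smul, smul_eq_zero] at this
    exact this.resolve_left (by exact_mod_cast hg0)
  have hww : w ⬝ᵥ w ≠ 0 := fun h ↦ hw (dotProduct_self_eq_zero.1 h)
  obtain ⟨c, hc⟩ : ∃ c : ℝ, latticePt u₁ = c • w := by
    refine ⟨(w ⬝ᵥ latticePt u₁) / (w ⬝ᵥ w), sub_eq_zero.1 ?_⟩
    refine eq_zero_of_forall_dotProduct hw (hspan w hB) hdim (hspan _ fun b hb ↦ ?_) ?_
    · rw [dotProduct_sub, hu₁B b hb, dotProduct_smul, hB b hb, smul_zero, sub_zero]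
    · rw [dotProduct_sub, dotProduct_smul, smul_eq_mul, div_mul_cancel₀ _ hww, sub_self]
  -- The annihilator is a line, so the primitive vector is `c • w`; its sign is chosen so that it
  -- points in the direction of `w`.
  rcases lt_trichotomy c 0 with h | rfl | h
  · refine ⟨-u₁, -c, neg_pos.2 h, ?_, fun d hd ↦ hprim d fun i ↦ by simpa using hd i⟩
    rw [neg_smul, ← hc]
    ext i
    simp [latticePt]
  · exfalso
    rw [zero_smul] at hc
    refine hu₀ (funext fun i ↦ ?_)
    have := congrFun hc i
    simp only [latticePt, Pi.zero_apply, Int.cast_eq_zero] at this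
    rw [hu₁ i (Finset.mem_univ i), this, mul_zero]
    rfl
  · exact ⟨u₁, c, h, hc, hprim⟩

/-- A linear functional on a compact polar body attains its minimum at an extreme point. -/
lemma exists_extremePoint_le {Q : Set (Fin n → ℝ)} (hQ : IsCompact Q) (y : Fin n → ℝ)
    {w₀ : Fin n → ℝ} (hw₀ : w₀ ∈ Q) : ∃ w ∈ Q.extremePoints ℝ, y ⬝ᵥ w ≤ y ⬝ᵥ w₀ := by
  let l : StrongDual ℝ (Fin n → ℝ) := LinearMap.toContinuousLinearMap
    { toFun := fun w ↦ -(y ⬝ᵥ w)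
      map_add' := fun a b ↦ by rw [dotProduct_add]; ring
      map_smul' := fun c a ↦ by rw [dotProduct_smul]; simp }
  have hl (w) : l w = -(y ⬝ᵥ w) := rfl
  obtain ⟨w₁, hw₁, hmax⟩ := hQ.exists_isMaxOn ⟨w₀, hw₀⟩ l.continuous.continuousOn
  -- The minimizers of `y ⬝ᵥ w` form a compact exposed face, and its extreme points are extreme in
  -- `Q`.
  have hexp : IsExposed ℝ Q {w ∈ Q | ∀ y ∈ Q, l y ≤ l w} := fun _ ↦ ⟨l, rfl⟩
  obtain ⟨w, hw⟩ := (hexp.isCompact hQ).extremePoints_nonempty (E := Fin n → ℝ)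
    ⟨w₁, hw₁, fun y hy ↦ hmax hy⟩
  refine ⟨w, hexp.isExtreme.extremePoints_subset_extremePoints hw, ?_⟩
  have := hw.1.2 w₀ hw₀
  rw [hl, hl] at this
  linarith

end ConvexGeometry

/-! ### Facet inequalities and the cone of a reflexive polytope -/

namespace ReflexivePolytope

open scoped Pointwise

variable {n : ℕ} (Δ : ReflexivePolytope n)

/-- A functional separating `x` from `Δ`, normalized at an interior point `p`, lies in the polar
body of `Δ - p`. It may be replaced by an extreme point `w`, whose active set spans a face of
codimension one. Differences of lattice points span the direction of that face, so `w` is a positive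
multiple of a primitive integral conormal. -/
lemma exists_facet_of_notMem {x : Fin n → ℝ} (hx : x ∉ Δ.carrier) :
    ∃ F : Δ.Facet, pairing x F.1 < -1 := by
  obtain ⟨S, hS⟩ := Δ.lattice
  set T : Set (Fin n → ℝ) := latticePt '' (S : Set (Fin n → ℤ)) with hTdef
  have hT : T.Finite := S.finite_toSet.image _
  have hn : 0 < n := by
    rcases Nat.eq_zero_or_pos n with rfl | h
    · obtain ⟨y, hy⟩ := Δ.nonempty
      exact absurd (Subsingleton.elim y x ▸ hy) hx
    · exact h
  obtain ⟨p, hp⟩ : (interior (convexHull ℝ T)).Nonempty := by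
    rw [interior_convexHull_nonempty_iff_affineSpan_eq_top, ← affineSpan_convexHull, ← hS,
      Δ.fullDim]
  rw [hS] at hx
  obtain ⟨f, a, hfx, hfa⟩ := geometric_hahn_banach_point_closed (convex_convexHull ℝ T)
    (hT.isClosed_convexHull ℝ) hx
  obtain ⟨w₁, hw₁⟩ := exists_dotProduct_eq (f : (Fin n → ℝ) →ₗ[ℝ] ℝ)
  replace hw₁ (y) : f y = y ⬝ᵥ w₁ := hw₁ y
  have hpa : 0 < f p - a := sub_pos.2 (hfa p (interior_subset hp))
  have hval (y) : (y - p) ⬝ᵥ ((f p - a)⁻¹ • w₁) = (f y - f p) / (f p - a) := by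
    rw [dotProduct_smul, ← hw₁, map_sub, smul_eq_mul, div_eq_inv_mul]
  have hw₀ : (f p - a)⁻¹ • w₁ ∈ polarBody T p := fun s hs ↦ by
    rw [hval, le_div_iff₀ hpa]
    have := hfa s (subset_convexHull ℝ T hs)
    linarith
  obtain ⟨w, hw, hle⟩ := exists_extremePoint_le (isCompact_polarBody hp) (x - p) hw₀
  have hxw : (x - p) ⬝ᵥ w < -1 := by
    refine hle.trans_lt ?_
    rw [hval, div_lt_iff₀ hpa]
    linarith
  set A : Set (Fin n → ℝ) := {s | s ∈ T ∧ (s - p) ⬝ᵥ w = -1} with hA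
  have hspan : Submodule.span ℝ {y | ∃ s ∈ A, y = s - p} = ⊤ := by
    rw [← span_active_eq_top hT hw]
    congr 1
    ext y
    simp [hA, and_assoc]
  obtain ⟨hw0, ⟨s₀, hs₀⟩, hdim⟩ := finrank_vectorSpan_active hn (fun s hs ↦ hs.2) hspan
  set B : Set (Fin n → ℤ) := {b | ∃ s ∈ A, ∃ t ∈ A, latticePt b = s - t} with hB
  have hBA : Submodule.span ℝ (latticePt '' B) = vectorSpan ℝ A := by
    rw [vectorSpan]
    congr 1
    ext y
    constructor
    · rintro ⟨b, ⟨s, hs, t, ht, hb⟩, rfl⟩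
      exact ⟨s, hs, t, ht, hb.symm⟩
    · rintro ⟨s, hs, t, ht, rfl⟩
      obtain ⟨s', -, hs'⟩ := hs.1
      obtain ⟨t', -, ht'⟩ := ht.1
      have : latticePt (s' - t') = s - t := by
        rw [← hs', ← ht']
        ext i
        simp [latticePt]
      exact ⟨s' - t', ⟨s, hs, t, ht, this⟩, this⟩
  obtain ⟨u, c, hc, huc, hprim⟩ := exists_primitive_normal hw0 B (by
    rintro b ⟨s, hs, t, ht, hb⟩
    have h1 := hs.2
    have h2 := ht.2
    rw [sub_dotProduct] at h1 h2
    rw [hb, sub_dotProduct]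
    linarith) (by rw [hBA, hdim])
  have hpair (y) : pairing y u = c * ((y - p) ⬝ᵥ w) + c * (p ⬝ᵥ w) := by
    have : pairing y u = y ⬝ᵥ latticePt u := rfl
    rw [this, huc, dotProduct_smul, sub_dotProduct, smul_eq_mul]
    ring
  have hfacet : IsFacetNormal Δ.carrier u (c - c * (p ⬝ᵥ w)) := by
    refine ⟨hprim, fun m hm ↦ ?_, ⟨s₀, hS ▸ subset_convexHull ℝ T hs₀.1, ?_⟩, ?_⟩
    · have := polarBody_convexHull hw.1 m (hS ▸ hm)
      rw [hpair]
      nlinarith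
    · rw [hpair, hs₀.2]
      ring
    · refine le_antisymm (finrank_ker_dotProduct hw0 fun y hy ↦ ?_) ?_
      · induction hy using Submodule.span_induction with
        | mem x hx =>
          obtain ⟨a, ha, b, hb, rfl⟩ := hx
          have h1 := ha.2
          have h2 := hb.2
          rw [hpair, sub_dotProduct] at h1 h2
          change (a - b) ⬝ᵥ w = 0
          rw [sub_dotProduct]
          have : c * (a ⬝ᵥ w - b ⬝ᵥ w) = 0 := by linarith
          exact (mul_eq_zero.1 this).resolve_left hc.ne'
        | zero => simp
        | add x y _ _ hx hy => rw [add_dotProduct, hx, hy, add_zero]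
        | smul c x _ hx => rw [smul_dotProduct, hx, smul_zero]
      · refine hdim.ge.trans (Nat.add_le_add_right
          (Submodule.finrank_mono (vectorSpan_mono ℝ ?_)) 1)
        intro s hs
        refine ⟨hS ▸ subset_convexHull ℝ T hs.1, ?_⟩
        rw [hpair, hs.2]
        ring
  -- Reflexivity fixes the offset of the facet: `c - c * (p ⬝ᵥ w) = 1`, which turns `(x - p) ⬝ᵥ w <
  -- -1` into the required inequality.
  have h1 := Δ.reflexive _ _ hfacet
  refine ⟨⟨u, h1 ▸ hfacet⟩, ?_⟩
  change pairing x u < -1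
  rw [hpair]
  nlinarith

lemma mem_carrier_iff (x : Fin n → ℝ) : x ∈ Δ.carrier ↔ ∀ F : Δ.Facet, -1 ≤ pairing x F.1 := by
  refine ⟨fun hx F ↦ F.2.inward x hx, fun h ↦ ?_⟩
  by_contra hx
  obtain ⟨F, hF⟩ := Δ.exists_facet_of_notMem hx
  exact absurd (h F) (not_le.2 hF)

lemma zero_mem_carrier : (0 : Fin n → ℝ) ∈ Δ.carrier :=
  (Δ.mem_carrier_iff 0).2 fun F ↦ by simp [pairing]

lemma isBounded_carrier : Bornology.IsBounded Δ.carrier := by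
  obtain ⟨S, hS⟩ := Δ.lattice
  rw [hS, isBounded_convexHull]
  exact (S.finite_toSet.image _).isBounded

lemma pairing_smul (a : ℝ) (x : Fin n → ℝ) (u : Fin n → ℤ) :
    pairing (a • x) u = a * pairing x u := by
  simp [pairing, Finset.mul_sum, mul_assoc]

/-- The case `a = 0` is the substantial one: a vector nonnegative on all facet conormals has all its
nonnegative multiples in `Δ`, so boundedness forces it to vanish. -/
lemma mem_smul_carrier_iff {a : ℝ} (ha : 0 ≤ a) (x : Fin n → ℝ) :
    x ∈ a • Δ.carrier ↔ ∀ F : Δ.Facet, -a ≤ pairing x F.1 := by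
  rcases ha.eq_or_lt with rfl | ha
  · rw [Set.zero_smul_set Δ.nonempty]
    constructor
    · rintro rfl F
      simp [pairing]
    · intro h
      by_contra hx
      have hmem (r : ℝ) (hr : 0 ≤ r) : r • x ∈ Δ.carrier := by
        rw [mem_carrier_iff]
        intro F
        rw [pairing_smul]
        have := h F
        nlinarith [mul_nonneg hr (by linarith : 0 ≤ pairing x F.1)]
      obtain ⟨R, hR⟩ := Δ.isBounded_carrier.exists_norm_le
      have hx' : 0 < ‖x‖ := norm_pos_iff.2 hx
      have hR0 : 0 ≤ R := (norm_nonneg _).trans (hR 0 Δ.zero_mem_carrier)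
      have := hR _ (hmem ((R + 1) / ‖x‖) (by positivity))
      rw [norm_smul, Real.norm_of_nonneg (by positivity), div_mul_cancel₀ _ hx'.ne'] at this
      linarith
  · rw [Set.mem_smul_set_iff_inv_smul_mem₀ ha.ne', mem_carrier_iff]
    refine forall_congr' fun F ↦ ?_
    rw [pairing_smul, ← div_eq_inv_mul, le_div_iff₀ ha, neg_one_mul]

lemma mem_cone_iff (p : (Fin n → ℤ) × ℕ) :
    p ∈ Δ.cone ↔ ∀ F : Δ.Facet, -(p.2 : ℤ) ≤ ∑ i, p.1 i * F.1 i := by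
  change latticePt p.1 ∈ (p.2 : ℝ) • Δ.carrier ↔ _
  rw [mem_smul_carrier_iff _ (Nat.cast_nonneg _)]
  refine forall_congr' fun F ↦ ?_
  unfold pairing latticePt
  exact_mod_cast Iff.rfl

/-- Multiplication by `t` is onto the monomials that vanish on all facet divisors. -/
lemma mem_cone_of_forall_ne {m : Fin n → ℤ} {k : ℕ} (h : (m, k + 1) ∈ Δ.cone)
    (hF : ∀ F : Δ.Facet, pairing (latticePt m) F.1 ≠ -((k + 1 : ℕ) : ℝ)) : (m, k) ∈ Δ.cone := by
  rw [mem_cone_iff] at h ⊢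
  intro F
  have h1 := h F
  have h2 : ∑ i, m i * F.1 i ≠ -((k + 1 : ℕ) : ℤ) := fun h0 ↦ hF F (by
    unfold pairing latticePt
    exact_mod_cast h0)
  simp only [Nat.cast_add, Nat.cast_one] at h1 h2 ⊢
  omega

lemma zero_one_mem_cone : ((0 : Fin n → ℤ), 1) ∈ Δ.cone := by
  rw [mem_cone_iff]
  intro F
  simp

/-- The lattice points whose convex hull is `Δ`. -/
def vertices : Finset (Fin n → ℤ) := Δ.lattice.choose

lemma carrier_eq : Δ.carrier = convexHull ℝ (latticePt '' (Δ.vertices : Set (Fin n → ℤ))) :=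
  Δ.lattice.choose_spec

lemma mem_cone_of_mem_vertices {v : Fin n → ℤ} (hv : v ∈ Δ.vertices) : (v, 1) ∈ Δ.cone := by
  change latticePt v ∈ ((1 : ℕ) : ℝ) • Δ.carrier
  rw [Nat.cast_one, one_smul, carrier_eq]
  exact subset_convexHull ℝ _ ⟨v, hv, rfl⟩

/-- Some vertex `v` occurs in `p` with positive coefficient. Once a multiple makes that coefficient
at least `1`, a copy of `(v, 1)` can be removed. Consequently the elements `χ^v t` have no common
zero on `Proj`. -/
lemma exists_nsmul_eq_add {p : (Fin n → ℤ) × ℕ} (hp : p ∈ Δ.cone) (hp2 : 0 < p.2) :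
    ∃ v ∈ Δ.vertices, ∃ N : ℕ, ∃ q ∈ Δ.cone, N • p = (v, 1) + q := by
  have hne := Δ.nonempty
  have hp' : latticePt p.1 ∈ (p.2 : ℝ) • Δ.carrier := hp
  rw [carrier_eq] at hp' hne
  rw [mem_smul_convexHull_image _ _ hne (Nat.cast_nonneg _)] at hp'
  obtain ⟨c, hc0, hc1, hc⟩ := hp'
  obtain ⟨v, hv, hcv⟩ : ∃ v ∈ Δ.vertices, 0 < c v := by
    by_contra! h
    have := Finset.sum_nonpos h
    rw [hc1] at this
    have : (0 : ℝ) < p.2 := by exact_mod_cast hp2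
    linarith
  obtain ⟨N, hN⟩ := exists_nat_ge (1 / c v)
  rw [div_le_iff₀ hcv] at hN
  have hN0 : 0 < N := by
    rcases Nat.eq_zero_or_pos N with rfl | h
    · norm_num at hN
    · exact h
  have hNp : 1 ≤ N * p.2 := Nat.mul_pos hN0 hp2
  refine ⟨v, hv, N, (N • p.1 - v, N * p.2 - 1), ?_, ?_⟩
  · change latticePt (N • p.1 - v) ∈ ((N * p.2 - 1 : ℕ) : ℝ) • Δ.carrier
    rw [carrier_eq, mem_smul_convexHull_image _ _ hne (Nat.cast_nonneg _)]
    classical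
    refine ⟨fun i ↦ N * c i - if i = v then 1 else 0, fun i hi ↦ ?_, ?_, ?_⟩
    · dsimp only
      split_ifs with h
      · subst h; linarith
      · rw [sub_zero]
        exact mul_nonneg (Nat.cast_nonneg _) (hc0 i hi)
    · rw [Finset.sum_sub_distrib, ← Finset.mul_sum, hc1, Finset.sum_ite_eq' _ v, if_pos hv,
        Nat.cast_sub hNp]
      push_cast
      ring
    · have : latticePt (N • p.1 - v) = (N : ℝ) • latticePt p.1 - latticePt v := by
        ext i
        simp [latticePt]
      rw [this, hc]
      simp only [sub_smul, Finset.sum_sub_distrib, Finset.smul_sum, smul_smul, ite_smul, one_smul,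
        zero_smul, Finset.sum_ite_eq', if_pos hv]
  · ext i
    · simp
    · simp only [Prod.smul_snd, smul_eq_mul, Prod.snd_add]
      omega

end ReflexivePolytope


/-! ### Ideal sheaves as modules -/

section IdealModule

variable {X : Scheme.{0}} (I : X.IdealSheafData)

/-- The surjection of the structure sheaf onto the structure sheaf of a closed subscheme. -/
def quotientMap : structureModule X ⟶
    (Scheme.Modules.pushforward I.subschemeι).obj (structureModule I.subscheme) :=
  SheafOfModules.unitToPushforwardObjUnit I.subschemeι.toRingCatSheafHom

/-- The inclusion of an ideal sheaf into the structure sheaf. -/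
def idealInclusion : idealModule I ⟶ structureModule X := kernel.ι (quotientMap I)

instance : Mono (idealInclusion I) := inferInstanceAs (Mono (kernel.ι (quotientMap I)))

/-- The function given by a section of an ideal sheaf. -/
def idealFun {U : X.Opens} (z : Γ(idealModule I, U)) : Γ(X, U) := (idealInclusion I).app U z

lemma idealFun_injective (U : X.Opens) : Function.Injective (idealFun I (U := U)) :=
  injective_app_of_mono (idealInclusion I) U

lemma idealFun_smul {U : X.Opens} (r : Γ(X, U)) (z : Γ(idealModule I, U)) :
    idealFun I (r • z) = r * idealFun I z :=
  Scheme.Modules.Hom.app_smul (φ := idealInclusion I) (U := U) r z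

lemma resO_idealFun {U V : X.Opens} (h : V ≤ U) (z : Γ(idealModule I, U)) :
    resO h (idealFun I z) = idealFun I (resM _ h z) :=
  (app_resM (idealInclusion I) h z).symm

lemma idealFun_mem (U : X.affineOpens) (z : Γ(idealModule I, U.1)) :
    idealFun I z ∈ I.ideal U := by
  rw [← I.ker_subschemeι_app U]
  exact congrArg (fun f ↦ Scheme.Modules.Hom.app f U.1 z) (kernel.condition (quotientMap I))

lemma exists_idealFun_eq (U : X.affineOpens) {a : Γ(X, U.1)} (ha : a ∈ I.ideal U) :
    ∃ z : Γ(idealModule I, U.1), idealFun I z = a := by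
  rw [← I.ker_subschemeι_app U] at ha
  exact exists_app_eq_of_isKernel (kernel.condition (quotientMap I)) (kernelIsKernel _)
    (U := U.1) (a := a) ha

/-- A generator of an ideal sheaf on an affine open that is a nonzerodivisor is a frame. -/
lemma isFrame_idealModule (U : X.affineOpens) (z : Γ(idealModule I, U.1))
    (hz : idealFun I z ∈ nonZeroDivisors Γ(X, U.1)) (hI : I.ideal U = Ideal.span {idealFun I z}) :
    IsFrame (idealModule I) z := by
  refine isFrame_of_basis {V | ∃ g : Γ(X, U.1), V = X.basicOpen g} (fun W hW x hx ↦ ?_) ?_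
  · obtain ⟨g, hg, hxg⟩ := U.2.exists_basicOpen_le ⟨x, hx⟩ (hW hx)
    exact ⟨_, ⟨g, rfl⟩, hxg, hg⟩
  · rintro _ ⟨g, rfl⟩ h
    have hloc : IsLocalization.Away g Γ(X, X.basicOpen g) := U.2.isLocalization_basicOpen g
    have hres (a : Γ(X, U.1)) : algebraMap Γ(X, U.1) Γ(X, X.basicOpen g) a = resO h a := rfl
    have hreg : idealFun I (resM _ h z) ∈ nonZeroDivisors Γ(X, X.basicOpen g) := by
      rw [← resO_idealFun, ← hres]
      exact IsLocalization.map_nonZeroDivisors_le (.powers g) _ ⟨_, hz, rfl⟩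
    have hspan : I.ideal (X.affineBasicOpen g) = Ideal.span {idealFun I (resM _ h z)} := by
      rw [← I.map_ideal_basicOpen U g, hI, Ideal.map_span, Set.image_singleton, ← resO_idealFun]
      rfl
    constructor
    · intro r s hrs
      have := congrArg (idealFun I) hrs
      simp only [idealFun_smul] at this
      exact mul_cancel_right_mem_nonZeroDivisors hreg |>.1 this
    · intro y
      obtain ⟨r, hr⟩ := Ideal.mem_span_singleton'.1
        (hspan ▸ idealFun_mem I (X.affineBasicOpen g) y)
      exact ⟨r, idealFun_injective I _ ((idealFun_smul I _ _).trans hr)⟩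

lemma mem_vanishingIdeal_iff (Z : Closeds X) (U : X.affineOpens) (a : Γ(X, U.1)) :
    a ∈ (Scheme.IdealSheafData.vanishingIdeal Z).ideal U ↔
      ∀ x ∈ Z, x ∈ U.1 → x ∉ X.basicOpen a := by
  rw [Scheme.IdealSheafData.vanishingIdeal_ideal, PrimeSpectrum.mem_vanishingIdeal]
  have key (p : Spec Γ(X, U.1)) : U.2.fromSpec p ∈ X.basicOpen a ↔ a ∉ p.asIdeal := by
    refine Iff.trans ?_ (PrimeSpectrum.mem_basicOpen a p)
    exact iff_of_eq (congrArg (p ∈ ·) (IsAffineOpen.fromSpec_preimage_basicOpen U.2 a))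
  constructor
  · intro h x hxZ hxU
    obtain ⟨p, rfl⟩ : x ∈ Set.range U.2.fromSpec := by rwa [U.2.range_fromSpec]
    rw [key, not_not]
    exact h p hxZ
  · intro h p hp
    have hpU : U.2.fromSpec p ∈ U.1 := by
      rw [← SetLike.mem_coe, ← U.2.range_fromSpec]
      exact ⟨p, rfl⟩
    exact not_not.1 fun hap ↦ h _ hp hpU ((key p).2 hap)

end IdealModule

/-! ### Degree-zero fractions on `Proj` -/

section Proj

open HomogeneousLocalization

variable {A : Type} [CommRing A] {σ : Type*} [SetLike σ A] [AddSubgroupClass σ A]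
  {𝒜 : ℕ → σ} [GradedRing 𝒜]

/-- The function `a / f ^ k` on `D₊(f)`, where `f` has degree `1` and `a` has degree `k`. -/
def fracSec {f : A} (hf : f ∈ 𝒜 1) {k : ℕ} {a : A} (ha : a ∈ 𝒜 k) :
    Γ(Proj 𝒜, Proj.basicOpen 𝒜 f) :=
  Proj.awayToSection 𝒜 f (Away.mk 𝒜 hf k a (by simpa using ha))

variable {f : A} (hf : f ∈ 𝒜 1)

lemma fracSec_surjective (s : Γ(Proj 𝒜, Proj.basicOpen 𝒜 f)) :
    ∃ (k : ℕ) (a : A) (ha : a ∈ 𝒜 k), fracSec hf ha = s := by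
  obtain ⟨k, a, ha, h⟩ := Away.mk_surjective 𝒜 hf ((Proj.basicOpenIsoAway 𝒜 f hf one_pos).inv s)
  refine ⟨k, a, by simpa using ha, ?_⟩
  rw [fracSec, h, ← Proj.basicOpenIsoAway_hom 𝒜 f hf one_pos]
  exact ConcreteCategory.congr_hom (Proj.basicOpenIsoAway 𝒜 f hf one_pos).inv_hom_id s

lemma fracSec_eq_iff_of_isDomain [IsDomain A] (hf0 : f ≠ 0) {k l : ℕ} {a b : A} (ha : a ∈ 𝒜 k)
    (hb : b ∈ 𝒜 l) : fracSec hf ha = fracSec hf hb ↔ f ^ l * a = f ^ k * b := by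
  have hinj : Function.Injective (Proj.awayToSection 𝒜 f) := by
    rw [← Proj.basicOpenIsoAway_hom 𝒜 f hf one_pos]
    exact (ConcreteCategory.bijective_of_isIso _).1
  rw [fracSec, fracSec, hinj.eq_iff, ext_iff_val, Away.val_mk, Away.val_mk,
    Localization.mk_eq_mk_iff, Localization.r_iff_exists]
  constructor
  · rintro ⟨⟨_, m, rfl⟩, h⟩
    exact mul_left_cancel₀ (pow_ne_zero m hf0) h
  · intro h
    exact ⟨1, by simpa using h⟩

lemma fracSec_mul {k l : ℕ} {a b : A} (ha : a ∈ 𝒜 k) (hb : b ∈ 𝒜 l) :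
    fracSec hf ha * fracSec hf hb = fracSec hf (SetLike.mul_mem_graded ha hb) := by
  rw [fracSec, fracSec, ← map_mul, fracSec]
  congr 1
  rw [ext_iff_val, val_mul, Away.val_mk, Away.val_mk, Away.val_mk, Localization.mk_mul]
  congr 1
  exact Subtype.ext (pow_add f k l).symm

lemma fracSec_self : fracSec hf hf = 1 := by
  rw [fracSec, ← map_one (Proj.awayToSection 𝒜 f).hom]
  congr 1
  rw [ext_iff_val, val_one, Away.val_mk, ← Localization.mk_one]
  exact Localization.mk_eq_mk_iff.2 (Localization.r_iff_exists.2 ⟨1, by simp⟩)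

lemma fracSec_zero {k : ℕ} : fracSec hf (zero_mem (𝒜 k)) = 0 := by
  rw [fracSec, ← map_zero (Proj.awayToSection 𝒜 f).hom]
  congr 1
  rw [ext_iff_val, val_zero, Away.val_mk, Localization.mk_zero]

/-- The germ of `a / f^k` at a point of `D₊(f)` is a unit exactly when its numerator avoids the
prime, as one sees in the localization at that prime. -/
lemma mem_basicOpen_fracSec {k : ℕ} {a : A} (ha : a ∈ 𝒜 k) (x : Proj 𝒜) :
    x ∈ (Proj 𝒜).basicOpen (fracSec hf ha) ↔
      f ∉ x.asHomogeneousIdeal ∧ a ∉ x.asHomogeneousIdeal := by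
  by_cases hx : x ∈ Proj.basicOpen 𝒜 f
  · rw [Scheme.mem_basicOpen _ _ _ hx]
    have h1 : (Proj 𝒜).presheaf.germ _ x hx (fracSec hf ha) =
        (Proj.stalkIso' 𝒜 x).symm (mapId 𝒜 (Submonoid.powers_le.mpr hx)
          (Away.mk 𝒜 hf k a (by simpa using ha))) :=
      ConcreteCategory.congr_hom (ProjectiveSpectrum.Proj.awayToSection_germ 𝒜 f x hx) _
    rw [h1]
    have hp : x.asHomogeneousIdeal.toIdeal.IsPrime := x.isPrime
    refine (isUnit_map_iff (Proj.stalkIso' 𝒜 x).symm _).trans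
      ((isUnit_iff_isUnit_val _ _ _).symm.trans ?_)
    refine Iff.trans (b := a ∈ x.asHomogeneousIdeal.toIdeal.primeCompl) ?_
      ⟨fun h ↦ ⟨hx, h⟩, fun h ↦ h.2⟩
    refine (iff_of_eq (congrArg IsUnit (Localization.mk_eq_mk'_apply a _))).trans ?_
    exact IsLocalization.AtPrime.isUnit_mk'_iff
      (Localization.AtPrime x.asHomogeneousIdeal.toIdeal) x.asHomogeneousIdeal.toIdeal a
      ⟨f ^ k, fun h ↦ hx (hp.mem_of_pow_mem k h)⟩
  · exact ⟨fun h ↦ absurd ((Proj 𝒜).basicOpen_le _ h) hx, fun h ↦ absurd h.1 hx⟩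

lemma resO_fracSec {g : A} (hg : g ∈ 𝒜 1) {a : A} (ha : a ∈ 𝒜 1) :
    resO (inf_le_right : Proj.basicOpen 𝒜 g ⊓ Proj.basicOpen 𝒜 f ≤ _) (fracSec hf ha) =
      resO inf_le_left (fracSec hg ha) * resO inf_le_right (fracSec hf hg) := by
  refine Subtype.ext (funext fun x ↦ val_injective _ ?_)
  have hxf : f ∉ x.1.asHomogeneousIdeal.toIdeal := x.2.2
  have hxg : g ∉ x.1.asHomogeneousIdeal.toIdeal := x.2.1
  have hprime : x.1.asHomogeneousIdeal.toIdeal.IsPrime := x.1.isPrime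
  have hp (h : A) (hh : h ∉ x.1.asHomogeneousIdeal.toIdeal) :
      h ^ 1 ∈ x.1.asHomogeneousIdeal.toIdeal.primeCompl := by simpa using hh
  refine Eq.trans (b := Localization.mk a ⟨f ^ 1, hp f hxf⟩) rfl ?_
  refine Eq.trans ?_ (HomogeneousLocalization.val_mul _ _).symm
  refine Eq.trans ?_ (b := Localization.mk a ⟨g ^ 1, hp g hxg⟩ *
    Localization.mk g ⟨f ^ 1, hp f hxf⟩) rfl
  rw [Localization.mk_mul, Localization.mk_eq_mk_iff, Localization.r_iff_exists]
  refine ⟨1, ?_⟩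
  simp
  ring

end Proj


/-! ### The canonical sheaf of the toric variety -/

namespace ReflexivePolytope

variable {n : ℕ} (Δ : ReflexivePolytope n)

/-- This makes the coordinate ring a domain. -/
instance : UniqueSums Δ.cone :=
  UniqueSums.of_injective_addHom (G := (Fin n → ℤ) × ℕ) (Δ.cone.subtype : Δ.cone →ₙ+ _)
    Subtype.val_injective inferInstance

/-- The monomial `χ^m t^k`. -/
def monomial (p : Δ.cone) : Δ.coordRing := AddMonoidAlgebra.single p 1

lemma monomial_mul (p q : Δ.cone) : Δ.monomial p * Δ.monomial q = Δ.monomial (p + q) := by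
  simp [monomial, AddMonoidAlgebra.single_mul_single]

lemma monomial_pow (p : Δ.cone) (N : ℕ) : Δ.monomial p ^ N = Δ.monomial (N • p) := by
  simp [monomial, AddMonoidAlgebra.single_pow]

lemma monomial_ne_zero (p : Δ.cone) : Δ.monomial p ≠ 0 := by
  simp [monomial]

lemma monomial_mem (p : Δ.cone) : Δ.monomial p ∈ Δ.grading p.1.2 :=
  AddMonoidAlgebra.single_mem_gradeBy Δ.degree p 1

lemma single_eq_smul (p : Δ.cone) (c : ℂ) :
    (AddMonoidAlgebra.single p c : Δ.coordRing) = c • Δ.monomial p := by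
  simp [monomial]

lemma eq_sum_monomial (a : Δ.coordRing) :
    a = ∑ p ∈ a.coeff.support, a.coeff p • Δ.monomial p := by
  simp only [← single_eq_smul]
  exact (AddMonoidAlgebra.sum_coeff_single a).symm

/-- `p` lies on the cone over the facet `F`. -/
def OnFacet (F : Δ.Facet) (p : Δ.cone) : Prop := pairing (latticePt p.1.1) F.1 = -(p.1.2 : ℝ)

lemma neg_le_pairing (F : Δ.Facet) (p : Δ.cone) : -(p.1.2 : ℝ) ≤ pairing (latticePt p.1.1) F.1 :=
  (Δ.mem_smul_carrier_iff (Nat.cast_nonneg _) _).1 p.2 F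

/-- Both points satisfy the facet inequality, so equality for the sum forces equality for each. This
makes the projection onto the facet monomials multiplicative. -/
lemma onFacet_add (F : Δ.Facet) (p q : Δ.cone) :
    Δ.OnFacet F (p + q) ↔ Δ.OnFacet F p ∧ Δ.OnFacet F q := by
  have hp := Δ.neg_le_pairing F p
  have hq := Δ.neg_le_pairing F q
  have h : pairing (latticePt (p + q).1.1) F.1 =
      pairing (latticePt p.1.1) F.1 + pairing (latticePt q.1.1) F.1 := by
    simp [pairing, latticePt, add_mul, Finset.sum_add_distrib]
  have h' : (((p + q).1.2 : ℕ) : ℝ) = p.1.2 + q.1.2 := by simp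
  unfold OnFacet
  rw [h, h']
  constructor
  · intro h
    constructor <;> linarith
  · rintro ⟨h1, h2⟩
    linarith

lemma onFacet_zero (F : Δ.Facet) : Δ.OnFacet F 0 := by
  simp [OnFacet, pairing, latticePt]

open Classical in
/-- The projection of the coordinate ring onto the span of the monomials on a facet. -/
def facetProj (F : Δ.Facet) : Δ.coordRing →ₐ[ℂ] Δ.coordRing :=
  AddMonoidAlgebra.lift ℂ Δ.coordRing Δ.cone
    { toFun := fun p ↦ if Δ.OnFacet F p.toAdd then Δ.monomial p.toAdd else 0
      map_one' := if_pos (Δ.onFacet_zero F)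
      map_mul' := fun p q ↦ by
        rw [toAdd_mul, onFacet_add, ← monomial_mul]
        by_cases h1 : Δ.OnFacet F p.toAdd <;> by_cases h2 : Δ.OnFacet F q.toAdd <;> simp [h1, h2] }

open Classical in
lemma facetProj_monomial (F : Δ.Facet) (p : Δ.cone) :
    Δ.facetProj F (Δ.monomial p) = if Δ.OnFacet F p then Δ.monomial p else 0 := by
  simp [facetProj, monomial]

open Classical in
lemma coeff_facetProj (F : Δ.Facet) (a : Δ.coordRing) (p : Δ.cone) :
    (Δ.facetProj F a).coeff p = if Δ.OnFacet F p then a.coeff p else 0 := by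
  induction a using AddMonoidAlgebra.induction_linear with
  | zero => simp
  | add a b ha hb =>
    rw [map_add, AddMonoidAlgebra.coeff_add, Finsupp.add_apply, ha, hb]
    split_ifs <;> simp
  | single q c =>
    rw [single_eq_smul, map_smul, facetProj_monomial]
    by_cases h : p = q
    · subst h
      split_ifs <;> simp
    · by_cases h1 : Δ.OnFacet F q <;> simp [h1, monomial, Ne.symm h]

/-- The ideal of a facet divisor. -/
def facetIdeal (F : Δ.Facet) : Ideal Δ.coordRing :=
  Ideal.span {f | ∃ p : Δ.cone, ¬ Δ.OnFacet F p ∧ f = Δ.monomial p}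

/-- As the kernel of a ring map into a domain the ideal is prime, so it supplies a generic point of
`D_F`; it also lets membership be read off coefficients. -/
lemma facetIdeal_eq_ker (F : Δ.Facet) :
    Δ.facetIdeal F = RingHom.ker (Δ.facetProj F : Δ.coordRing →+* Δ.coordRing) := by
  refine le_antisymm (Ideal.span_le.2 ?_) fun a ha ↦ ?_
  · rintro _ ⟨p, hp, rfl⟩
    change Δ.facetProj F (Δ.monomial p) = 0
    rw [facetProj_monomial, if_neg hp]
  · have ha' : ∀ p, Δ.OnFacet F p → a.coeff p = 0 := fun p hp ↦ by
      have := congrArg (fun b : Δ.coordRing ↦ b.coeff p) (show Δ.facetProj F a = 0 from ha)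
      simpa [coeff_facetProj, hp] using this
    rw [Δ.eq_sum_monomial a]
    refine Ideal.sum_mem _ fun p hp ↦ ?_
    rw [Algebra.smul_def]
    exact Ideal.mul_mem_left _ _ (Ideal.subset_span ⟨p, fun h ↦
      Finsupp.mem_support_iff.1 hp (ha' p h), rfl⟩)

instance (F : Δ.Facet) : (Δ.facetIdeal F).IsPrime := by
  rw [facetIdeal_eq_ker]
  exact RingHom.ker_isPrime _

lemma coeff_eq_zero_of_mem_facetIdeal {F : Δ.Facet} {a : Δ.coordRing} (ha : a ∈ Δ.facetIdeal F)
    {p : Δ.cone} (hp : Δ.OnFacet F p) : a.coeff p = 0 := by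
  rw [facetIdeal_eq_ker] at ha
  have := congrArg (fun b : Δ.coordRing ↦ b.coeff p) (show Δ.facetProj F a = 0 from ha)
  simpa [coeff_facetProj, hp] using this

lemma isHomogeneous_facetIdeal (F : Δ.Facet) : (Δ.facetIdeal F).IsHomogeneous Δ.grading := by
  refine Ideal.homogeneous_span _ _ ?_
  rintro _ ⟨p, -, rfl⟩
  exact ⟨_, Δ.monomial_mem p⟩

/-- The generic point of a facet divisor. -/
def facetPoint (F : Δ.Facet) {p : Δ.cone} (hp : 0 < p.1.2) (hpF : Δ.monomial p ∉ Δ.facetIdeal F) :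
    Proj Δ.grading :=
  { asHomogeneousIdeal := ⟨Δ.facetIdeal F, Δ.isHomogeneous_facetIdeal F⟩
    isPrime := inferInstanceAs (Δ.facetIdeal F).IsPrime
    not_irrelevant_le := fun h ↦ hpF (h (HomogeneousIdeal.mem_irrelevant_of_mem _ hp
      (Δ.monomial_mem p))) }

/-- The degree one element `t`. -/
def tPt : Δ.cone := ⟨(0, 1), Δ.zero_one_mem_cone⟩

/-- No monomial of `b` lies on a facet, so each exponent `(m, k + 1)` is the sum of `(0, 1)` and a
point `(m, k)` of the cone. -/
lemma exists_eq_t_mul {k : ℕ} {b : Δ.coordRing} (hb : b ∈ Δ.grading (k + 1))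
    (hF : ∀ F, b ∈ Δ.facetIdeal F) : ∃ c ∈ Δ.grading k, b = Δ.monomial Δ.tPt * c := by
  have key (p : Δ.cone) (hp : p ∈ b.coeff.support) : ∃ q : Δ.cone, q.1.2 = k ∧ p = Δ.tPt + q := by
    obtain ⟨⟨m, l⟩, hml⟩ := p
    obtain rfl : l = k + 1 := hb _ hp
    refine ⟨⟨(m, k), Δ.mem_cone_of_forall_ne hml fun F h ↦ ?_⟩, rfl, ?_⟩
    · exact Finsupp.mem_support_iff.1 hp (Δ.coeff_eq_zero_of_mem_facetIdeal (hF F) h)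
    · refine Subtype.ext (Prod.ext ?_ ?_)
      · simp [tPt]
      · simp [tPt, add_comm]
  choose! q hq hpq using key
  refine ⟨∑ p ∈ b.coeff.support, b.coeff p • Δ.monomial (q p), sum_mem fun p hp ↦
    Submodule.smul_mem _ _ (hq p hp ▸ Δ.monomial_mem (q p)), ?_⟩
  conv_lhs => rw [Δ.eq_sum_monomial b]
  rw [Finset.mul_sum]
  refine Finset.sum_congr rfl fun p hp ↦ ?_
  rw [mul_smul_comm, monomial_mul, ← hpq p hp]

/-- The point of the cone given by a vertex. -/
def vertexPt (v : Δ.vertices) : Δ.cone := ⟨(v, 1), Δ.mem_cone_of_mem_vertices v.2⟩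

lemma iSup_basicOpen_vertexPt :
    ⨆ v, Proj.basicOpen Δ.grading (Δ.monomial (Δ.vertexPt v)) = ⊤ := by
  refine top_le_iff.mp fun x _ ↦ Opens.mem_iSup.mpr ?_
  by_contra! H
  have hx : x.asHomogeneousIdeal.toIdeal.IsPrime := x.isPrime
  replace H (v) : Δ.monomial (Δ.vertexPt v) ∈ x.asHomogeneousIdeal.toIdeal := not_not.1 (H v)
  have hmon (p : Δ.cone) (hp : 0 < p.1.2) : Δ.monomial p ∈ x.asHomogeneousIdeal.toIdeal := by
    obtain ⟨v, hv, N, q, hq, h⟩ := Δ.exists_nsmul_eq_add p.2 hp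
    refine hx.mem_of_pow_mem N ?_
    have : N • p = Δ.vertexPt ⟨v, hv⟩ + ⟨q, hq⟩ := Subtype.ext h
    rw [monomial_pow, this, ← monomial_mul]
    exact Ideal.mul_mem_right _ _ (H _)
  refine x.not_irrelevant_le fun z hz ↦ ?_
  rw [← DirectSum.sum_support_decompose Δ.grading z]
  refine Ideal.sum_mem _ fun i _ ↦ ?_
  rcases Nat.eq_zero_or_pos i with rfl | hi
  · have : (DirectSum.decompose Δ.grading z 0 : Δ.coordRing) = 0 :=
      (HomogeneousIdeal.mem_irrelevant_iff _ _).1 hz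
    rw [this]
    exact zero_mem _
  · generalize hb : (DirectSum.decompose Δ.grading z i) = b
    rw [Δ.eq_sum_monomial b.1]
    refine Ideal.sum_mem _ fun p hp ↦ ?_
    rw [Algebra.smul_def]
    refine Ideal.mul_mem_left _ _ (hmon p ?_)
    have : p.1.2 = i := b.2 p hp
    omega

/-- The charts `D₊(χ^v t)` of the toric variety, for the vertices `v`. -/
def charts : Charts Δ.toricVariety Δ.vertices where
  U v := Proj.basicOpen Δ.grading (Δ.monomial (Δ.vertexPt v))
  cover := Δ.iSup_basicOpen_vertexPt
  g v w := fracSec (Δ.monomial_mem (Δ.vertexPt w)) (Δ.monomial_mem (Δ.vertexPt v))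
  g_self v := fracSec_self _
  cocycle u v w := resO_fracSec (Δ.monomial_mem (Δ.vertexPt w)) (Δ.monomial_mem (Δ.vertexPt v))
    (Δ.monomial_mem (Δ.vertexPt u))
  basicOpen_g v w := by
    ext x
    exact (mem_basicOpen_fracSec (Δ.monomial_mem (Δ.vertexPt w))
      (Δ.monomial_mem (Δ.vertexPt v)) x).trans and_comm

lemma isAffineOpen_charts (v : Δ.vertices) : IsAffineOpen (Δ.charts.U v) :=
  Proj.isAffineOpen_basicOpen Δ.grading _ (Δ.monomial_mem (Δ.vertexPt v)) one_pos

/-- The function `t / x_v`. -/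
def tFrac (v : Δ.vertices) : Γ(Δ.toricVariety, Δ.charts.U v) :=
  fracSec (Δ.monomial_mem (Δ.vertexPt v)) (Δ.monomial_mem Δ.tPt)

/-- The closed subset `⋃_F D_F`. -/
abbrev boundary : Closeds Δ.toricVariety := ⨆ F, Δ.facetDivisor F

lemma mem_facetDivisor {F : Δ.Facet} {x : Proj Δ.grading} :
    x ∈ Δ.facetDivisor F ↔ Δ.facetIdeal F ≤ x.asHomogeneousIdeal.toIdeal := by
  refine Iff.trans ?_ Ideal.span_le.symm
  rfl

lemma isAffineOpen_basicOpen {f : Δ.coordRing} (hf : f ∈ Δ.grading 1) :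
    IsAffineOpen (X := Δ.toricVariety) (Proj.basicOpen Δ.grading f) :=
  Proj.isAffineOpen_basicOpen Δ.grading _ hf one_pos

/-- The exponent `(0, 1)` of `t` is on no facet, because `0 ≠ -1`; so `t` vanishes on every `D_F`.
-/
lemma fracSec_t_mem {f : Δ.coordRing} (hf : f ∈ Δ.grading 1) :
    fracSec hf (Δ.monomial_mem Δ.tPt) ∈
      (Scheme.IdealSheafData.vanishingIdeal Δ.boundary).ideal
        ⟨Proj.basicOpen Δ.grading f, Δ.isAffineOpen_basicOpen hf⟩ := by
  let s : Γ(Δ.toricVariety, Proj.basicOpen Δ.grading f) := fracSec hf (Δ.monomial_mem Δ.tPt)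
  refine (mem_vanishingIdeal_iff (X := Δ.toricVariety) Δ.boundary
    ⟨Proj.basicOpen Δ.grading f, Δ.isAffineOpen_basicOpen hf⟩ s).2 fun x hx _ ↦ ?_
  let Z : Closeds Δ.toricVariety := ⟨((Δ.toricVariety.basicOpen s : Set _))ᶜ,
    (Δ.toricVariety.basicOpen s).isOpen.isClosed_compl⟩
  have hZ : Δ.boundary ≤ Z := iSup_le fun F y hy hyt ↦ by
    have h1 := (mem_basicOpen_fracSec _ _ y).1 hyt
    refine h1.2 (Δ.mem_facetDivisor.1 hy (Ideal.subset_span ⟨_, ?_, rfl⟩))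
    simp [OnFacet, tPt, pairing, latticePt]
  exact hZ hx

lemma tFrac_mem (v : Δ.vertices) : Δ.tFrac v ∈
    (Scheme.IdealSheafData.vanishingIdeal Δ.boundary).ideal
      ⟨Δ.charts.U v, Δ.isAffineOpen_charts v⟩ :=
  Δ.fracSec_t_mem (Δ.monomial_mem (Δ.vertexPt v))

lemma ideal_boundary (v : Δ.vertices) : (Scheme.IdealSheafData.vanishingIdeal Δ.boundary).ideal
    ⟨Δ.charts.U v, Δ.isAffineOpen_charts v⟩ = Ideal.span {Δ.tFrac v} := by
  refine le_antisymm (fun s hs ↦ ?_) ((Ideal.span_singleton_le_iff_mem _).2 (Δ.tFrac_mem v))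
  rw [mem_vanishingIdeal_iff] at hs
  let hx := Δ.monomial_mem (Δ.vertexPt v)
  obtain ⟨k, a, ha, rfl⟩ := fracSec_surjective hx s
  -- The extra factor `x_v` covers the facets whose divisor misses this chart, where `a` itself is
  -- unconstrained, and raises the degree so that `t` can be divided out.
  have hxa : Δ.monomial (Δ.vertexPt v) * a ∈ Δ.grading (k + 1) := by
    rw [add_comm k 1]
    exact SetLike.mul_mem_graded hx ha
  obtain ⟨c, hc, hac⟩ := Δ.exists_eq_t_mul hxa fun F ↦ by
    by_cases hxF : Δ.monomial (Δ.vertexPt v) ∈ Δ.facetIdeal F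
    · exact Ideal.mul_mem_right _ _ hxF
    · refine Ideal.mul_mem_left _ _ ?_
      let y := Δ.facetPoint F (p := Δ.vertexPt v) one_pos hxF
      have hy : y ∈ Δ.boundary := (le_iSup Δ.facetDivisor F) (Δ.mem_facetDivisor.2 le_rfl)
      by_contra haF
      exact hs y hy hxF ((mem_basicOpen_fracSec hx ha y).2 ⟨hxF, haF⟩)
  refine Ideal.mem_span_singleton.2 ⟨fracSec hx hc, ?_⟩
  refine Eq.trans ?_ (fracSec_mul hx (Δ.monomial_mem Δ.tPt) hc).symm
  have hac' : Δ.monomial Δ.tPt * c = Δ.monomial (Δ.vertexPt v) * a := hac.symm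
  refine (fracSec_eq_iff_of_isDomain hx (Δ.monomial_ne_zero _) _ _).2 ?_
  rw [hac', add_comm, pow_add, mul_assoc]
  congr 1
  exact congrArg (· * a) (pow_one _)

lemma tFrac_mem_nonZeroDivisors (v : Δ.vertices) :
    Δ.tFrac v ∈ nonZeroDivisors Γ(Δ.toricVariety, Δ.charts.U v) := by
  rw [mem_nonZeroDivisors_iff_right]
  intro s hs
  let hx := Δ.monomial_mem (Δ.vertexPt v)
  obtain ⟨k, a, ha, rfl⟩ := fracSec_surjective hx s
  have h1 := (fracSec_mul hx ha (Δ.monomial_mem Δ.tPt)).symm.trans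
    (hs.trans (fracSec_zero hx (k := 0)).symm)
  rw [fracSec_eq_iff_of_isDomain hx (Δ.monomial_ne_zero _), mul_zero, pow_zero, one_mul,
    mul_eq_zero] at h1
  obtain rfl := h1.resolve_right (Δ.monomial_ne_zero _)
  exact fracSec_zero hx

/-- The local generators satisfy `t / x_v = (x_v / x_w)⁻¹ (t / x_w)`. -/
lemma hasWeight_canonicalSheaf : Δ.charts.HasWeight Δ.canonicalSheaf (-1) := by
  choose z hz using fun v ↦ exists_idealFun_eq _ _ (Δ.tFrac_mem v)
  refine ⟨z, fun v ↦ isFrame_idealModule _ ⟨Δ.charts.U v, Δ.isAffineOpen_charts v⟩ (z v) ?_ ?_,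
    fun v w ↦ idealFun_injective _ _ ?_⟩
  · rw [hz]
    exact Δ.tFrac_mem_nonZeroDivisors v
  · rw [hz]
    exact Δ.ideal_boundary v
  · refine (resO_idealFun _ _ (z v)).symm.trans (Eq.trans ?_ (idealFun_smul _ _ _).symm)
    refine Eq.trans ?_ (congrArg _ (resO_idealFun _ _ (z w)))
    rw [hz, hz, zpow_neg_one, Units.eq_inv_mul_iff_mul_eq, mul_comm]
    exact (resO_fracSec (Δ.monomial_mem (Δ.vertexPt w)) (Δ.monomial_mem (Δ.vertexPt v))
      (Δ.monomial_mem Δ.tPt)).symm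

lemma hasWeight_polarization : Δ.charts.HasWeight Δ.polarization (n - 1) := by
  have := Δ.hasWeight_canonicalSheaf.tensorPow (-((n : ℤ) - 1))
  rwa [neg_mul_neg, mul_one] at this

end ReflexivePolytope


/-! ### Nontrivial Ext groups from charts -/

lemma Charts.HasWeight.of_subsingleton {X : Scheme.{0}} {ι : Type} [Subsingleton ι]
    {C : Charts X ι} {M : X.Modules} {d : ℤ} (h : C.HasWeight M d) (d' : ℤ) : C.HasWeight M d' := by
  obtain ⟨e, he, he'⟩ := h
  have ht (v w) : C.trans v w = 1 := by
    obtain rfl := Subsingleton.elim v w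
    refine Units.ext ?_
    change resO _ (C.g v v) = 1
    rw [C.g_self, map_one]
  refine ⟨e, he, fun v w ↦ ?_⟩
  have := he' v w
  rw [ht, one_zpow] at this ⊢
  exact this

/-- The chart that consists of the whole scheme. -/
def Charts.whole (X : Scheme.{0}) : Charts X Unit where
  U _ := ⊤
  cover := iSup_const
  g _ _ := 1
  g_self _ := rfl
  cocycle _ _ _ := by simp
  basicOpen_g _ _ := by
    rw [Scheme.basicOpen_of_isUnit _ isUnit_one, inf_idem]

/-- Sufficiently negative powers of a line bundle `L` have nonzero morphisms to a shift of any
nonzero object of the bounded derived category, if `L` is ample or `Y` has a single affine chart. -/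
lemma exists_forall_nontrivial_dbExt {Y : Scheme.{0}} {ι : Type} [Finite ι] (C : Charts Y ι)
    (hC : ∀ w, IsAffineOpen (C.U w)) {L : Y.Modules} {d : ℤ} (hL : C.HasWeight L d)
    (hd : 1 ≤ d ∨ Subsingleton ι) :
    ∃ hL : ∀ i : ℤ, IsCoherent (tensorPow L i), ∀ F : DbCoh Y, ¬ IsZero F →
      ∃ i₀ r : ℤ, ∀ i : ℤ, i ≤ i₀ → Nontrivial (DbExt r (sheafObj (tensorPow L i) (hL i)) F) := by
  refine ⟨fun i ↦ (hL.tensorPow i).isCoherent, fun F hF ↦ ?_⟩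
  obtain ⟨k₀, r, h⟩ := exists_nontrivial_dbExt (M := fun k : ℕ ↦ tensorPow L (-(k : ℤ)))
    (fun k ↦ (hL.tensorPow _).isCoherent) (fun Z H q hZ hq ↦ by
      obtain ⟨k₀, hk₀⟩ := C.exists_comp_ne_zero hC hZ q hq
      refine ⟨k₀, fun k hk ↦ ?_⟩
      rcases hd with hd | hd
      -- The `-k`-th power has weight `-(k * d)`, and `k * d ≥ k ≥ k₀` because `d ≥ 1`.
      · lift d to ℕ using by omega
        refine hk₀ (k * d) (hk.trans (Nat.le_mul_of_pos_right k (by omega))) _ ?_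
        have := hL.tensorPow (-(k : ℤ))
        rwa [neg_mul] at this
      · exact hk₀ k hk _ ((hL.tensorPow _).of_subsingleton _)) F hF
  refine ⟨-k₀, r, fun i hi ↦ ?_⟩
  obtain ⟨k, rfl⟩ : ∃ k : ℕ, i = -(k : ℤ) := ⟨i.natAbs, by omega⟩
  exact h k (by omega)

/-! ### Nonzero equations of a closed subscheme -/

section IdealSheaf

variable {X : Scheme.{0}} (I : X.IdealSheafData)

lemma subschemeι_notMem_basicOpen (U : X.affineOpens) {s : Γ(X, U.1)} (hs : s ∈ I.ideal U)
    (y : I.subscheme) : I.subschemeι y ∉ X.basicOpen s := by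
  intro h
  rw [← I.ker_subschemeι_app U, RingHom.mem_ker] at hs
  have h1 : y ∈ I.subschemeι ⁻¹ᵁ X.basicOpen s := h
  rw [Scheme.Hom.preimage_basicOpen, hs, Scheme.basicOpen_zero] at h1
  exact h1

lemma idealFun_zero (U : X.Opens) : idealFun I (0 : Γ(idealModule I, U)) = 0 :=
  map_zero ((idealInclusion I).app U).hom

/-- The isomorphism need not respect the embeddings into `𝒪_X`, but it and they are injective on
sections, so a nonzero function still yields a nonzero function. -/
lemma exists_ne_zero_mem_ideal_of_iso {J : X.IdealSheafData} (e : idealModule I ≅ idealModule J)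
    (U : X.affineOpens) {a : Γ(X, U.1)} (ha : a ∈ J.ideal U) (ha0 : a ≠ 0) :
    ∃ s ∈ I.ideal U, s ≠ 0 := by
  obtain ⟨z, rfl⟩ := exists_idealFun_eq J U ha
  refine ⟨idealFun I (U := U.1) (e.inv.app U.1 z), idealFun_mem I U _, fun h ↦ ha0 ?_⟩
  have h1 : e.inv.app U.1 z = 0 := idealFun_injective I U.1 (h.trans (idealFun_zero I U.1).symm)
  have h2 : e.hom.app U.1 (e.inv.app U.1 z) = z :=
    congrArg (fun f ↦ Scheme.Modules.Hom.app f U.1 z) e.inv_hom_id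
  rw [h1, map_zero] at h2
  rw [← h2, idealFun_zero]

end IdealSheaf

/-! ### Dimension one: anticanonical subschemes of the conic are affine -/

namespace ReflexivePolytope

section Segment

open scoped Pointwise

variable (Δ : ReflexivePolytope 1)

lemma facet_eq (F : Δ.Facet) : F.1 0 = 1 ∨ F.1 0 = -1 := by
  have := F.2.primitive (F.1 0) (fun i ↦ by rw [Subsingleton.elim i 0])
  exact Int.isUnit_iff.1 this

/-- Without a facet on one side, `Δ` would contain arbitrarily large lattice points in that
direction. -/
lemma exists_facet_eq {ε : ℤ} (hε : ε = 1 ∨ ε = -1) : ∃ F : Δ.Facet, F.1 0 = ε := by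
  by_contra! h
  obtain ⟨R, hR⟩ := Δ.isBounded_carrier.exists_norm_le
  obtain ⟨N, hN⟩ := exists_nat_gt R
  have hmem : ((fun _ ↦ -ε * N : Fin 1 → ℤ), 1) ∈ Δ.cone := by
    rw [mem_cone_iff]
    intro F
    have h1 := Δ.facet_eq F
    have h2 := h F
    have h3 : F.1 0 = -ε := by omega
    rw [Fin.sum_univ_one, h3]
    rcases hε with rfl | rfl <;> simp
  change latticePt _ ∈ ((1 : ℕ) : ℝ) • Δ.carrier at hmem
  rw [Nat.cast_one, one_smul] at hmem
  have h4 := (norm_le_pi_norm _ 0).trans (hR _ hmem)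
  have h5 : ‖latticePt (fun _ ↦ -ε * N : Fin 1 → ℤ) 0‖ = N := by
    rcases hε with rfl | rfl <;> simp [latticePt]
  rw [h5] at h4
  linarith

lemma mem_cone_iff_abs (p : (Fin 1 → ℤ) × ℕ) : p ∈ Δ.cone ↔ |p.1 0| ≤ p.2 := by
  rw [mem_cone_iff, abs_le]
  simp only [Fin.sum_univ_one]
  constructor
  · intro h
    obtain ⟨F, hF⟩ := Δ.exists_facet_eq (Or.inl rfl)
    obtain ⟨G, hG⟩ := Δ.exists_facet_eq (Or.inr rfl)
    have h1 := h F
    have h2 := h G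
    rw [hF] at h1
    rw [hG] at h2
    omega
  · intro h F
    rcases Δ.facet_eq F with h1 | h1 <;> rw [h1] <;> omega

/-- The degree one point `χ^m t`. -/
def endPt (ε : ℤ) (hε : |ε| ≤ 1) : Δ.cone :=
  ⟨(fun _ ↦ ε, 1), (Δ.mem_cone_iff_abs _).2 (by simpa using hε)⟩

/-- The monomial `χ t`. -/
def xPos : Δ.coordRing := Δ.monomial (Δ.endPt 1 (by norm_num))

/-- The monomial `χ⁻¹ t`. -/
def xNeg : Δ.coordRing := Δ.monomial (Δ.endPt (-1) (by norm_num))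

/-- The element `t`. -/
def tEl : Δ.coordRing := Δ.monomial Δ.tPt

lemma xPos_mul_xNeg : Δ.xPos * Δ.xNeg = Δ.tEl ^ 2 := by
  rw [xPos, xNeg, tEl, monomial_pow, monomial_mul]
  congr 1

lemma xPos_mem : Δ.xPos ∈ Δ.grading 1 := Δ.monomial_mem _
lemma xNeg_mem : Δ.xNeg ∈ Δ.grading 1 := Δ.monomial_mem _
lemma tEl_mem : Δ.tEl ∈ Δ.grading 1 := Δ.monomial_mem _

/-- The section with a double zero at `c`. -/
def doublePt (c : ℂ) : Δ.coordRing := Δ.xNeg - (2 * c) • Δ.tEl + c ^ 2 • Δ.xPos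

lemma doublePt_mem (c : ℂ) : Δ.doublePt c ∈ Δ.grading 1 :=
  add_mem (sub_mem Δ.xNeg_mem (Submodule.smul_mem _ _ Δ.tEl_mem))
    (Submodule.smul_mem _ _ Δ.xPos_mem)

lemma xPos_mul_doublePt (c : ℂ) : Δ.xPos * Δ.doublePt c = (Δ.tEl - c • Δ.xPos) ^ 2 := by
  rw [doublePt, mul_add, mul_sub, xPos_mul_xNeg]
  simp only [Algebra.smul_def, map_mul, map_pow, map_ofNat]
  ring

/-- If `χ t` vanished too, the conic equation would force `t`, and then `χ⁻¹ t`, to vanish,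
contradicting the cover. The other claim holds because `χ t` times the section is the square of `t -
c χ t`. -/
lemma mem_of_doublePt_mem {c : ℂ} {x : Proj Δ.grading}
    (hx : Δ.doublePt c ∈ x.asHomogeneousIdeal.toIdeal) :
    Δ.xPos ∉ x.asHomogeneousIdeal.toIdeal ∧
      Δ.tEl - c • Δ.xPos ∈ x.asHomogeneousIdeal.toIdeal := by
  have hp : x.asHomogeneousIdeal.toIdeal.IsPrime := x.isPrime
  have hsmul (c : ℂ) (a : Δ.coordRing) (ha : a ∈ x.asHomogeneousIdeal.toIdeal) :
      c • a ∈ x.asHomogeneousIdeal.toIdeal := by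
    rw [Algebra.smul_def]
    exact Ideal.mul_mem_left _ _ ha
  refine ⟨fun h ↦ ?_, hp.mem_of_pow_mem 2 ?_⟩
  · have ht : Δ.tEl ∈ x.asHomogeneousIdeal.toIdeal := by
      refine hp.mem_of_pow_mem 2 ?_
      rw [← xPos_mul_xNeg]
      exact Ideal.mul_mem_right _ _ h
    have hn : Δ.xNeg ∈ x.asHomogeneousIdeal.toIdeal := by
      have : Δ.xNeg = Δ.doublePt c + (2 * c) • Δ.tEl - c ^ 2 • Δ.xPos := by
        rw [doublePt]; abel
      rw [this]
      exact sub_mem (add_mem hx (hsmul _ _ ht)) (hsmul _ _ h)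
    have hcov : x ∈ (⨆ v, Proj.basicOpen Δ.grading (Δ.monomial (Δ.vertexPt v))) := by
      rw [iSup_basicOpen_vertexPt]; trivial
    obtain ⟨v, hv⟩ := Opens.mem_iSup.1 hcov
    refine hv ?_
    have h1 := (Δ.mem_cone_iff_abs _).1 (Δ.vertexPt v).2
    have hpt (ε : ℤ) (hε : |ε| ≤ 1) (h : (Δ.vertexPt v).1.1 0 = ε) :
        Δ.vertexPt v = Δ.endPt ε hε := by
      refine Subtype.ext (Prod.ext (funext fun i ↦ ?_) rfl)
      rw [Subsingleton.elim i 0]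
      exact h
    have h0 : Δ.tPt = Δ.endPt 0 (by norm_num) := rfl
    change |(Δ.vertexPt v).1.1 0| ≤ 1 at h1
    rw [abs_le] at h1
    have h2 : (Δ.vertexPt v).1.1 0 = 1 ∨ (Δ.vertexPt v).1.1 0 = 0 ∨
        (Δ.vertexPt v).1.1 0 = -1 := by omega
    rcases h2 with h2 | h2 | h2
    · rw [hpt 1 (by norm_num) h2]; exact h
    · rw [hpt 0 (by norm_num) h2]; exact ht
    · rw [hpt (-1) (by norm_num) h2]; exact hn
  · rw [← xPos_mul_doublePt]
    exact Ideal.mul_mem_left _ _ hx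

open Polynomial in
/-- The dehomogenization of an element of degree `k` with respect to `χ t`. -/
def dehomog (k : ℕ) (a : Δ.coordRing) : ℂ[X] :=
  ∑ p ∈ a.coeff.support, C (a.coeff p) * X ^ ((k : ℤ) - p.1.1 0).toNat

/-- In degree `k` the exponents `k - m` are nonnegative and distinct, so distinct monomials cannot
cancel. -/
lemma dehomog_ne_zero {k : ℕ} {a : Δ.coordRing} (ha : a ∈ Δ.grading k) (h0 : a ≠ 0) :
    Δ.dehomog k a ≠ 0 := by
  obtain ⟨p, hp⟩ : a.coeff.support.Nonempty := by
    rw [Finsupp.support_nonempty_iff]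
    simpa using h0
  intro h
  have := congrArg (fun P ↦ Polynomial.coeff P ((k : ℤ) - p.1.1 0).toNat) h
  simp only [dehomog, Polynomial.finsetSum_coeff, Polynomial.coeff_C_mul, Polynomial.coeff_X_pow,
    Polynomial.coeff_zero] at this
  rw [Finset.sum_eq_single p] at this
  · simp only [if_true, mul_one] at this
    exact Finsupp.mem_support_iff.1 hp this
  · intro q hq hqp
    rw [if_neg, mul_zero]
    intro h
    apply hqp
    have h1 := (Δ.mem_cone_iff_abs _).1 p.2
    have h2 := (Δ.mem_cone_iff_abs _).1 q.2
    have h3 : p.1.2 = k := ha p hp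
    have h4 : q.1.2 = k := ha q hq
    rw [abs_le] at h1 h2
    refine Subtype.ext (Prod.ext (funext fun i ↦ ?_) (h4.trans h3.symm))
    rw [Subsingleton.elim i 0]
    omega
  · intro h; exact absurd hp h

/-- Multiplied by `(χ t)^k`, the monomial `χ^m t^k` becomes `t^(k-m) (χ t)^(k+m)`; substituting `t =
c χ t` evaluates the dehomogenization at `c`. -/
lemma xPos_pow_mul_sub_mem {k : ℕ} {a : Δ.coordRing} (ha : a ∈ Δ.grading k) (c : ℂ) :
    Δ.xPos ^ k * a - (Δ.dehomog k a).eval c • Δ.xPos ^ (2 * k) ∈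
      Ideal.span {Δ.tEl - c • Δ.xPos} := by
  have hmon (p : Δ.cone) (hp : p.1.2 = k) : Δ.xPos ^ k * Δ.monomial p -
      c ^ ((k : ℤ) - p.1.1 0).toNat • Δ.xPos ^ (2 * k) ∈ Ideal.span {Δ.tEl - c • Δ.xPos} := by
    have h1 := (Δ.mem_cone_iff_abs _).1 p.2
    rw [abs_le] at h1
    obtain ⟨e, he⟩ : ∃ e : ℕ, (k : ℤ) - p.1.1 0 = e := ⟨_, (Int.toNat_of_nonneg (by omega)).symm⟩
    obtain ⟨j, hj⟩ : ∃ j : ℕ, (k : ℤ) + p.1.1 0 = j := ⟨_, (Int.toNat_of_nonneg (by omega)).symm⟩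
    rw [he, Int.toNat_natCast]
    have h2 : Δ.xPos ^ k * Δ.monomial p = Δ.tEl ^ e * Δ.xPos ^ j := by
      rw [xPos, tEl, monomial_pow, monomial_pow, monomial_pow, monomial_mul, monomial_mul]
      congr 1
      refine Subtype.ext (Prod.ext (funext fun i ↦ ?_) ?_)
      · rw [Subsingleton.elim i 0]
        simp [endPt, tPt]
        omega
      · simp [endPt, tPt, hp]
        omega
    have h3 : 2 * k = e + j := by omega
    rw [h2, h3, pow_add, ← smul_mul_assoc, ← smul_pow, ← sub_mul]
    exact Ideal.mul_mem_right _ _ (Ideal.mem_span_singleton.2 (sub_dvd_pow_sub_pow _ _ _))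
  have hsum : Δ.xPos ^ k * a - (Δ.dehomog k a).eval c • Δ.xPos ^ (2 * k) =
      ∑ p ∈ a.coeff.support, a.coeff p • (Δ.xPos ^ k * Δ.monomial p -
        c ^ ((k : ℤ) - p.1.1 0).toNat • Δ.xPos ^ (2 * k)) := by
    simp only [smul_sub, Finset.sum_sub_distrib, ← mul_smul_comm, ← Finset.mul_sum,
      ← Δ.eq_sum_monomial, smul_smul, ← Finset.sum_smul]
    congr 2
    simp [dehomog, Polynomial.eval_finsetSum]
  rw [hsum]
  refine Ideal.sum_mem _ fun p hp ↦ ?_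
  exact Submodule.smul_of_tower_mem _ _ (hmon p (ha p hp))

lemma exists_ne_zero_mem_ideal {I : Δ.toricVariety.IdealSheafData} (hI : Δ.IsAnticanonical I) :
    ∃ s ∈ I.ideal ⟨Proj.basicOpen Δ.grading Δ.xPos, Δ.isAffineOpen_basicOpen Δ.xPos_mem⟩,
      s ≠ 0 := by
  obtain ⟨e⟩ := hI
  refine exists_ne_zero_mem_ideal_of_iso I e _ (Δ.fracSec_t_mem Δ.xPos_mem) fun h ↦ ?_
  have h1 := h.trans (fracSec_zero Δ.xPos_mem (k := 0)).symm
  have h2 := (fracSec_eq_iff_of_isDomain Δ.xPos_mem (Δ.monomial_ne_zero _)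
    (Δ.monomial_mem Δ.tPt) (zero_mem _)).1 h1
  rw [mul_zero, pow_zero, one_mul] at h2
  exact Δ.monomial_ne_zero _ h2

/-- A nonzero equation of `Y` has finitely many zeros on `χ t ≠ 0`. For `c` not among them, the
degree-one section vanishing only at `t = c χ t` has no zero on `Y`, so `Y` is closed in an affine
open. -/
lemma isAffine_subscheme {I : Δ.toricVariety.IdealSheafData} (hI : Δ.IsAnticanonical I) :
    IsAffine I.subscheme := by
  obtain ⟨s, hsI, hs0⟩ := Δ.exists_ne_zero_mem_ideal hI
  obtain ⟨k, a, ha, rfl⟩ := fracSec_surjective Δ.xPos_mem s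
  have ha0 : a ≠ 0 := by
    rintro rfl
    exact hs0 (fracSec_zero _)
  obtain ⟨c, hc⟩ : ∃ c : ℂ, (Δ.dehomog k a).eval c ≠ 0 := by
    by_contra! h
    exact Δ.dehomog_ne_zero ha ha0 (Polynomial.funext fun c ↦ by simp [h c])
  have htop : I.subschemeι ⁻¹ᵁ (Proj.basicOpen Δ.grading (Δ.doublePt c)) = ⊤ := by
    refine top_le_iff.1 fun y _ hy ↦ ?_
    obtain ⟨hx, ht⟩ := Δ.mem_of_doublePt_mem (c := c) (x := I.subschemeι y) hy
    have hyp : (I.subschemeι y).asHomogeneousIdeal.toIdeal.IsPrime := (I.subschemeι y).isPrime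
    have hay : a ∈ (I.subschemeι y).asHomogeneousIdeal.toIdeal := by
      by_contra hay
      exact subschemeι_notMem_basicOpen I _ hsI y
        ((mem_basicOpen_fracSec Δ.xPos_mem ha _).2 ⟨hx, hay⟩)
    have h2 := Ideal.span_le.2 (Set.singleton_subset_iff.2 ht) (Δ.xPos_pow_mul_sub_mem ha c)
    have h3 : (Δ.dehomog k a).eval c • Δ.xPos ^ (2 * k) ∈
        (I.subschemeι y).asHomogeneousIdeal.toIdeal := by
      have := sub_mem (Ideal.mul_mem_left _ (Δ.xPos ^ k) hay) h2
      rwa [sub_sub_cancel] at this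
    have h4 := Submodule.smul_of_tower_mem _ ((Δ.dehomog k a).eval c)⁻¹ h3
    rw [smul_smul, inv_mul_cancel₀ hc, one_smul] at h4
    exact hx (hyp.mem_of_pow_mem _ h4)
  have := (Δ.isAffineOpen_basicOpen (Δ.doublePt_mem c)).preimage I.subschemeι
  rw [htop] at this
  have : IsAffine (⊤ : I.subscheme.Opens).toScheme := this
  exact .of_isIso I.subscheme.topIso.inv

end Segment

variable {n : ℕ} (Δ : ReflexivePolytope n)

lemma subsingleton_vertices (h : n = 0) : Subsingleton Δ.vertices := by
  subst h
  infer_instance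

end ReflexivePolytope

end ToricCY

end

theorem proposition2p2 (n : ℕ) (Δ : ToricCY.ReflexivePolytope n)
    (I : Δ.toricVariety.IdealSheafData) (hY : Δ.IsAnticanonical I) :
    ∃ hL : ∀ i : ℤ, ToricCY.IsCoherent (ToricCY.tensorPow (Δ.lineBundle I) i),
      ∀ F : ToricCY.DbCoh I.subscheme, ¬ CategoryTheory.Limits.IsZero F →
        ∃ i₀ r : ℤ, ∀ i : ℤ, i ≤ i₀ →
          Nontrivial (ToricCY.DbExt r
            (ToricCY.sheafObj (ToricCY.tensorPow (Δ.lineBundle I) i) (hL i)) F) := by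
  by_cases hn : n = 1
  · subst hn
    have := Δ.isAffine_subscheme hY
    -- For `n = 1` the exponent `-(n - 1)` reduces to `0`, so the polarization is the structure
    -- sheaf by definition.
    have hpol : (ToricCY.Charts.whole Δ.toricVariety).HasWeight Δ.polarization 0 :=
      (ToricCY.Charts.whole Δ.toricVariety).hasWeight_structureModule
    exact ToricCY.exists_forall_nontrivial_dbExt
      ((ToricCY.Charts.whole Δ.toricVariety).pullback I.subschemeι)
      (fun _ ↦ isAffineOpen_top I.subscheme) (hpol.pullback I.subschemeι) (Or.inr inferInstance)
  · refine ToricCY.exists_forall_nontrivial_dbExt (Δ.charts.pullback I.subschemeι)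
      (fun v ↦ (Δ.isAffineOpen_charts v).preimage I.subschemeι)
      (Δ.hasWeight_polarization.pullback I.subschemeι) ?_
    by_cases h0 : n = 0
    · exact Or.inr (Δ.subsingleton_vertices h0)
    · exact Or.inl (by omega)
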